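/- **Notation.** For a finite group $\Gamma$, $\mathrm{Irr}(\Gamma)$ is the set of irreducible complex characters. If $N$ is a normal subgroup of $\Gamma$, then $\Gamma$ acts on $\mathrm{Irr}(N)$ by $(x\cdot\theta)(n)=\theta(xnx^{-1})$. **Block-like Clifford setting.** Let $\pi_0:G_0\to K_0$ be a surjective homomorphism of finite groups with $K_0$ cyclic, let $A\ge 1$, and let $F_A=\langle\sigma\rangle$ be cyclic of order $A$. Let $\hat G_A=G_0^A\rtimes F_A$ be the regular wreath product, and let $\kappa:\hat G_A\to K_0$, $\kappa(g\,\sigma^i)=\pi_0(g_1)\cdots\pi_0(g_A)$. Put $\hat H=\ker\kappa$ and $H=\hat H\cap G_0^A$, so that $\hat G_A/H\simeq F_A\times K_0$, $\hat H/H\simeq F_A$ and $\hat G_A/\hat H\simeq K_0$. Suppose given the following data. * A quotient $\bar K_0$ of $K_0$ such that the action of $K_0=\hat G_A/\hat H$ on $\mathrm{Irr}(\hat H)$ factors through $\bar K_0$. * A finite group $G$ containing $\hat H$, in which $H$ is normal with abelian quotient $\pi:G\to K=G/H$. * A homomorphism $j:K\to F_A\times\bar K_0$ which on $\hat H/H=F_A\subset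 K$ is the inclusion of the first factor, and which is compatible with the actions on $\mathrm{Irr}(H)$ and on $\mathrm{Irr}(\hat H)$. That is, if $x\in G$ and $w\in\hat G_A$ have the same image in $F_A\times\bar K_0$ (that of $x$ being taken through $j\circ\pi$), then conjugation by $x$ and conjugation by $w$ act in the same way on $\mathrm{Irr}(H)$ and on $\mathrm{Irr}(\hat H)$. Let $F_B$ be the image of $K$ in $\bar K_0$ and $B=|F_B|$. Assume that the induced map $K\to F_A\times F_B$ is an isomorphism. Let $K'\subset K$ be a subgroup whose projections to $F_A$ and to $F_B$ are surjective. For $\eta\in\mathrm{Irr}(G_0)$ let $\mathrm{Stab}_\eta=\{\xi\in\mathrm{Hom}(K_0,\mathbb C^\times):(\xi\circ\pi_0)\,\eta=\eta\}$ and $$e_A(\eta)=\frac{\gcd(A|\mathrm{Stab}_\eta|,|K_0|)}{\gcd\left(A|\mathrm{Stab}_\eta|,|\bar K_0|/B\right)}.$$ Identify $F_A\times F_B$ with $\mathbb Z/A\times\mathbb Z/B$ by any isomorphisms $F_A\simeq\mathbb Z/A$ and $F_B\simeq\mathbb Z/B$, and for $a,b\in K^g$ put $$\Delta(a,b)=\frac{\gcd(A,B)}{\left|\left\langle\sum_i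 a_i^{(1)}b_i^{(2)}-a_i^{(2)}b_i^{(1)}\right\rangle\right|},$$ where the superscripts indicate the coordinates and the subgroup is taken in $\mathbb Z/\gcd(A,B)$. Let $\mathrm{Irr}(G_0)_{a,b}$ be the set of $\eta\in\mathrm{Irr}(G_0)$ such that $|\mathrm{Stab}_\eta|$ divides $|\bar K_0|/B$ and $e_A(\eta)$ divides $\Delta(a,b)$. For $z=(z_1,\dots,z_A)\in G_0^A$ write $\eta(z)=\prod_{i=1}^A\eta(z_i)$, and for $x,y\in G^g$ write $[x,y]=[x_1,y_1]\cdots[x_g,y_g]$, where $[u,v]=uvu^{-1}v^{-1}$. **Theorem.** In a block-like Clifford setting, let $N$ be a natural number such that $|\mathrm{Stab}_\eta|$ divides $N$ for every $\eta\in\mathrm{Irr}(G_0)$. Let $z\in H$ be an element each of whose coordinates has a $\gcd(AN,|K_0|)$-th root in $G_0$. Then for every positive integer $g$ and all $a,b\in K^g$ whose coordinates together generate $K'$, $$\left|\left\{(x,y)\in G^g\times G^g:\ [x,y]z=1,\ \pi(x)=a,\ \pi(y)=b\right\}\right|=\sum_{\eta\in\mathrm{Irr}(G_0)_{a,b}}\gcd\left(A,\frac{|K_0|}{|\mathrm{Stab}_\eta|}\right)\left(\frac{|\mathrm{Stab}_\eta|}{|K_0|}\right)^{2g}\left(\frac{|G_0|}{\eta(1)}\right)^{A(2g-1)}\eta(z).$$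 -/

import Mathlib

namespace BlockLike

/-- `Irr Γ`: the set of characters of irreducible complex representations of `Γ`. -/
def Irr (Γ : Type*) [Group Γ] : Set (Γ → ℂ) :=
  {χ | ∃ (n : ℕ) (ρ : Representation ℂ Γ (Fin n → ℂ)), ρ.IsIrreducible ∧ ρ.character = χ}

/-- A finite group has finitely many irreducible characters. -/
theorem finite_Irr (Γ : Type*) [Group Γ] [Finite Γ] : (Irr Γ).Finite := by
  classical
  have := Fintype.ofFinite Γ
  have hc : (Nat.card Γ : ℂ) ≠ 0 := by exact_mod_cast Nat.card_pos.ne'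
  have : Invertible (Nat.card Γ : ℂ) := invertibleOfNonzero hc
  have key : ∀ χ ∈ Irr Γ, ∀ ψ ∈ Irr Γ,
      (Nat.card Γ : ℂ)⁻¹ * ∑ g : Γ, χ g * ψ g⁻¹ = if χ = ψ then 1 else 0 := by
    rintro _ ⟨n, ρ, hρ, rfl⟩ _ ⟨m, σ, hσ, rfl⟩
    by_cases h : Nonempty (Representation.Equiv σ ρ)
    · rw [Representation.char_orthonormal, if_pos h, if_pos (Representation.char_iso h.some).symm]
    · have h0 : (Nat.card Γ : ℂ)⁻¹ * ∑ g : Γ, ρ.character g * σ.character g⁻¹ = 0 := by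
        rw [Representation.char_orthonormal, if_neg h]
      have h1 : (Nat.card Γ : ℂ)⁻¹ * ∑ g : Γ, ρ.character g * ρ.character g⁻¹ = 1 := by
        rw [Representation.char_orthonormal, if_pos ⟨Representation.Equiv.refl ρ⟩]
      rw [h0, if_neg]
      intro he
      rw [← he, h1] at h0
      exact one_ne_zero h0
  have hli : LinearIndependent ℂ (fun χ : Irr Γ => (χ : Γ → ℂ)) := by
    rw [linearIndependent_iff']
    intro s c hs ψ hψ
    have h2 : ∑ χ ∈ s, c χ * ((Nat.card Γ : ℂ)⁻¹ * ∑ g : Γ, (χ : Γ → ℂ) g * (ψ : Γ → ℂ) g⁻¹) = 0 := by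
      calc _ = (Nat.card Γ : ℂ)⁻¹ *
              ∑ g : Γ, (∑ χ ∈ s, c χ • (χ : Γ → ℂ)) g * (ψ : Γ → ℂ) g⁻¹ := by
            simp only [Finset.mul_sum, Finset.sum_apply, Pi.smul_apply, smul_eq_mul,
              Finset.sum_mul]
            rw [Finset.sum_comm]
            refine Finset.sum_congr rfl fun _ _ => Finset.sum_congr rfl fun _ _ => by ring
        _ = 0 := by rw [hs]; simp
    rw [Finset.sum_congr rfl fun χ _ => by rw [key χ χ.2 ψ ψ.2]] at h2
    simpa [Subtype.coe_inj, hψ] using h2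
  have : Finite (Irr Γ) := hli.finite_of_isNoetherian
  exact Set.toFinite _

/-- The cyclic group `F_A` of order `A`, written multiplicatively. -/
abbrev F (A : ℕ) : Type := Multiplicative (ZMod A)

section Wreath

variable {A : ℕ} [NeZero A] {G₀ K₀ : Type*} [Group G₀] [CommGroup K₀]

/-- The homomorphism `G₀ ≀ F_A → K₀` sending `(g, σ^i)` to the product of all `π₀ (g_k)`. -/
def prodHom (A : ℕ) [NeZero A] (π₀ : G₀ →* K₀) : (G₀ ≀ᵣ F A) →* K₀ where
  toFun w := ∏ i, π₀ (w.left i)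
  map_one' := by simp
  map_mul' u v := by
    simp only [RegularWreathProduct.mul_left, Pi.mul_apply, map_mul, Finset.prod_mul_distrib]
    congr 1
    exact Fintype.prod_equiv (Equiv.mulLeft u.right⁻¹) _ _ fun _ => rfl

/-- `Ĥ`: the kernel of `G₀ ≀ F_A → K₀`. -/
abbrev Hhat (A : ℕ) [NeZero A] (π₀ : G₀ →* K₀) : Subgroup (G₀ ≀ᵣ F A) := (prodHom A π₀).ker

/-- `H`: the tuples `(g_k) ∈ G₀^A` with `∏ π₀ (g_k) = 1`, viewed inside `G₀ ≀ F_A`; this is the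
kernel of `G₀ ≀ F_A → F_A × K₀`. -/
abbrev H (A : ℕ) [NeZero A] (π₀ : G₀ →* K₀) : Subgroup (G₀ ≀ᵣ F A) :=
  (RegularWreathProduct.rightHom.prod (prodHom A π₀)).ker

theorem H_le_Hhat (A : ℕ) [NeZero A] (π₀ : G₀ →* K₀) : H A π₀ ≤ Hhat A π₀ := by
  intro w hw
  rw [MonoidHom.mem_ker, MonoidHom.prod_apply, Prod.mk_eq_one] at hw
  exact hw.2

/-- For a normal subgroup `N` of `G₀ ≀ F_A` contained in `Ĥ` and a homomorphism `ι : Ĥ → G`: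
conjugation by `x : G` (on the image of `N` in `G`) and conjugation by `w : G₀ ≀ F_A` move every
irreducible character of `N` in the same way. -/
def SameActionOnIrr {π₀ : G₀ →* K₀} {G : Type*} [Group G] (ι : Hhat A π₀ →* G)
    (N : Subgroup (G₀ ≀ᵣ F A)) [N.Normal] (hN : N ≤ Hhat A π₀) (x : G) (w : G₀ ≀ᵣ F A) : Prop :=
  ∀ θ ∈ Irr N, ∀ n n' : N,
    ι (Subgroup.inclusion hN n') = x * ι (Subgroup.inclusion hN n) * x⁻¹ →
      θ n' = θ (MulAut.conjNormal w n)

end Wreath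

/-- A block-like Clifford setting. Here `K₀ → Kbar` is the quotient `K̄₀` of `K₀`, and `Ĥ` is regarded
as a subgroup of `G` through the injection `ι`. -/
structure Setting (A : ℕ) [NeZero A] (G₀ K₀ Kbar G K : Type*) [Group G₀] [CommGroup K₀]
    [CommGroup Kbar] [Group G] [CommGroup K] where
  π₀ : G₀ →* K₀
  π₀_surjective : Function.Surjective π₀
  /-- the quotient map `K₀ → K̄₀` -/
  q : K₀ →* Kbar
  q_surjective : Function.Surjective q
  /-- the action of `K₀ = (G₀ ≀ F_A) / Ĥ` on `Irr Ĥ` factors through `K̄₀` -/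
  action_factors : ∀ w : G₀ ≀ᵣ F A, q (prodHom A π₀ w) = 1 →
    ∀ χ ∈ Irr (Hhat A π₀), ∀ h : Hhat A π₀, χ (MulAut.conjNormal w h) = χ h
  /-- the inclusion of `Ĥ` into `G` -/
  ι : Hhat A π₀ →* G
  ι_injective : Function.Injective ι
  /-- the quotient map of `G` by `H` -/
  π : G →* K
  π_surjective : Function.Surjective π
  ker_π : π.ker = ((H A π₀).subgroupOf (Hhat A π₀)).map ι
  /-- the homomorphism `K → F_A × K̄₀` -/
  j : K →* F A × Kbar
  /-- on `Ĥ / H = F_A ⊆ K` the homomorphism `j` is the inclusion of the first factor -/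
  j_Hhat : ∀ h : Hhat A π₀, j (π (ι h)) = ((h : G₀ ≀ᵣ F A).right, 1)
  /-- `j` is compatible with the actions on `Irr H` -/
  compatible_H : ∀ (x : G) (w : G₀ ≀ᵣ F A), j (π x) = (w.right, q (prodHom A π₀ w)) →
    SameActionOnIrr ι (H A π₀) (H_le_Hhat A π₀) x w
  /-- `j` is compatible with the actions on `Irr Ĥ` -/
  compatible_Hhat : ∀ (x : G) (w : G₀ ≀ᵣ F A), j (π x) = (w.right, q (prodHom A π₀ w)) →
    SameActionOnIrr ι (Hhat A π₀) le_rfl x w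
  /-- with `F_B` the image of `K` in `K̄₀`, the induced map `K → F_A × F_B` is an isomorphism -/
  bijective_prod : Function.Bijective
    (((MonoidHom.fst (F A) Kbar).comp j).prod ((MonoidHom.snd (F A) Kbar).comp j).rangeRestrict)

namespace Setting

variable {A : ℕ} [NeZero A] {G₀ K₀ Kbar G K : Type*} [Group G₀] [CommGroup K₀]
  [CommGroup Kbar] [Group G] [CommGroup K] (S : Setting A G₀ K₀ Kbar G K)

/-- The projection `K → F_A`. -/
def prA : K →* F A := (MonoidHom.fst (F A) Kbar).comp S.j

/-- The group `F_B`, the image of `K` in `K̄₀`. -/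
def FB : Subgroup Kbar := ((MonoidHom.snd (F A) Kbar).comp S.j).range

/-- The projection `K → F_B`. -/
def prB : K →* S.FB := ((MonoidHom.snd (F A) Kbar).comp S.j).rangeRestrict

/-- `B = |F_B|`. -/
noncomputable def B : ℕ := Nat.card S.FB

/-- The stabilizer of `η : G₀ → ℂ` in `Irr K₀ = Hom(K₀, ℂˣ)`, which acts by
`(ξ · η)(x) = ξ(π₀ x) η(x)`. -/
def stab (η : G₀ → ℂ) : Subgroup (K₀ →* ℂˣ) where
  carrier := {ξ | ∀ x, (ξ (S.π₀ x) : ℂ) * η x = η x}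
  one_mem' := by simp
  mul_mem' := by
    intro ξ ζ hξ hζ x
    rw [MonoidHom.mul_apply, Units.val_mul, mul_assoc, hζ x, hξ x]
  inv_mem' := by
    intro ξ hξ x
    rw [MonoidHom.inv_apply, Units.inv_mul_eq_iff_eq_mul, hξ x]

/-- `e_A(η) = gcd(A |Stab η|, |K₀|) / gcd(A |Stab η|, |K̄₀| / B)`. -/
noncomputable def eA (η : G₀ → ℂ) : ℕ :=
  Nat.gcd (A * Nat.card (S.stab η)) (Nat.card K₀) /
    Nat.gcd (A * Nat.card (S.stab η)) (Nat.card Kbar / S.B)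

/-- The element `∑ a_i⁽¹⁾ b_i⁽²⁾ - a_i⁽²⁾ b_i⁽¹⁾` of `ℤ / gcd(A, B)`, where the coordinates are taken
through identifications `α` of `F_A` with `ℤ/A` and `β` of `F_B` with `ℤ/B`. -/
noncomputable def pairing (α : F A ≃* Multiplicative (ZMod A))
    (β : S.FB ≃* Multiplicative (ZMod S.B)) {g : ℕ} (a b : Fin g → K) : ZMod (Nat.gcd A S.B) :=
  let c₁ : K → ZMod (Nat.gcd A S.B) := fun k =>
    ZMod.castHom (Nat.gcd_dvd_left A S.B) _ (Multiplicative.toAdd (α (S.prA k)))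
  let c₂ : K → ZMod (Nat.gcd A S.B) := fun k =>
    ZMod.castHom (Nat.gcd_dvd_right A S.B) _ (Multiplicative.toAdd (β (S.prB k)))
  ∑ i, (c₁ (a i) * c₂ (b i) - c₂ (a i) * c₁ (b i))

/-- `Δ(a,b) = gcd(A,B) / |⟨∑ a_i⁽¹⁾ b_i⁽²⁾ - a_i⁽²⁾ b_i⁽¹⁾⟩|`. -/
noncomputable def Delta (α : F A ≃* Multiplicative (ZMod A))
    (β : S.FB ≃* Multiplicative (ZMod S.B)) {g : ℕ} (a b : Fin g → K) : ℕ :=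
  Nat.gcd A S.B / Nat.card (AddSubgroup.zmultiples (S.pairing α β a b))

/-- `Irr(G₀)_{a,b}`: the irreducible characters `η` of `G₀` such that `|Stab η|` divides `|K̄₀| / B`
and `e_A(η)` divides `Δ(a,b)`. -/
def irrAB (α : F A ≃* Multiplicative (ZMod A))
    (β : S.FB ≃* Multiplicative (ZMod S.B)) {g : ℕ} (a b : Fin g → K) : Set (G₀ → ℂ) :=
  {η ∈ Irr G₀ | Nat.card (S.stab η) ∣ Nat.card Kbar / S.B ∧ S.eA η ∣ S.Delta α β a b}

theorem finite_irrAB [Finite G₀] (α : F A ≃* Multiplicative (ZMod A))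
    (β : S.FB ≃* Multiplicative (ZMod S.B)) {g : ℕ} (a b : Fin g → K) :
    (S.irrAB α β a b).Finite :=
  (finite_Irr G₀).subset fun _ h => h.1

/-- The set of `(x, y) ∈ G^g × G^g` with `[x₁,y₁]⋯[x_g,y_g] z = 1`, `π(x) = a` and `π(y) = b`. -/
def solutions {g : ℕ} (z : Hhat A S.π₀) (a b : Fin g → K) : Set ((Fin g → G) × (Fin g → G)) :=
  {p | (List.ofFn fun i => p.1 i * p.2 i * (p.1 i)⁻¹ * (p.2 i)⁻¹).prod * S.ι z = 1 ∧
    (∀ i, S.π (p.1 i) = a i) ∧ ∀ i, S.π (p.2 i) = b i}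

end Setting

end BlockLike

/-!
The number of solutions is computed with the irreducible characters of `H` alone. Fix `x` and `y` in
`G^g` over `a` and `b`. The solutions correspond to the families in `H × H` at which the product of
commutators of the translated entries equals `z⁻¹`, so that their number is `Psi x y z δ`, where `δ` is
the indicator of `1` and `Psi x y z f` is the sum of `f ([x l, y k] z)` over all families `(l, k)`.
By column orthogonality for `G₀^A`, the function `δ` on `H`
is `|G₀|^{-A} ∑ ∏ χ_i(1) ∏ χ_i`, summed over tuples `χ` of irreducible characters of `G₀` indexed by `F_A`
(`card_mul_ncard_solutions`). It remains to evaluate `Psi` on such a tuple.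

If `ρ` is an irreducible representation of `H`, averaging over `H` shows that `Psi` vanishes on its
character as soon as some `x_i` or `y_i` moves this character (`Psi_eq_zero`). Expand a tuple into
irreducible characters of `H`. If a constituent is fixed by all `x_i` and `y_i`, then, since these
generate a group mapping onto `F_A`, every translation of the indices twists the tuple by a linear
character of `K₀` (`mem_tupleSymm_of_Psi_ne_zero`). Hence only the tuples `(η, ξ η, ξ² η, …)` with `ξ^A`
in the stabilizer of `η` contribute, and each of them arises from `|Stab η|` twists `ξ`
(`sum_tuples_eq`).

For such a tuple let `ζ` generate the stabilizer. The operator realizing `ζ η = η` has a tensor power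
acting on the representation of `G₀^A` with character `∏ ξ^i η`; its eigenspaces are the irreducible
constituents on `H`, one for each `|Stab η|`-th root of unity, of equal degree. They are irreducible and
distinct because the norm of the tuple on `H` is `|Stab η|` (`trace_baseRep_pieces`). A cyclic shift of the
tensor factors, corrected at the last factor, extends each constituent to `Ĥ` (`exists_pieces`), and
conjugation by an element of the base group multiplies the extension by a power of `ξ`. The
compatibility with the actions on `Irr H` shows that `ζ` factors through `K̄₀`, and the hypothesis on the
action of `K₀` on `Irr Ĥ` shows that `ξ` does. If `ζ` is nontrivial on `F_B`, the constituents are moved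
and contribute nothing. Otherwise an element `u` of `G` over the generator of `F_B` intertwines the
extension with its twist by `ξ`, and the commutator sums are those of Frobenius, multiplied by the value
of `ξ` at a lift of the generator to the power of the pairing of `a` and `b` (`commSum_eq_smul`,
`Psi_chi`).

The twists `ξ` with `ξ^A` in the stabilizer form a cyclic group of order `gcd(A |Stab η|, |K₀|)`, and the sum
of the values just described is this order if the pairing is divisible by `e_A(η)`, and `0` otherwise. Here
`ζ` is trivial on `F_B` exactly when `|Stab η|` divides `|K̄₀| / B`, because `F_B` is the group of
`|K̄₀| / B`-th powers (`trivial_above_FB_iff`, `eA_dvd_Delta_iff`). The root condition on `z` makes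
`∏ (ξ^i η)(z_i)` independent of `ξ`.
-/

namespace BlockLike

open Module Matrix
open scoped commutatorElement

/-! ### Characters of matrix representations -/

section RepTheory

variable {Γ : Type*} [Group Γ]

/-- The bilinear pairing `|Γ|⁻¹ ∑ f(x) f'(x⁻¹)` of functions on a finite group; on characters it is the
usual Hermitian inner product. -/
noncomputable def ip [Finite Γ] (f f' : Γ → ℂ) : ℂ :=
  letI := Fintype.ofFinite Γ
  (Nat.card Γ : ℂ)⁻¹ * ∑ x, f x * f' x⁻¹

theorem ip_eq [Fintype Γ] (f f' : Γ → ℂ) :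
    ip f f' = (Nat.card Γ : ℂ)⁻¹ * ∑ x, f x * f' x⁻¹ := by
  unfold ip
  congr!

/-- The trace character of a representation by matrices. -/
def chr {d : Type*} [Fintype d] [DecidableEq d] (ρ : Γ →* Matrix d d ℂ) : Γ → ℂ :=
  fun x => (ρ x).trace

/-- A representation by matrices, as a representation on column vectors. -/
noncomputable def matRep {d : Type*} [Fintype d] [DecidableEq d] (ρ : Γ →* Matrix d d ℂ) :
    Representation ℂ Γ (d → ℂ) :=
  ((Matrix.toLinAlgEquiv' : Matrix d d ℂ ≃ₐ[ℂ] _) : Matrix d d ℂ →* _).comp ρ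

theorem matRep_apply {d : Type*} [Fintype d] [DecidableEq d] (ρ : Γ →* Matrix d d ℂ) (x : Γ) :
    matRep ρ x = Matrix.toLin' (ρ x) := rfl

theorem character_matRep {d : Type*} [Fintype d] [DecidableEq d] (ρ : Γ →* Matrix d d ℂ) :
    (matRep ρ).character = chr ρ := by
  ext x
  simp [Representation.character, matRep_apply, chr, Matrix.trace_toLin'_eq]

/-- Every representation is equivalent to one by matrices. -/
theorem exists_matrix_rep {V : Type*} [AddCommGroup V] [Module ℂ V] [FiniteDimensional ℂ V]
    (ρ : Representation ℂ Γ V) : ∃ (n : ℕ) (ρ' : Γ →* Matrix (Fin n) (Fin n) ℂ),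
    chr ρ' = ρ.character := by
  let b := finBasis ℂ V
  refine ⟨finrank ℂ V, ((LinearMap.toMatrixAlgEquiv b : _ ≃ₐ[ℂ] _) : (V →ₗ[ℂ] V) →* _).comp ρ, ?_⟩
  ext x
  rw [Representation.character, LinearMap.trace_eq_matrix_trace ℂ b]
  rfl

section Finite

variable [Finite Γ]

theorem natCard_ne_zero : (Nat.card Γ : ℂ) ≠ 0 := by exact_mod_cast Nat.card_pos.ne'

section General

variable {V W : Type*} [AddCommGroup V] [Module ℂ V] [FiniteDimensional ℂ V]
  [AddCommGroup W] [Module ℂ W] [FiniteDimensional ℂ W]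
  (ρ : Representation ℂ Γ V) (τ : Representation ℂ Γ W)

/-- The pairing of two characters is the dimension of the space of intertwining maps. -/
theorem ip_character : ip ρ.character τ.character =
    (finrank ℂ (Representation.IntertwiningMap τ ρ) : ℂ) := by
  have := Fintype.ofFinite Γ
  have : Invertible (Nat.card Γ : ℂ) := invertibleOfNonzero natCard_ne_zero
  rw [ip_eq, Representation.card_inv_mul_sum_char_mul_char_eq_finrank]

/-- If the endomorphisms of `ρ` are the scalars, then by Maschke's theorem the projection to any
subrepresentation is one of them, hence `0` or `1`. -/
theorem isIrreducible_of_ip_eq_one (h : ip ρ.character ρ.character = 1) : ρ.IsIrreducible := by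
  rw [ip_character] at h
  have h1 : finrank ℂ (Representation.IntertwiningMap ρ ρ) = 1 := by exact_mod_cast h
  -- a zero identity map would leave only the zero endomorphism
  have hid : Representation.IntertwiningMap.id ρ ≠ 0 := by
    intro h0
    have : Subsingleton (Representation.IntertwiningMap ρ ρ) := by
      refine ⟨fun f f' => ?_⟩
      have hf : ∀ f : Representation.IntertwiningMap ρ ρ, f = 0 := by
        intro f
        ext v
        have : v = 0 := congrArg (fun F : Representation.IntertwiningMap ρ ρ => F v) h0
        rw [this]; simp
      rw [hf f, hf f']
    rw [finrank_zero_of_subsingleton] at h1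
    exact zero_ne_one h1
  have hsc := (finrank_eq_one_iff_of_nonzero' _ hid).1 h1
  have : NeZero (Nat.card Γ : ℂ) := ⟨natCard_ne_zero⟩
  have hss : Representation.IsSemisimpleRepresentation ρ := inferInstance
  refine { exists_pair_ne := ⟨⊥, ⊤, ?_⟩, eq_bot_or_eq_top := ?_ }
  · intro hbt
    apply hid
    ext v
    have hv : v ∈ (⊥ : Subrepresentation ρ) := by
      rw [hbt]; exact Submodule.mem_top (R := ℂ)
    exact (Submodule.mem_bot ℂ).1 hv
  · intro p
    obtain ⟨q, hpq⟩ := hss.exists_isCompl p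
    have hc : IsCompl p.toSubmodule q.toSubmodule := by
      refine ⟨?_, ?_⟩
      · rw [disjoint_iff]
        have := hpq.inf_eq_bot
        rw [← Subrepresentation.toSubmodule_inf, this]; rfl
      · rw [codisjoint_iff]
        have := hpq.sup_eq_top
        rw [← Subrepresentation.toSubmodule_sup, this]; rfl
    -- the projection onto `p` along `q` commutes with `Γ`, hence is a scalar
    let f : Representation.IntertwiningMap ρ ρ :=
      { toLinearMap := p.toSubmodule.projection q.toSubmodule hc
        isIntertwining' := by
          intro g
          ext v
          obtain ⟨y, z, hy, hz, rfl⟩ : ∃ y z, y ∈ p.toSubmodule ∧ z ∈ q.toSubmodule ∧ y + z = v := by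
            have : v ∈ p.toSubmodule ⊔ q.toSubmodule := by rw [hc.sup_eq_top]; trivial
            obtain ⟨y, hy, z, hz, h⟩ := Submodule.mem_sup.1 this
            exact ⟨y, z, hy, hz, h⟩
          have h1 := p.apply_mem_toSubmodule g hy
          have h2 := q.apply_mem_toSubmodule g hz
          simp only [LinearMap.comp_apply, map_add]
          rw [Submodule.projection_apply_of_mem_left hc h1, Submodule.projection_apply_of_mem_left hc hy,
            Submodule.projection_apply_of_mem_right hc h2, Submodule.projection_apply_of_mem_right hc hz]
          simp }
    obtain ⟨c, hcf⟩ := hsc f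
    have hcf' : ∀ v, c • v = p.toSubmodule.projection q.toSubmodule hc v := fun v =>
      congrArg (fun F : Representation.IntertwiningMap ρ ρ => F v) hcf
    by_cases h0 : c = 0
    · left
      apply Subrepresentation.toSubmodule_injective
      refine (Submodule.eq_bot_iff _).2 fun v hv => ?_
      have := hcf' v
      rw [Submodule.projection_apply_of_mem_left hc hv, h0, zero_smul] at this
      exact this.symm
    · right
      apply Subrepresentation.toSubmodule_injective
      refine Submodule.eq_top_iff'.2 fun v => ?_
      have h2 : v = c⁻¹ • p.toSubmodule.projection q.toSubmodule hc v := by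
        rw [← hcf' v, smul_smul, inv_mul_cancel₀ h0, one_smul]
      rw [h2]
      exact Submodule.smul_mem _ _ (by simp)

theorem ip_eq_one_of_isIrreducible (h : ρ.IsIrreducible) : ip ρ.character ρ.character = 1 := by
  rw [ip_character, Representation.IsIrreducible.finrank_intertwiningMap_self]; simp

end General

/-- The irreducibility criterion: membership in `Irr` is a statement about the character alone. -/
theorem chr_mem_Irr_iff {d : Type*} [Fintype d] [DecidableEq d] (ρ : Γ →* Matrix d d ℂ) :
    chr ρ ∈ Irr Γ ↔ ip (chr ρ) (chr ρ) = 1 := by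
  constructor
  · rintro ⟨n, τ, hτ, h⟩
    rw [← h, ip_eq_one_of_isIrreducible τ hτ]
  · intro h
    obtain ⟨n, ρ', hρ'⟩ := exists_matrix_rep (matRep ρ)
    rw [character_matRep] at hρ'
    refine ⟨n, matRep ρ', ?_, by rw [character_matRep, hρ']⟩
    apply isIrreducible_of_ip_eq_one
    rw [character_matRep, hρ', h]

theorem character_mem_Irr {V : Type*} [AddCommGroup V] [Module ℂ V] [FiniteDimensional ℂ V]
    (ρ : Representation ℂ Γ V) (h : ρ.IsIrreducible) : ρ.character ∈ Irr Γ := by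
  obtain ⟨n, ρ', hρ'⟩ := exists_matrix_rep ρ
  rw [← hρ', chr_mem_Irr_iff, hρ', ip_eq_one_of_isIrreducible ρ h]

omit [Finite Γ] in
theorem exists_matrix_of_mem_Irr {χ : Γ → ℂ} (h : χ ∈ Irr Γ) :
    ∃ (n : ℕ) (ρ : Γ →* Matrix (Fin n) (Fin n) ℂ), chr ρ = χ := by
  obtain ⟨n, ρ, -, rfl⟩ := h
  exact exists_matrix_rep ρ

theorem isIrreducible_matRep {d : Type*} [Fintype d] [DecidableEq d] {ρ : Γ →* Matrix d d ℂ}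
    (h : chr ρ ∈ Irr Γ) : (matRep ρ).IsIrreducible := by
  apply isIrreducible_of_ip_eq_one
  rw [character_matRep, (chr_mem_Irr_iff ρ).1 h]

theorem ip_of_mem_Irr [DecidableEq (Γ → ℂ)] {χ ψ : Γ → ℂ} (hχ : χ ∈ Irr Γ) (hψ : ψ ∈ Irr Γ) :
    ip χ ψ = if χ = ψ then 1 else 0 := by
  split_ifs with h
  · subst h
    obtain ⟨n, ρ, rfl⟩ := exists_matrix_of_mem_Irr hχ
    exact (chr_mem_Irr_iff ρ).1 hχ
  · obtain ⟨n, ρ, hρ, rfl⟩ := hχ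
    obtain ⟨m, τ, hτ, rfl⟩ := hψ
    have := Fintype.ofFinite Γ
    have : Invertible (Nat.card Γ : ℂ) := invertibleOfNonzero natCard_ne_zero
    rw [ip_eq, Representation.char_orthonormal, if_neg]
    rintro ⟨e⟩
    exact h (Representation.char_iso e).symm

section Matrices

variable {d e : Type*} [Fintype d] [DecidableEq d] [Fintype e] [DecidableEq e]

/-- The inner product of two characters is a natural number. -/
theorem ip_chr_nat (ρ : Γ →* Matrix d d ℂ) (τ : Γ →* Matrix e e ℂ) :
    ∃ n : ℕ, ip (chr ρ) (chr τ) = n := by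
  rw [← character_matRep, ← character_matRep, ip_character]
  exact ⟨_, rfl⟩

theorem nonempty_of_mem_Irr {ρ : Γ →* Matrix d d ℂ} (h : chr ρ ∈ Irr Γ) : Nonempty d := by
  by_contra hd
  rw [not_nonempty_iff] at hd
  have h1 := (chr_mem_Irr_iff ρ).1 h
  have : chr ρ = 0 := by ext x; simp [chr, Matrix.trace]
  rw [this] at h1
  simp [ip] at h1

/-- Schur's lemma for matrices commuting with an irreducible representation. -/
theorem schur_scalar {ρ : Γ →* Matrix d d ℂ} (h : chr ρ ∈ Irr Γ) (M : Matrix d d ℂ)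
    (hM : ∀ x, ρ x * M = M * ρ x) : ∃ c : ℂ, M = c • 1 := by
  have := isIrreducible_matRep h
  let f : Representation.IntertwiningMap (matRep ρ) (matRep ρ) :=
    { toLinearMap := Matrix.toLin' M
      isIntertwining' := by
        intro x
        rw [matRep_apply, ← Matrix.toLin'_mul, ← Matrix.toLin'_mul, hM] }
  obtain ⟨c, hc⟩ :=
    (Representation.IsIrreducible.algebraMap_intertwiningMap_bijective_of_isAlgClosed
      (ρ := matRep ρ)).2 f
  refine ⟨c, ?_⟩
  apply Matrix.toLin'.injective
  have h1 : f.toLinearMap = Matrix.toLin' M := rfl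
  rw [← h1, ← hc, map_smul, Matrix.toLin'_one]
  rfl

/-- Two irreducible representations with the same character are conjugate. -/
theorem exists_intertwiner {ρ τ : Γ →* Matrix d d ℂ} (h : chr ρ ∈ Irr Γ) (hρτ : chr ρ = chr τ) :
    ∃ Q : (Matrix d d ℂ)ˣ, ∀ x, τ x * Q = Q * ρ x := by
  have h1 := isIrreducible_matRep h
  have h2 := isIrreducible_matRep (hρτ ▸ h)
  have := Fintype.ofFinite Γ
  have : Invertible (Nat.card Γ : ℂ) := invertibleOfNonzero natCard_ne_zero
  have h3 := Representation.char_orthonormal (matRep τ) (matRep ρ)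
  rw [character_matRep, character_matRep, ← hρτ, ← ip_eq, (chr_mem_Irr_iff ρ).1 h] at h3
  have h4 : Nonempty ((matRep ρ).Equiv (matRep τ)) := by
    by_contra hn
    rw [if_neg hn] at h3
    exact one_ne_zero h3
  obtain ⟨φ⟩ := h4
  have hl : ∀ v, φ.symm (φ v) = v := fun v => φ.symm_apply_apply v
  have hr : ∀ v, φ (φ.symm v) = v := fun v => φ.apply_symm_apply v
  refine ⟨⟨LinearMap.toMatrix' φ.toLinearMap, LinearMap.toMatrix' φ.symm.toLinearMap, ?_, ?_⟩, ?_⟩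
  · rw [← LinearMap.toMatrix'_comp, ← LinearMap.toMatrix'_id]
    congr 1
    exact LinearMap.ext hr
  · rw [← LinearMap.toMatrix'_comp, ← LinearMap.toMatrix'_id]
    congr 1
    exact LinearMap.ext hl
  · intro x
    have := φ.isIntertwining' x
    have h5 := congrArg LinearMap.toMatrix' this
    rw [LinearMap.toMatrix'_comp, LinearMap.toMatrix'_comp, matRep_apply, matRep_apply,
      LinearMap.toMatrix'_toLin', LinearMap.toMatrix'_toLin'] at h5
    exact h5.symm

/-- Schur's lemma for representations with orthogonal characters. -/
theorem intertwiner_eq_zero {ρ : Γ →* Matrix d d ℂ} {τ : Γ →* Matrix e e ℂ}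
    (h : ip (chr τ) (chr ρ) = 0) (M : Matrix e d ℂ) (hM : ∀ x, τ x * M = M * ρ x) : M = 0 := by
  rw [← character_matRep, ← character_matRep, ip_character] at h
  have h1 : finrank ℂ (Representation.IntertwiningMap (matRep ρ) (matRep τ)) = 0 := by
    exact_mod_cast h
  have : FiniteDimensional ℂ (Representation.IntertwiningMap (matRep ρ) (matRep τ)) :=
    Module.Finite.equiv (Representation.invariantsEquivIntertwiningMap (matRep ρ) (matRep τ))
  have h2 := finrank_zero_iff.1 h1
  let f : Representation.IntertwiningMap (matRep ρ) (matRep τ) :=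
    { toLinearMap := Matrix.toLin' M
      isIntertwining' := by
        intro x
        rw [matRep_apply, matRep_apply, ← Matrix.toLin'_mul, ← Matrix.toLin'_mul, hM] }
  apply Matrix.toLin'.injective
  have h3 : f.toLinearMap = Matrix.toLin' M := rfl
  rw [← h3, Subsingleton.elim f 0]
  simp

end Matrices

end Finite

end RepTheory

/-! ### Decomposition into irreducible characters -/

section Decomposition

variable {Γ : Type*} [Group Γ]

theorem character_eq_add_of_isCompl {V : Type*} [AddCommGroup V] [Module ℂ V]
    [FiniteDimensional ℂ V] (ρ : Representation ℂ Γ V) (p q : Subrepresentation ρ)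
    (hc : IsCompl p.toSubmodule q.toSubmodule) :
    ρ.character = p.toRepresentation.character + q.toRepresentation.character := by
  ext x
  have h : ρ x = (Submodule.prodEquivOfIsCompl _ _ hc).conj
      (LinearMap.prodMap (p.toRepresentation x) (q.toRepresentation x)) := by
    apply LinearMap.ext
    intro v
    obtain ⟨w, rfl⟩ := (Submodule.prodEquivOfIsCompl _ _ hc).surjective v
    obtain ⟨y, z⟩ := w
    rw [LinearEquiv.conj_apply, LinearMap.comp_apply, LinearMap.comp_apply, LinearEquiv.coe_coe,
      LinearEquiv.coe_coe, LinearEquiv.symm_apply_apply, LinearMap.prodMap_apply,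
      Submodule.coe_prodEquivOfIsCompl', Submodule.coe_prodEquivOfIsCompl', map_add]
    rfl
  rw [Representation.character, h, LinearMap.trace_conj', LinearMap.trace_prodMap']
  rfl

variable [Finite Γ]

/-- Complete reducibility at the level of characters. -/
theorem exists_multiset_irr (n : ℕ) : ∀ {V : Type*} [AddCommGroup V] [Module ℂ V]
    [FiniteDimensional ℂ V] (ρ : Representation ℂ Γ V), finrank ℂ V = n →
    ∃ s : Multiset (Γ → ℂ), (∀ θ ∈ s, θ ∈ Irr Γ) ∧ ρ.character = s.sum := by
  induction n using Nat.strong_induction_on with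
  | _ n ih =>
    intro V _ _ _ ρ hn
    by_cases h0 : n = 0
    · refine ⟨0, by simp, ?_⟩
      have := finrank_zero_iff.1 (hn.trans h0)
      ext x
      have h1 : ρ x = 0 := by ext v; exact Subsingleton.elim _ _
      simp [Representation.character, h1]
    by_cases hirr : ρ.IsIrreducible
    · exact ⟨{ρ.character}, by simpa using character_mem_Irr ρ hirr, by simp⟩
    have : NeZero (Nat.card Γ : ℂ) := ⟨natCard_ne_zero⟩
    have hss : Representation.IsSemisimpleRepresentation ρ := inferInstance
    have hbt : (⊥ : Subrepresentation ρ) ≠ ⊤ := by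
      intro h
      have hV : (⊥ : Submodule ℂ V) = ⊤ := congrArg Subrepresentation.toSubmodule h
      have := finrank_top ℂ V
      rw [← hV, finrank_bot] at this
      omega
    obtain ⟨p, hpb, hpt⟩ : ∃ p : Subrepresentation ρ, p ≠ ⊥ ∧ p ≠ ⊤ := by
      by_contra! hall
      exact hirr { exists_pair_ne := ⟨⊥, ⊤, hbt⟩, eq_bot_or_eq_top := fun p => by
                    by_cases hp : p = ⊥
                    · exact Or.inl hp
                    · exact Or.inr (hall p hp) }
    obtain ⟨q, hpq⟩ := hss.exists_isCompl p
    have hc : IsCompl p.toSubmodule q.toSubmodule := by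
      refine ⟨?_, ?_⟩
      · rw [disjoint_iff, ← Subrepresentation.toSubmodule_inf, hpq.inf_eq_bot]; rfl
      · rw [codisjoint_iff, ← Subrepresentation.toSubmodule_sup, hpq.sup_eq_top]; rfl
    have hadd := Submodule.finrank_add_eq_of_isCompl hc
    have hp0 : finrank ℂ p.toSubmodule ≠ 0 := by
      intro h
      exact hpb (Subrepresentation.toSubmodule_injective (Submodule.finrank_eq_zero.1 h))
    have hp1 : finrank ℂ p.toSubmodule ≠ finrank ℂ V := by
      intro h
      exact hpt (Subrepresentation.toSubmodule_injective (Submodule.eq_top_of_finrank_eq h))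
    have hle : finrank ℂ p.toSubmodule ≤ finrank ℂ V := Submodule.finrank_le _
    obtain ⟨s, hs, hs'⟩ := ih _ (by omega) p.toRepresentation rfl
    obtain ⟨t, ht, ht'⟩ := ih _ (by omega) q.toRepresentation rfl
    refine ⟨s + t, fun θ hθ => (Multiset.mem_add.1 hθ).elim (hs θ) (ht θ), ?_⟩
    rw [character_eq_add_of_isCompl ρ p q hc, hs', ht', Multiset.sum_add]

theorem ip_add_left (f f' g : Γ → ℂ) : ip (f + f') g = ip f g + ip f' g := by
  simp [ip, add_mul, Finset.sum_add_distrib, mul_add]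

theorem ip_sum_left {ι : Type*} (s : Finset ι) (f : ι → Γ → ℂ) (g : Γ → ℂ) :
    ip (fun x => ∑ i ∈ s, f i x) g = ∑ i ∈ s, ip (f i) g := by
  have := Fintype.ofFinite Γ
  simp only [ip_eq, Finset.mul_sum, Finset.sum_mul]
  rw [Finset.sum_comm]

theorem ip_smul_left (c : ℂ) (f g : Γ → ℂ) : ip (fun x => c * f x) g = c * ip f g := by
  have := Fintype.ofFinite Γ
  simp only [ip_eq, Finset.mul_sum]
  exact Finset.sum_congr rfl fun _ _ => by ring

theorem ip_comm (f g : Γ → ℂ) : ip f g = ip g f := by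
  have := Fintype.ofFinite Γ
  simp only [ip_eq]
  congr 1
  exact Fintype.sum_equiv (Equiv.inv Γ) _ _ fun x => by simp [mul_comm]

variable (Γ) in
/-- The irreducible characters as a finset. -/
noncomputable def irrFinset : Finset (Γ → ℂ) := (finite_Irr Γ).toFinset

theorem mem_irrFinset {θ : Γ → ℂ} : θ ∈ irrFinset Γ ↔ θ ∈ Irr Γ := by simp [irrFinset]

/-- A character is the combination of the irreducible characters with its multiplicities. -/
theorem chr_eq_sum_ip {d : Type*} [Fintype d] [DecidableEq d] (ρ : Γ →* Matrix d d ℂ) (x : Γ) :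
    chr ρ x = ∑ θ ∈ irrFinset Γ, ip (chr ρ) θ * θ x := by
  classical
  obtain ⟨s, hs, hs'⟩ := exists_multiset_irr _ (matRep ρ) rfl
  rw [character_matRep] at hs'
  rw [hs']
  clear hs'
  induction s using Multiset.induction_on with
  | empty => simp [ip]
  | cons a s ih =>
    rw [Multiset.sum_cons, Pi.add_apply, ih fun θ hθ => hs θ (Multiset.mem_cons_of_mem hθ)]
    simp only [ip_add_left, add_mul, Finset.sum_add_distrib]
    congr 1
    have ha := hs a (Multiset.mem_cons_self a s)
    rw [Finset.sum_eq_single_of_mem a (mem_irrFinset.2 ha)]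
    · rw [ip_of_mem_Irr ha ha, if_pos rfl, one_mul]
    · intro b hb hba
      rw [ip_of_mem_Irr ha (mem_irrFinset.1 hb), if_neg (Ne.symm hba), zero_mul]

theorem irr_one_ne_zero {χ : Γ → ℂ} (h : χ ∈ Irr Γ) : χ 1 ≠ 0 := by
  obtain ⟨n, ρ, rfl⟩ := exists_matrix_of_mem_Irr h
  have := nonempty_of_mem_Irr h
  simp [chr, Fin.pos_iff_nonempty.2 this |>.ne']

/-- The decomposition of the regular character. -/
theorem sum_irr_one_mul [DecidableEq Γ] (x : Γ) :
    ∑ θ ∈ irrFinset Γ, θ 1 * θ x = if x = 1 then (Nat.card Γ : ℂ) else 0 := by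
  have := Fintype.ofFinite Γ
  -- the regular representation, by permutation matrices
  let reg : Γ →* Matrix Γ Γ ℂ :=
    { toFun := fun x => Matrix.of fun i j => if i = x * j then 1 else 0
      map_one' := by ext i j; simp [Matrix.one_apply]
      map_mul' := by
        intro x y
        ext i j
        simp [Matrix.mul_apply, mul_assoc] }
  have hreg : ∀ x, chr reg x = if x = 1 then (Nat.card Γ : ℂ) else 0 := by
    intro x
    simp only [chr, reg, Matrix.trace, MonoidHom.coe_mk, OneHom.coe_mk, Matrix.diag_apply,
      Matrix.of_apply, right_eq_mul]
    split_ifs <;> simp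
  rw [← hreg, chr_eq_sum_ip]
  refine Finset.sum_congr rfl fun θ _ => ?_
  congr 1
  simp only [ip_eq, hreg, ite_mul, zero_mul, Finset.sum_ite_eq', Finset.mem_univ, if_true, inv_one]
  rw [inv_mul_cancel_left₀ natCard_ne_zero]

end Decomposition

/-! ### Frobenius sums over cosets of a normal subgroup -/

section Schur

variable {Γ : Type*} [Group Γ] [Fintype Γ] {d : Type*} [Fintype d] [DecidableEq d]

/-- Averaging a matrix over an irreducible representation gives a scalar. -/
theorem sum_conj_eq {ρ : Γ →* Matrix d d ℂ} (h : chr ρ ∈ Irr Γ) (M : Matrix d d ℂ) :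
    ∑ x, ρ x * M * ρ x⁻¹ = ((Nat.card Γ : ℂ) / Fintype.card d * M.trace) • 1 := by
  have hd := nonempty_of_mem_Irr h
  obtain ⟨c, hc⟩ := schur_scalar h (∑ x, ρ x * M * ρ x⁻¹) fun y => by
    rw [Finset.mul_sum, Finset.sum_mul]
    refine Fintype.sum_equiv (Equiv.mulLeft y) _ _ fun x => ?_
    have : ρ y⁻¹ * ρ y = 1 := by rw [← map_mul, inv_mul_cancel, map_one]
    simp only [Equiv.coe_mulLeft, map_mul, _root_.mul_inv_rev, mul_assoc, this, mul_one]
  have ht := congrArg Matrix.trace hc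
  have h1 : ∀ x, (ρ x * M * ρ x⁻¹).trace = M.trace := fun x => by
    rw [Matrix.trace_mul_comm, ← mul_assoc, ← map_mul, inv_mul_cancel, map_one, one_mul]
  rw [Matrix.trace_sum, Finset.sum_congr rfl fun x _ => h1 x, Matrix.trace_smul, Matrix.trace_one,
    Finset.sum_const, Finset.card_univ, nsmul_eq_mul, smul_eq_mul] at ht
  have hd0 : (Fintype.card d : ℂ) ≠ 0 := by exact_mod_cast Fintype.card_ne_zero
  rw [hc, Nat.card_eq_fintype_card, div_mul_eq_mul_div, ht, mul_div_cancel_right₀ _ hd0]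

/-- An irreducible representation spans the full matrix algebra: the expansion of a matrix. -/
theorem sum_trace_smul {ρ : Γ →* Matrix d d ℂ} (h : chr ρ ∈ Irr Γ) (B : Matrix d d ℂ) :
    ∑ x, (B * ρ x).trace • ρ x⁻¹ = ((Nat.card Γ : ℂ) / Fintype.card d) • B := by
  -- Schur orthogonality of matrix coefficients, from averaging an elementary matrix
  have key : ∀ a b i j, ∑ x, ρ x i a * ρ x⁻¹ b j =
      if i = j ∧ a = b then (Nat.card Γ : ℂ) / Fintype.card d else 0 := by
    intro a b i j
    have := congrFun (congrFun (sum_conj_eq h (Matrix.single a b 1)) i) j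
    rw [Matrix.sum_apply, Matrix.smul_apply, Matrix.one_apply] at this
    rw [Finset.sum_congr rfl fun x _ => show ρ x i a * ρ x⁻¹ b j =
      (ρ x * Matrix.single a b (1 : ℂ) * ρ x⁻¹) i j from ?_, this]
    · by_cases hab : a = b
      · subst hab
        by_cases hij : i = j <;> simp [hij]
      · rw [Matrix.trace_single_eq_of_ne _ _ _ hab]
        simp [hab]
    · rw [Matrix.mul_apply, Finset.sum_eq_single b]
      · rw [Matrix.mul_single_apply_same, mul_one]
      · intro c _ hcb
        rw [Matrix.mul_single_apply_of_ne _ _ _ _ _ hcb, zero_mul]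
      · simp
  ext p q
  simp only [Matrix.sum_apply, Matrix.smul_apply, smul_eq_mul, Matrix.trace, Matrix.diag_apply,
    Matrix.mul_apply, Finset.sum_mul]
  rw [Finset.sum_comm]
  have h2 : ∀ u, ∑ x, ∑ v, B u v * ρ x v u * ρ x⁻¹ p q =
      ∑ v, B u v * (if v = q ∧ u = p then (Nat.card Γ : ℂ) / Fintype.card d else 0) := by
    intro u
    rw [Finset.sum_comm]
    refine Finset.sum_congr rfl fun v _ => ?_
    rw [← key, Finset.mul_sum]
    exact Finset.sum_congr rfl fun x _ => by ring
  rw [Finset.sum_congr rfl fun u _ => h2 u, Finset.sum_eq_single p, Finset.sum_eq_single q]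
  · simp [mul_comm]
  · intro v _ hv; simp [hv]
  · simp
  · intro u _ hu; simp [hu]
  · simp

/-- The Frobenius sum over commutators, twisted by two fixed invertible matrices. -/
theorem sum_commutator_eq {ρ : Γ →* Matrix d d ℂ} (h : chr ρ ∈ Irr Γ) (P Q : (Matrix d d ℂ)ˣ) :
    ∑ l, ∑ k, (P : Matrix d d ℂ) * ρ l * Q * ρ k * (ρ l⁻¹ * P⁻¹.val * ρ k⁻¹ * Q⁻¹.val) =
      ((Nat.card Γ : ℂ) / Fintype.card d) ^ 2 • (1 : Matrix d d ℂ) := by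
  rw [Finset.sum_comm]
  have h1 : ∀ k, ∑ l, (P : Matrix d d ℂ) * ρ l * Q * ρ k * (ρ l⁻¹ * P⁻¹.val * ρ k⁻¹ * Q⁻¹.val) =
      ((Nat.card Γ : ℂ) / Fintype.card d) • ((Q.val * ρ k).trace • ρ k⁻¹) * Q⁻¹.val := by
    intro k
    have h2 : ∀ l, (P : Matrix d d ℂ) * ρ l * Q * ρ k * (ρ l⁻¹ * P⁻¹.val * ρ k⁻¹ * Q⁻¹.val) =
        P.val * (ρ l * (Q.val * ρ k) * ρ l⁻¹) * (P⁻¹.val * ρ k⁻¹ * Q⁻¹.val) := fun l => by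
      simp only [mul_assoc]
    rw [Finset.sum_congr rfl fun l _ => h2 l, ← Finset.sum_mul, ← Finset.mul_sum, sum_conj_eq h,
      mul_smul_comm, mul_one, smul_mul_assoc, ← mul_assoc, ← mul_assoc, Units.mul_inv, one_mul,
      mul_smul, smul_mul_assoc, smul_mul_assoc]
  rw [Finset.sum_congr rfl fun k _ => h1 k, ← Finset.sum_mul, ← Finset.smul_sum,
    sum_trace_smul h, smul_smul, smul_mul_assoc, Units.mul_inv, sq]

end Schur

section Normal

variable {G : Type*} [Group G]

open Classical in
/-- Extension by zero of a function on a subgroup. -/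
noncomputable def extZ {α : Type*} [Zero α] (N : Subgroup G) (f : N → α) (x : G) : α :=
  if h : x ∈ N then f ⟨x, h⟩ else 0

theorem extZ_of_mem {α : Type*} [Zero α] {N : Subgroup G} (f : N → α) {x : G} (h : x ∈ N) :
    extZ N f x = f ⟨x, h⟩ := dif_pos h

variable {d : Type*} [Fintype d] [DecidableEq d]

theorem extZ_mul {N : Subgroup G} (ρ : N →* Matrix d d ℂ) {x y : G} (hx : x ∈ N) (hy : y ∈ N) :
    extZ N ρ (x * y) = extZ N ρ x * extZ N ρ y := by
  rw [extZ_of_mem _ hx, extZ_of_mem _ hy, extZ_of_mem _ (N.mul_mem hx hy), ← map_mul]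
  rfl

/-- The representation `n ↦ ρ (x n x⁻¹)` of a normal subgroup. -/
def conjRep {N : Subgroup G} [N.Normal] (ρ : N →* Matrix d d ℂ) (x : G) : N →* Matrix d d ℂ :=
  ρ.comp (MulAut.conjNormal x).toMonoidHom

theorem chr_conjRep {N : Subgroup G} [N.Normal] (ρ : N →* Matrix d d ℂ) (x : G) (n : N) :
    chr (conjRep ρ x) n = chr ρ (MulAut.conjNormal x n) := rfl

theorem ip_comp_mulEquiv {Γ Γ' : Type*} [Group Γ] [Group Γ'] [Finite Γ] [Finite Γ'] (e : Γ ≃* Γ')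
    (f f' : Γ' → ℂ) : ip (fun x => f (e x)) (fun x => f' (e x)) = ip f f' := by
  have := Fintype.ofFinite Γ
  have := Fintype.ofFinite Γ'
  rw [ip_eq, ip_eq, Nat.card_congr e.toEquiv]
  congr 1
  exact Fintype.sum_equiv e.toEquiv _ _ fun x => by simp

theorem chr_comp_mem_Irr {Γ Γ' : Type*} [Group Γ] [Group Γ'] [Finite Γ] [Finite Γ'] (e : Γ ≃* Γ')
    {ρ : Γ' →* Matrix d d ℂ} (h : chr ρ ∈ Irr Γ') : chr (ρ.comp e.toMonoidHom) ∈ Irr Γ := by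
  rw [chr_mem_Irr_iff] at h ⊢
  rw [← h]
  exact ip_comp_mulEquiv e (chr ρ) (chr ρ)

theorem chr_conjRep_mem_Irr {N : Subgroup G} [N.Normal] [Finite N] {ρ : N →* Matrix d d ℂ}
    (h : chr ρ ∈ Irr N) (x : G) : chr (conjRep ρ x) ∈ Irr N :=
  chr_comp_mem_Irr _ h

theorem chr_conj {Γ : Type*} [Group Γ] (ρ : Γ →* Matrix d d ℂ) (x y : Γ) :
    chr ρ (x * y * x⁻¹) = chr ρ y := by
  rw [chr, map_mul, Matrix.trace_mul_comm, ← map_mul, inv_mul_cancel_left]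
  rfl

variable {N : Subgroup G} [N.Normal]

/-- Conjugation by `y m x`, `m ∈ N`, acts on characters as conjugation by `x` only if `y` acts
trivially. -/
theorem chr_fixed_of_mul {ρ : N →* Matrix d d ℂ} {y m x : G} (hm : m ∈ N)
    (h : chr (conjRep ρ (y * m * x)) = chr (conjRep ρ x)) : chr (conjRep ρ y) = chr ρ := by
  ext n
  have h1 := congrFun h (MulAut.conjNormal x⁻¹ (MulAut.conjNormal m⁻¹ n))
  rw [chr_conjRep, chr_conjRep] at h1
  have e1 : MulAut.conjNormal (y * m * x) (MulAut.conjNormal x⁻¹ (MulAut.conjNormal m⁻¹ n)) =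
      MulAut.conjNormal y n := by
    ext; simp [mul_assoc]
  have e2 : MulAut.conjNormal x (MulAut.conjNormal x⁻¹ (MulAut.conjNormal m⁻¹ n)) =
      ⟨m, hm⟩⁻¹ * n * (⟨m, hm⟩⁻¹)⁻¹ := by
    ext; simp [mul_assoc]
  rw [e1, e2, chr_conj] at h1
  exact h1

variable [Fintype N]

/-- The average of an intertwiner between two conjugates of `ρ` with different characters. -/
theorem sum_conjRep_eq_zero {ρ : N →* Matrix d d ℂ} (h : chr ρ ∈ Irr N) {x y : G}
    (hxy : chr (conjRep ρ x) ≠ chr (conjRep ρ y)) :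
    ∑ l, conjRep ρ x l * conjRep ρ y l⁻¹ = 0 := by
  classical
  apply intertwiner_eq_zero (ρ := conjRep ρ y) (τ := conjRep ρ x)
  · rw [ip_of_mem_Irr (chr_conjRep_mem_Irr h x) (chr_conjRep_mem_Irr h y), if_neg hxy]
  · intro n
    rw [Finset.mul_sum, Finset.sum_mul]
    refine Fintype.sum_equiv (Equiv.mulLeft n) _ _ fun l => ?_
    have : conjRep ρ y n⁻¹ * conjRep ρ y n = 1 := by rw [← map_mul, inv_mul_cancel, map_one]
    simp only [Equiv.coe_mulLeft, map_mul, _root_.mul_inv_rev, mul_assoc, this, mul_one]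

/-- The sum of `ρ` over the commutators of two cosets of `N`. -/
noncomputable def commSum (ρ : N →* Matrix d d ℂ) (x y : G) : Matrix d d ℂ :=
  ∑ l : N, ∑ k : N, extZ N ρ ⁅x * l, y * k⁆

/-- For fixed `k`, the sum over `l` is, up to a constant factor, an intertwiner average between the
conjugates of `ρ` under `x` and under `x y k`, whose characters differ. -/
theorem commSum_eq_zero_right (hcomm : ∀ x y : G, ⁅x, y⁆ ∈ N) {ρ : N →* Matrix d d ℂ}
    (h : chr ρ ∈ Irr N) (x : G) {y : G} (hy : chr (conjRep ρ y) ≠ chr ρ) : commSum ρ x y = 0 := by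
  rw [commSum, Finset.sum_comm]
  refine Finset.sum_eq_zero fun k _ => ?_
  -- `x y k = y m x` with `m = y⁻¹ x y k x⁻¹` in `N`
  have hm : y⁻¹ * x * y * k * x⁻¹ ∈ N := by
    have := N.mul_mem (hcomm y⁻¹ x) ((inferInstance : N.Normal).conj_mem k k.2 x)
    convert this using 1
    simp only [commutatorElement_def]; group
  have hne : chr (conjRep ρ x) ≠ chr (conjRep ρ (x * y * k)) := by
    intro he
    apply hy
    apply chr_fixed_of_mul hm (x := x)
    rw [he]
    congr 2
    group
  have hc : x * y * k * x⁻¹ * k⁻¹ * y⁻¹ ∈ N := by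
    convert N.mul_mem (hcomm x y) ((inferInstance : N.Normal).conj_mem _
      (N.mul_mem ((inferInstance : N.Normal).conj_mem k k.2 x) (N.inv_mem k.2)) y) using 1
    simp only [commutatorElement_def, InvMemClass.coe_inv]; group
  have h1 : ∀ l : N, extZ N ρ ⁅x * l, y * k⁆ =
      conjRep ρ x l * conjRep ρ (x * y * k) l⁻¹ * extZ N ρ (x * y * k * x⁻¹ * k⁻¹ * y⁻¹) := by
    intro l
    rw [extZ_of_mem _ hc, extZ_of_mem _ (hcomm _ _)]
    simp only [conjRep, MonoidHom.comp_apply, ← map_mul]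
    congr 1
    ext
    simp [commutatorElement_def, mul_assoc]
  rw [Finset.sum_congr rfl fun l _ => h1 l, ← Finset.sum_mul, sum_conjRep_eq_zero h hne, zero_mul]

theorem commSum_eq_zero_left (hcomm : ∀ x y : G, ⁅x, y⁆ ∈ N) {ρ : N →* Matrix d d ℂ}
    (h : chr ρ ∈ Irr N) {x : G} (y : G) (hx : chr (conjRep ρ x) ≠ chr ρ) : commSum ρ x y = 0 := by
  rw [commSum]
  refine Finset.sum_eq_zero fun l _ => ?_
  have hm : x⁻¹ * y * x * l * y⁻¹ ∈ N := by
    have := N.mul_mem (hcomm x⁻¹ y) ((inferInstance : N.Normal).conj_mem l l.2 y)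
    convert this using 1
    simp only [commutatorElement_def]; group
  have hne : chr (conjRep ρ (y * x * l)) ≠ chr (conjRep ρ y) := by
    intro he
    apply hx
    apply chr_fixed_of_mul hm (x := y)
    rw [← he]
    congr 2
    group
  have h1 : ∀ k : N, extZ N ρ ⁅x * l, y * k⁆ =
      extZ N ρ ⁅x * l, y⁆ * (conjRep ρ (y * x * l) k * conjRep ρ y k⁻¹) := by
    intro k
    rw [extZ_of_mem _ (hcomm _ _), extZ_of_mem _ (hcomm _ _)]
    simp only [conjRep, MonoidHom.comp_apply, ← map_mul]
    congr 1
    ext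
    simp [commutatorElement_def, mul_assoc]
  rw [Finset.sum_congr rfl fun k _ => h1 k, ← Finset.mul_sum, sum_conjRep_eq_zero h hne, mul_zero]

end Normal

/-! ### Commutators in an extension of a normal subgroup -/

section Twisted

variable {G : Type*} [Group G] {d : Type*} [Fintype d] [DecidableEq d]

theorem val_toHomUnits {Γ : Type*} [Group Γ] (ρ : Γ →* Matrix d d ℂ) (x : Γ) :
    ((ρ.toHomUnits x : (Matrix d d ℂ)ˣ) : Matrix d d ℂ) = ρ x := rfl

variable {D : Subgroup G} [D.Normal] {ρ : D →* Matrix d d ℂ} {u : G} {T : (Matrix d d ℂ)ˣ}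
  {c : D →* ℂˣ}

/-- The relation between `T` and `ρ` for the powers of `T` and `u`. -/
theorem twisted_pow (hc : ∀ h : D, c (MulAut.conjNormal u h) = c h)
    (hT : ∀ h : D, (T : Matrix d d ℂ) * ρ h = (c h : ℂ) • (ρ (MulAut.conjNormal u h) * T)) (k : ℕ) :
    ∀ h : D, (T : Matrix d d ℂ) ^ k * ρ h =
      ((c h : ℂ) ^ k) • (ρ (MulAut.conjNormal (u ^ k) h) * (T : Matrix d d ℂ) ^ k) := by
  induction k with
  | zero => intro h; simp
  | succ k ih =>
    intro h
    rw [pow_succ, mul_assoc, hT, mul_smul_comm, ← mul_assoc, ih, hc, smul_mul_assoc, smul_smul,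
      pow_succ, mul_assoc, pow_succ u, map_mul, mul_comm (c h : ℂ), MulAut.mul_apply]

variable {N : Subgroup G} [N.Normal]

/-- If `T` intertwines `ρ` with its conjugate under `u` up to the linear character `c`, then on the
commutator of `h u^k` and `h' u^k'` the representation `ρ` is, up to a scalar given by `c`, the
commutator of the corresponding matrices. -/
theorem twisted_commutator (hcomm : ∀ x y : G, ⁅x, y⁆ ∈ D)
    (hc : ∀ h : D, c (MulAut.conjNormal u h) = c h)
    (hT : ∀ h : D, (T : Matrix d d ℂ) * ρ h = (c h : ℂ) • (ρ (MulAut.conjNormal u h) * T))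
    (h h' : D) (k k' : ℕ) :
    ρ ⟨⁅(h : G) * u ^ k, (h' : G) * u ^ k'⁆, hcomm _ _⟩ =
      ((((c h')⁻¹ ^ k * c h ^ k' : ℂˣ)) : ℂ) •
        (((ρ.toHomUnits h * T ^ k) * (ρ.toHomUnits h' * T ^ k') *
          ((ρ.toHomUnits h' * T ^ k') * (ρ.toHomUnits h * T ^ k))⁻¹ : (Matrix d d ℂ)ˣ) :
            Matrix d d ℂ) := by
  have key : ∀ (h h' : D) (k k' : ℕ), ρ h * (T : Matrix d d ℂ) ^ k * (ρ h' * (T : Matrix d d ℂ) ^ k') =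
      ((c h' ^ k : ℂˣ) : ℂ) • (ρ (h * MulAut.conjNormal (u ^ k) h') *
        (T : Matrix d d ℂ) ^ (k + k')) := by
    intro h h' k k'
    rw [← mul_assoc, mul_assoc (ρ h), twisted_pow hc hT, mul_smul_comm, smul_mul_assoc, map_mul,
      pow_add, Units.val_pow_eq_pow_val]
    simp only [mul_assoc]
  have h1 : ρ ⟨⁅(h : G) * u ^ k, (h' : G) * u ^ k'⁆, hcomm _ _⟩ *
      (((ρ.toHomUnits h' * T ^ k') * (ρ.toHomUnits h * T ^ k) : (Matrix d d ℂ)ˣ) : Matrix d d ℂ) =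
      ((((c h')⁻¹ ^ k * c h ^ k' : ℂˣ)) : ℂ) •
        (((ρ.toHomUnits h * T ^ k) * (ρ.toHomUnits h' * T ^ k') : (Matrix d d ℂ)ˣ) :
          Matrix d d ℂ) := by
    simp only [Units.val_mul, Units.val_pow_eq_pow_val, val_toHomUnits]
    rw [key, key, mul_smul_comm, ← mul_assoc, ← map_mul, smul_smul, add_comm k' k]
    congr 1
    · rw [Units.val_inv_eq_inv_val, Units.val_pow_eq_pow_val, Units.val_pow_eq_pow_val, inv_pow]
      field_simp
    · congr 2
      ext
      simp only [commutatorElement_def, Subgroup.coe_mul, MulAut.conjNormal_apply]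
      group
  rw [← mul_one (ρ _), ← Units.val_one,
    ← mul_inv_cancel ((ρ.toHomUnits h' * T ^ k') * (ρ.toHomUnits h * T ^ k)),
    Units.val_mul, ← mul_assoc, h1, smul_mul_assoc, ← Units.val_mul]

variable [Fintype N]

/-- The twisted Frobenius sum over two cosets. -/
theorem commSum_eq_smul (hND : N ≤ D) (hcomm : ∀ x y : G, ⁅x, y⁆ ∈ N)
    (hirr : chr (ρ.comp (Subgroup.inclusion hND)) ∈ Irr N)
    (hcN : ∀ n : D, (n : G) ∈ N → c n = 1)
    (hT : ∀ h : D, (T : Matrix d d ℂ) * ρ h = (c h : ℂ) • (ρ (MulAut.conjNormal u h) * T))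
    (h h' : D) (k k' : ℕ) :
    commSum (ρ.comp (Subgroup.inclusion hND)) (h * u ^ k) (h' * u ^ k') =
      ((((c h')⁻¹ ^ k * c h ^ k' : ℂˣ) : ℂ) * ((Nat.card N : ℂ) / Fintype.card d) ^ 2) • 1 := by
  -- `c` is trivial on `N`, which contains all commutators
  have hc : ∀ h : D, c (MulAut.conjNormal u h) = c h := by
    intro h
    have := hcN (MulAut.conjNormal u h * h⁻¹) (by
      simpa [commutatorElement_def] using hcomm u h)
    rwa [map_mul, map_inv, mul_inv_eq_one] at this
  -- moving `l ∈ N` to the left of `u ^ k`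
  have hmove : ∀ (h : D) (k : ℕ) (l : N), ∃ h₁ : D, (h₁ : G) * u ^ k = h * u ^ k * l ∧ c h₁ = c h ∧
      ρ.toHomUnits h₁ * T ^ k = ρ.toHomUnits h * T ^ k *
        (ρ.comp (Subgroup.inclusion hND)).toHomUnits l := by
    intro h k l
    refine ⟨h * MulAut.conjNormal (u ^ k) (Subgroup.inclusion hND l), ?_, ?_, ?_⟩
    · simp only [Subgroup.coe_mul, MulAut.conjNormal_apply, Subgroup.coe_inclusion]
      group
    · rw [map_mul, hcN (MulAut.conjNormal _ _) ?_, mul_one]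
      exact (inferInstance : N.Normal).conj_mem _ l.2 _
    · ext1
      simp only [Units.val_mul, Units.val_pow_eq_pow_val, val_toHomUnits, MonoidHom.comp_apply,
        map_mul]
      rw [mul_assoc, mul_assoc, twisted_pow hc hT, hcN _ l.2]
      simp
  rw [commSum, mul_smul, ← sum_commutator_eq hirr (ρ.toHomUnits h * T ^ k)
    (ρ.toHomUnits h' * T ^ k'), Finset.smul_sum]
  refine Finset.sum_congr rfl fun l _ => ?_
  rw [Finset.smul_sum]
  refine Finset.sum_congr rfl fun m _ => ?_
  obtain ⟨h₁, e1, e2, e3⟩ := hmove h k l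
  obtain ⟨h₂, e4, e5, e6⟩ := hmove h' k' m
  have := twisted_commutator (fun x y => hND (hcomm x y)) hc hT h₁ h₂ k k'
  rw [e2, e3, e5, e6] at this
  rw [extZ_of_mem _ (hcomm _ _), MonoidHom.comp_apply]
  have e7 : Subgroup.inclusion hND ⟨⁅(h : G) * u ^ k * l, (h' : G) * u ^ k' * m⁆, hcomm _ _⟩ =
      ⟨⁅(h₁ : G) * u ^ k, (h₂ : G) * u ^ k'⁆, hND (hcomm _ _)⟩ := by
    ext; simp [e1, e4]
  rw [e7, this]
  refine congrArg _ ?_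
  simp only [_root_.mul_inv_rev, Units.val_mul, ← map_inv, val_toHomUnits, mul_assoc]

end Twisted

section Counting

variable {G : Type*} [Group G] {N : Subgroup G}

variable {d : Type*} [Fintype d] [DecidableEq d]

theorem list_prod_mem {g : ℕ} {w : Fin g → G} (h : ∀ i, w i ∈ N) : (List.ofFn w).prod ∈ N := by
  apply Subgroup.list_prod_mem
  intro x hx
  obtain ⟨i, rfl⟩ := (List.mem_ofFn' _ _).1 hx
  exact h i

theorem extZ_list_prod (ρ : N →* Matrix d d ℂ) : ∀ {g : ℕ} (w : Fin g → G) (_ : ∀ i, w i ∈ N),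
    extZ N ρ (List.ofFn w).prod = (List.ofFn fun i => extZ N ρ (w i)).prod := by
  intro g
  induction g with
  | zero => intro w _; simpa using (extZ_of_mem ρ N.one_mem).trans (map_one ρ)
  | succ g ih =>
    intro w hw
    rw [List.ofFn_succ, List.prod_cons, List.ofFn_succ, List.prod_cons, extZ_mul _ (hw 0), ih _ fun i => hw _]
    exact list_prod_mem fun i => hw _

variable [Fintype N] {g : ℕ}

/-- The sum of `f ([x, y] z)` over all `(x, y)` in given cosets of `N`. -/
noncomputable def Psi (x y : Fin g → G) (z : G) (f : N → ℂ) : ℂ :=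
  ∑ p : Fin g → N × N, extZ N f ((List.ofFn fun i => ⁅x i * (p i).1, y i * (p i).2⁆).prod * z)

theorem sum_prod_ofFn {R κ : Type*} [Semiring R] [Fintype κ] : ∀ {g : ℕ} (F : Fin g → κ → R),
    ∑ p : Fin g → κ, (List.ofFn fun i => F i (p i)).prod = (List.ofFn fun i => ∑ a, F i a).prod := by
  intro g
  induction g with
  | zero => intro F; simp
  | succ g ih =>
    intro F
    rw [List.ofFn_succ, List.prod_cons, ← ih, Finset.sum_mul_sum, ← Fintype.sum_prod_type']
    refine (Fintype.sum_equiv (Fin.consEquiv fun _ => κ) _ _ fun p => ?_).symm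
    simp [List.ofFn_succ]

/-- Since `ρ` is multiplicative, the sum over all families of cosets factors into one commutator sum for
each index. -/
theorem Psi_chr [N.Normal] (hcomm : ∀ x y : G, ⁅x, y⁆ ∈ N) (ρ : N →* Matrix d d ℂ)
    (x y : Fin g → G) (z : N) :
    Psi x y z (chr ρ) = ((List.ofFn fun i => commSum ρ (x i) (y i)).prod * ρ z).trace := by
  have h1 : ∀ i, commSum ρ (x i) (y i) = ∑ a : N × N, extZ N ρ ⁅x i * a.1, y i * a.2⁆ := fun i => by
    rw [commSum, Fintype.sum_prod_type]
  simp only [h1]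
  rw [← sum_prod_ofFn (fun i (a : N × N) => extZ N ρ ⁅x i * a.1, y i * a.2⁆), Finset.sum_mul,
    Matrix.trace_sum, Psi]
  refine Finset.sum_congr rfl fun p _ => ?_
  have hm := list_prod_mem (w := fun i => ⁅x i * (p i).1, y i * (p i).2⁆) fun i => hcomm _ _
  rw [← extZ_list_prod _ _ fun i => hcomm _ _, extZ_of_mem _ (N.mul_mem hm z.2), chr,
    extZ_of_mem _ hm, ← map_mul]
  rfl

/-- The contribution of an irreducible character moved by one of the elements vanishes. -/
theorem Psi_eq_zero [N.Normal] (hcomm : ∀ x y : G, ⁅x, y⁆ ∈ N) {ρ : N →* Matrix d d ℂ}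
    (h : chr ρ ∈ Irr N) (x y : Fin g → G) (z : N)
    (hxy : ∃ i, chr (conjRep ρ (x i)) ≠ chr ρ ∨ chr (conjRep ρ (y i)) ≠ chr ρ) :
    Psi x y z (chr ρ) = 0 := by
  obtain ⟨i, hi⟩ := hxy
  have h0 : commSum ρ (x i) (y i) = 0 :=
    hi.elim (commSum_eq_zero_left hcomm h _) (commSum_eq_zero_right hcomm h _)
  rw [Psi_chr hcomm, List.prod_eq_zero, zero_mul, Matrix.trace_zero]
  rw [List.mem_ofFn']
  exact ⟨i, h0⟩

/-- The contribution of a representation for which all commutator sums are scalars. -/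
theorem Psi_eq_prod [N.Normal] (hcomm : ∀ x y : G, ⁅x, y⁆ ∈ N) {ρ : N →* Matrix d d ℂ}
    (x y : Fin g → G) (z : N) (c : Fin g → ℂ) (hc : ∀ i, commSum ρ (x i) (y i) = c i • 1) :
    Psi x y z (chr ρ) = (∏ i, c i) * chr ρ z := by
  have h1 : ∀ {g : ℕ} (c : Fin g → ℂ), (List.ofFn fun i => c i • (1 : Matrix d d ℂ)).prod =
      (∏ i, c i) • 1 := by
    intro g
    induction g with
    | zero => intro c; simp
    | succ g ih =>
      intro c
      rw [List.ofFn_succ, List.prod_cons, ih, Fin.prod_univ_succ, smul_mul_smul_comm, mul_one]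
  rw [Psi_chr hcomm]
  simp only [hc]
  rw [h1, smul_mul_assoc, one_mul, Matrix.trace_smul, smul_eq_mul]
  rfl

theorem Psi_sum {ι : Type*} (s : Finset ι) (x y : Fin g → G) (z : G) (c : ι → ℂ) (f : ι → N → ℂ) :
    Psi x y z (fun n => ∑ i ∈ s, c i * f i n) = ∑ i ∈ s, c i * Psi x y z (f i) := by
  simp only [Psi, Finset.mul_sum]
  rw [Finset.sum_comm]
  refine Finset.sum_congr rfl fun p _ => ?_
  by_cases h : (List.ofFn fun i => ⁅x i * (p i).1, y i * (p i).2⁆).prod * z ∈ N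
  · simp only [extZ_of_mem _ h]
  · simp [extZ, h]

end Counting

/-! ### Kronecker products and spectral projections -/

section Tensor

variable {ι : Type*} [Fintype ι] [DecidableEq ι]

/-- The Kronecker product of a finite family of square matrices. -/
def tens {m : ι → Type*} (M : ∀ i, Matrix (m i) (m i) ℂ) : Matrix (∀ i, m i) (∀ i, m i) ℂ :=
  Matrix.of fun f g => ∏ i, M i (f i) (g i)

section Family

variable {m : ι → Type*} [∀ i, Fintype (m i)] [∀ i, DecidableEq (m i)]

omit [(i : ι) → DecidableEq (m i)] in
theorem tens_mul (M M' : ∀ i, Matrix (m i) (m i) ℂ) :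
    tens M * tens M' = tens fun i => M i * M' i := by
  ext f g
  simp only [tens, Matrix.mul_apply, Matrix.of_apply, ← Finset.prod_mul_distrib]
  rw [Finset.prod_univ_sum, Fintype.piFinset_univ]

omit [DecidableEq ι] [(i : ι) → Fintype (m i)] in
theorem tens_one : tens (fun i => (1 : Matrix (m i) (m i) ℂ)) = 1 := by
  ext f g
  simp only [tens, Matrix.of_apply, Matrix.one_apply]
  by_cases h : f = g
  · simp [h]
  · rw [if_neg h]
    obtain ⟨i, hi⟩ := Function.ne_iff.1 h
    exact Finset.prod_eq_zero (Finset.mem_univ i) (if_neg hi)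

theorem tens_pow (M : ∀ i, Matrix (m i) (m i) ℂ) (k : ℕ) :
    tens M ^ k = tens fun i => M i ^ k := by
  induction k with
  | zero => simp [tens_one]
  | succ k ih => simp only [pow_succ, ih, tens_mul]

omit [(i : ι) → DecidableEq (m i)] in
theorem trace_tens (M : ∀ i, Matrix (m i) (m i) ℂ) : (tens M).trace = ∏ i, (M i).trace := by
  simp only [tens, Matrix.trace, Matrix.diag_apply, Matrix.of_apply]
  rw [Finset.prod_univ_sum, Fintype.piFinset_univ]

omit [DecidableEq ι] [(i : ι) → Fintype (m i)] [(i : ι) → DecidableEq (m i)] in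
theorem tens_smul (c : ι → ℂ) (M : ∀ i, Matrix (m i) (m i) ℂ) :
    tens (fun i => c i • M i) = (∏ i, c i) • tens M := by
  ext f g
  simp [tens, Finset.prod_mul_distrib]

/-- The Kronecker product of a family of invertible matrices. -/
def tensUnit (M : ∀ i, (Matrix (m i) (m i) ℂ)ˣ) : (Matrix (∀ i, m i) (∀ i, m i) ℂ)ˣ where
  val := tens fun i => M i
  inv := tens fun i => (M i)⁻¹.val
  val_inv := by rw [tens_mul]; simp [tens_one]
  inv_val := by rw [tens_mul]; simp [tens_one]

theorem val_tensUnit (M : ∀ i, (Matrix (m i) (m i) ℂ)ˣ) :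
    (tensUnit M : Matrix (∀ i, m i) (∀ i, m i) ℂ) = tens fun i => (M i).val := rfl

end Family

variable {n : Type*} [Fintype n] [DecidableEq n]

/-- The matrix permuting the factors of a Kronecker power. -/
def permTens (n : Type*) [DecidableEq n] (e : Equiv.Perm ι) : Matrix (ι → n) (ι → n) ℂ :=
  Matrix.of fun f g => if f ∘ e = g then 1 else 0

/-- The permutation matrix moves the factors of a Kronecker product. -/
theorem permTens_mul_tens (e : Equiv.Perm ι) (M : ι → Matrix n n ℂ) :
    permTens n e * tens M = tens (fun i => M (e.symm i)) * permTens n e := by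
  ext f g
  have h1 : (permTens n e * tens M) f g = ∏ i, M i (f (e i)) (g i) := by
    simp [permTens, Matrix.mul_apply, tens]
  have h2 : ∀ k : ι → n, k ∘ e = g ↔ k = g ∘ e.symm := fun k =>
    (Equiv.eq_comp_symm e k g).symm
  have h3 : (tens (fun i => M (e.symm i)) * permTens n e) f g =
      ∏ i, M (e.symm i) (f i) (g (e.symm i)) := by
    simp [permTens, Matrix.mul_apply, tens, h2]
  rw [h1, h3]
  exact Fintype.prod_equiv e _ _ fun i => by simp

theorem permTens_mul (e e' : Equiv.Perm ι) :
    permTens n e * permTens n e' = permTens n (e * e') := by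
  ext f g
  rw [Matrix.mul_apply, Finset.sum_eq_single (f ∘ e)]
  · simp only [permTens, Matrix.of_apply, Equiv.Perm.coe_mul, Function.comp_assoc, if_true, one_mul]
    rfl
  · intro j _ hj
    simp [permTens, Ne.symm hj]
  · simp

omit [DecidableEq ι] [Fintype n] in
theorem permTens_one : permTens n (1 : Equiv.Perm ι) = 1 := by
  ext f g
  simp [permTens, Matrix.one_apply]

/-- The invertible matrix permuting the factors of a Kronecker power. -/
def permTensUnit (n : Type*) [Fintype n] [DecidableEq n] (e : Equiv.Perm ι) :
    (Matrix (ι → n) (ι → n) ℂ)ˣ where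
  val := permTens n e
  inv := permTens n e⁻¹
  val_inv := by rw [permTens_mul, mul_inv_cancel, permTens_one]
  inv_val := by rw [permTens_mul, inv_mul_cancel, permTens_one]

end Tensor

section Compression

variable {V : Type*} [Fintype V] [DecidableEq V]

/-- An idempotent matrix splits as `I J` with `J I = 1`. -/
theorem exists_splitting (P : Matrix V V ℂ) (hP : P * P = P) :
    ∃ (d : ℕ) (I : Matrix V (Fin d) ℂ) (J : Matrix (Fin d) V ℂ), J * I = 1 ∧ I * J = P := by
  let p := Matrix.toLin' P
  let b := finBasis ℂ (LinearMap.range p)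
  have hp : p ∘ₗ p = p := by rw [← Matrix.toLin'_mul, hP]
  let incl : (Fin (finrank ℂ (LinearMap.range p)) → ℂ) →ₗ[ℂ] (V → ℂ) :=
    (LinearMap.range p).subtype ∘ₗ b.equivFun.symm.toLinearMap
  let proj : (V → ℂ) →ₗ[ℂ] (Fin (finrank ℂ (LinearMap.range p)) → ℂ) :=
    b.equivFun.toLinearMap ∘ₗ p.rangeRestrict
  have h1 : proj ∘ₗ incl = LinearMap.id := by
    ext1 i
    ext1
    simp only [proj, incl, LinearMap.comp_apply, LinearMap.id_comp, LinearEquiv.coe_coe]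
    have : p.rangeRestrict ((LinearMap.range p).subtype (b.equivFun.symm (LinearMap.single ℂ _ i 1))) =
        b.equivFun.symm (LinearMap.single ℂ _ i 1) := by
      ext1
      obtain ⟨w, hw⟩ := (b.equivFun.symm (LinearMap.single ℂ _ i 1)).2
      rw [LinearMap.codRestrict_apply, Submodule.subtype_apply, ← hw]
      exact congrArg (fun F : (V → ℂ) →ₗ[ℂ] (V → ℂ) => F w) hp
    rw [this, LinearEquiv.apply_symm_apply]
  have h2 : incl ∘ₗ proj = p := by
    apply LinearMap.ext
    intro v
    simp [proj, incl]
  refine ⟨_, LinearMap.toMatrix' incl, LinearMap.toMatrix' proj, ?_, ?_⟩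
  · rw [← LinearMap.toMatrix'_comp, h1, LinearMap.toMatrix'_id]
  · rw [← LinearMap.toMatrix'_comp, h2, LinearMap.toMatrix'_toLin']

variable {d : Type*} [Fintype d] [DecidableEq d] {P : Matrix V V ℂ} {I : Matrix V d ℂ}
  {J : Matrix d V ℂ}

omit [DecidableEq V] in
theorem compress_mul (hJI : J * I = 1) (hIJ : I * J = P) (X : Matrix V V ℂ) {Y : Matrix V V ℂ}
    (hY : Commute P Y) : J * (X * Y) * I = (J * X * I) * (J * Y * I) := by
  have h1 : P * I = I := by rw [← hIJ, Matrix.mul_assoc, hJI, Matrix.mul_one]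
  calc J * (X * Y) * I = J * X * (Y * (P * I)) := by rw [h1]; simp only [Matrix.mul_assoc]
    _ = J * X * ((P * Y) * I) := by rw [hY.eq]; simp only [Matrix.mul_assoc]
    _ = _ := by rw [← hIJ]; simp only [Matrix.mul_assoc]

omit [DecidableEq V] [DecidableEq d] in
theorem trace_compress (hIJ : I * J = P) (X : Matrix V V ℂ) : (J * X * I).trace = (X * P).trace := by
  rw [Matrix.mul_assoc, Matrix.trace_mul_comm, Matrix.mul_assoc, hIJ]

end Compression

section Spectral

variable {V : Type*} [Fintype V] [DecidableEq V]

/-- The spectral projection of a matrix `E` with `E ^ s = 1` to the eigenvalue `ω`. -/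
noncomputable def specProj (E : Matrix V V ℂ) (s : ℕ) (ω : ℂˣ) : Matrix V V ℂ :=
  (s : ℂ)⁻¹ • ∑ k ∈ Finset.range s, ((ω⁻¹ ^ k : ℂˣ) : ℂ) • E ^ k

variable {E : Matrix V V ℂ} {s : ℕ}

/-- `specProj E s ω` projects to the eigenspace of `ω`. -/
theorem mul_specProj (hs : s ≠ 0) (hE : E ^ s = 1) {ω : ℂˣ} (hω : ω ^ s = 1) :
    E * specProj E s ω = (ω : ℂ) • specProj E s ω := by
  obtain ⟨r, rfl⟩ := Nat.exists_eq_succ_of_ne_zero hs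
  have h : ∀ k, E * (((ω⁻¹ ^ k : ℂˣ) : ℂ) • E ^ k) =
      (ω : ℂ) • (((ω⁻¹ ^ (k + 1) : ℂˣ) : ℂ) • E ^ (k + 1)) := by
    intro k
    rw [mul_smul_comm, ← pow_succ', smul_smul, ← Units.val_mul]
    congr 2
    rw [pow_succ' ω⁻¹, mul_inv_cancel_left]
  rw [specProj, mul_smul_comm, Finset.mul_sum, Finset.sum_congr rfl fun k _ => h k,
    ← Finset.smul_sum, smul_comm (ω : ℂ)]
  refine congrArg _ (congrArg _ ?_)
  rw [Finset.sum_range_succ, Finset.sum_range_succ', hE, inv_pow, hω]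
  simp

theorem specProj_idem (hs : s ≠ 0) (hE : E ^ s = 1) {ω : ℂˣ} (hω : ω ^ s = 1) :
    specProj E s ω * specProj E s ω = specProj E s ω := by
  have h : ∀ k, E ^ k * specProj E s ω = ((ω ^ k : ℂˣ) : ℂ) • specProj E s ω := by
    intro k
    induction k with
    | zero => simp
    | succ k ih =>
      rw [pow_succ, mul_assoc, mul_specProj hs hE hω, mul_smul_comm, ih, smul_smul, pow_succ',
        Units.val_mul]
  conv_lhs => enter [1]; rw [specProj]
  rw [smul_mul_assoc, Finset.sum_mul, Finset.sum_congr rfl fun k _ => show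
    ((ω⁻¹ ^ k : ℂˣ) : ℂ) • E ^ k * specProj E s ω = specProj E s ω from ?_]
  · rw [Finset.sum_const, Finset.card_range, ← Nat.cast_smul_eq_nsmul ℂ, smul_smul,
      inv_mul_cancel₀ (by exact_mod_cast hs), one_smul]
  · rw [smul_mul_assoc, h, smul_smul, ← Units.val_mul, ← mul_pow, inv_mul_cancel, one_pow,
      Units.val_one, one_smul]

theorem specProj_commute (E : Matrix V V ℂ) (s : ℕ) (ω : ℂˣ) {X : Matrix V V ℂ} (h : Commute E X) :
    Commute (specProj E s ω) X := by
  apply Commute.smul_left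
  apply Commute.sum_left
  intro k _
  exact (h.pow_left k).smul_left _

/-- A matrix commuting with `E` up to the scalar `c` moves the eigenspace of `ω` to that of `c ω`. -/
theorem specProj_mul_of_twist {c ω : ℂˣ} {X : Matrix V V ℂ} (h : E * X = (c : ℂ) • (X * E)) :
    specProj E s ω * X = X * specProj E s (c⁻¹ * ω) := by
  have h1 : ∀ k, E ^ k * X = ((c ^ k : ℂˣ) : ℂ) • (X * E ^ k) := by
    intro k
    induction k with
    | zero => simp
    | succ k ih =>
      rw [pow_succ', mul_assoc, ih, mul_smul_comm, ← mul_assoc, h, smul_mul_assoc, smul_smul,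
        ← Units.val_mul, pow_succ c, mul_assoc]
  simp only [specProj, smul_mul_assoc, mul_smul_comm, Finset.sum_mul, Finset.mul_sum, h1, smul_smul]
  congr 1
  refine Finset.sum_congr rfl fun k _ => ?_
  rw [← Units.val_mul, ← mul_pow]
  rw [_root_.mul_inv_rev, inv_inv]

/-- A matrix of finite order is diagonalizable: the spectral projections add up to `1`. -/
theorem sum_specProj [NeZero s] [Fintype (rootsOfUnity s ℂ)] :
    ∑ ω : rootsOfUnity s ℂ, specProj E s ω = 1 := by
  simp only [specProj]
  rw [← Finset.smul_sum, Finset.sum_comm]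
  have h : ∀ k ∈ Finset.range s, ∑ ω : rootsOfUnity s ℂ, (((ω : ℂˣ)⁻¹ ^ k : ℂˣ) : ℂ) • E ^ k =
      if k = 0 then (s : ℂ) • 1 else 0 := by
    intro k hk
    rw [← Finset.sum_smul]
    split_ifs with h0
    · subst h0
      have hcard := Complex.card_rootsOfUnity s
      rw [Nat.card_eq_fintype_card] at hcard
      simp only [pow_zero, Units.val_one, Finset.sum_const, Finset.card_univ, hcard, nsmul_eq_mul, mul_one]
    · let f : rootsOfUnity s ℂ →* ℂ :=
        { toFun := fun ω => (((ω : ℂˣ)⁻¹ ^ k : ℂˣ) : ℂ)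
          map_one' := by simp
          map_mul' := by intro x y; simp [mul_comm, mul_pow] }
      have hf : f ≠ 1 := by
        intro hf
        have hprim := Complex.isPrimitiveRoot_exp s (NeZero.ne s)
        have h1 := congrArg (fun F : rootsOfUnity s ℂ →* ℂ => F hprim.toRootsOfUnity) hf
        simp only [f, MonoidHom.coe_mk, OneHom.coe_mk, MonoidHom.one_apply, inv_pow] at h1
        rw [Units.val_inv_eq_inv_val, inv_eq_one, Units.val_pow_eq_pow_val] at h1
        exact hprim.pow_ne_one_of_pos_of_lt h0 (Finset.mem_range.1 hk) h1
      have := sum_hom_units_eq_zero f hf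
      rw [show (∑ ω : rootsOfUnity s ℂ, (((ω : ℂˣ)⁻¹ ^ k : ℂˣ) : ℂ)) = ∑ ω, f ω from rfl, this, zero_smul]
  rw [Finset.sum_congr rfl h, Finset.sum_ite_eq', if_pos (Finset.mem_range.2 (NeZero.pos s)),
    smul_smul, inv_mul_cancel₀ (by exact_mod_cast NeZero.ne s), one_smul]

end Spectral

/-! ### Twists by linear characters and the base group -/

section Dual

variable {K₀ : Type*} [CommGroup K₀] [Finite K₀]

instance : Finite (K₀ →* ℂˣ) :=
  Finite.of_equiv K₀ (CommGroup.monoidHom_mulEquiv_of_hasEnoughRootsOfUnity K₀ ℂ).some.toEquiv.symm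

/-- Column orthogonality for the linear characters of a finite abelian group. -/
theorem sum_dual [Fintype (K₀ →* ℂˣ)] [DecidableEq K₀] (k : K₀) :
    ∑ ξ : K₀ →* ℂˣ, (ξ k : ℂ) = if k = 1 then (Nat.card K₀ : ℂ) else 0 := by
  split_ifs with h
  · subst h
    simp [← Nat.card_eq_fintype_card, CommGroup.card_monoidHom_of_hasEnoughRootsOfUnity K₀ ℂ]
  · obtain ⟨φ, hφ⟩ := CommGroup.exists_apply_ne_one_of_hasEnoughRootsOfUnity K₀ ℂ h
    have h1 : (φ k : ℂ) * ∑ ξ : K₀ →* ℂˣ, (ξ k : ℂ) = ∑ ξ : K₀ →* ℂˣ, (ξ k : ℂ) := by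
      rw [Finset.mul_sum]
      exact Fintype.sum_equiv (Equiv.mulLeft φ) _ _ fun ξ => by simp
    have h2 : ((φ k : ℂ) - 1) * ∑ ξ : K₀ →* ℂˣ, (ξ k : ℂ) = 0 := by rw [sub_mul, h1, one_mul, sub_self]
    refine (mul_eq_zero.1 h2).resolve_left fun h3 => hφ ?_
    ext
    simpa [sub_eq_zero] using h3

end Dual

section Twist

variable {G₀ K₀ : Type*} [Group G₀] [CommGroup K₀] (π₀ : G₀ →* K₀)

/-- The twist `(ξ ∘ π₀) η` of a function on `G₀` by a linear character of `K₀`. -/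
def tw (ξ : K₀ →* ℂˣ) (η : G₀ → ℂ) : G₀ → ℂ := fun x => (ξ (π₀ x) : ℂ) * η x

/-- The stabilizer of a function on `G₀` in the group of linear characters of `K₀`. For `π₀` part of a
`Setting`, this is `Setting.stab`. -/
def stabC (η : G₀ → ℂ) : Subgroup (K₀ →* ℂˣ) where
  carrier := {ξ | ∀ x, (ξ (π₀ x) : ℂ) * η x = η x}
  one_mem' := by simp
  mul_mem' := by
    intro ξ ζ hξ hζ x
    rw [MonoidHom.mul_apply, Units.val_mul, mul_assoc, hζ x, hξ x]
  inv_mem' := by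
    intro ξ hξ x
    rw [MonoidHom.inv_apply, Units.inv_mul_eq_iff_eq_mul, hξ x]

theorem mem_stabC {η : G₀ → ℂ} {ξ : K₀ →* ℂˣ} : ξ ∈ stabC π₀ η ↔ tw π₀ ξ η = η :=
  ⟨fun h => funext h, fun h x => congrFun h x⟩

theorem tw_mul (ξ ξ' : K₀ →* ℂˣ) (η : G₀ → ℂ) : tw π₀ (ξ * ξ') η = tw π₀ ξ (tw π₀ ξ' η) := by
  ext x; simp [tw, mul_assoc]

theorem tw_one (η : G₀ → ℂ) : tw π₀ 1 η = η := by ext x; simp [tw]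

theorem tw_eq_tw_iff (ξ ξ' : K₀ →* ℂˣ) (η : G₀ → ℂ) :
    tw π₀ ξ η = tw π₀ ξ' η ↔ ξ⁻¹ * ξ' ∈ stabC π₀ η := by
  rw [mem_stabC, tw_mul]
  constructor
  · intro h; rw [← h, ← tw_mul, show ξ⁻¹ * ξ = 1 from inv_mul_cancel ξ, tw_one]
  · intro h; conv_lhs => rw [← h]
    rw [← tw_mul, show ξ * ξ⁻¹ = 1 from mul_inv_cancel ξ, tw_one]

/-- The twist of a representation by matrices. -/
def twRep {n : Type*} [Fintype n] [DecidableEq n] (ξ : K₀ →* ℂˣ) (R : G₀ →* Matrix n n ℂ) :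
    G₀ →* Matrix n n ℂ where
  toFun x := (ξ (π₀ x) : ℂ) • R x
  map_one' := by simp
  map_mul' x y := by
    rw [smul_mul_smul_comm, map_mul, map_mul, map_mul, Units.val_mul]

theorem chr_twRep {n : Type*} [Fintype n] [DecidableEq n] (ξ : K₀ →* ℂˣ) (R : G₀ →* Matrix n n ℂ) :
    chr (twRep π₀ ξ R) = tw π₀ ξ (chr R) := by
  ext x; simp [chr, twRep, tw]

theorem tw_mem_Irr [Finite G₀] (ξ : K₀ →* ℂˣ) {η : G₀ → ℂ} (h : η ∈ Irr G₀) :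
    tw π₀ ξ η ∈ Irr G₀ := by
  have := Fintype.ofFinite G₀
  obtain ⟨n, R, rfl⟩ := exists_matrix_of_mem_Irr h
  rw [← chr_twRep, chr_mem_Irr_iff, ← (chr_mem_Irr_iff R).1 h, ip_eq, ip_eq]
  congr 1
  refine Finset.sum_congr rfl fun x _ => ?_
  simp only [chr_twRep, tw, map_inv, Units.val_inv_eq_inv_val]
  have := (ξ (π₀ x)).ne_zero
  field_simp

/-- The operator realizing the isomorphism between `η` and its twist by an element of the
stabilizer, normalized to have the order of that element. -/
theorem exists_twist_operator [Finite G₀] [Finite K₀] {n : Type*} [Fintype n] [DecidableEq n]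
    {R : G₀ →* Matrix n n ℂ} (h : chr R ∈ Irr G₀) {ζ : K₀ →* ℂˣ} (hζ : ζ ∈ stabC π₀ (chr R)) :
    ∃ E : (Matrix n n ℂ)ˣ, E ^ orderOf ζ = 1 ∧
      ∀ x, (E : Matrix n n ℂ) * R x = (ζ (π₀ x) : ℂ) • (R x * E) := by
  obtain ⟨Q, hQ⟩ := exists_intertwiner (τ := twRep π₀ ζ R) h
    (by rw [chr_twRep, (mem_stabC π₀).1 hζ])
  have hQ' : ∀ x, (Q : Matrix n n ℂ) * R x = (ζ (π₀ x) : ℂ) • (R x * Q) := fun x => by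
    rw [← hQ]; simp [twRep]
  have hpow : ∀ (k : ℕ) x, (Q : Matrix n n ℂ) ^ k * R x =
      (ζ (π₀ x) : ℂ) ^ k • (R x * (Q : Matrix n n ℂ) ^ k) := by
    intro k x
    induction k with
    | zero => simp
    | succ k ih =>
      rw [pow_succ', mul_assoc, ih, mul_smul_comm, ← mul_assoc, hQ', smul_mul_assoc, smul_smul,
        pow_succ (ζ (π₀ x) : ℂ), mul_assoc]
  have hs := (orderOf_pos ζ).ne'
  -- the power of `Q` at the order of `ζ` commutes with `R`
  obtain ⟨c, hc⟩ := schur_scalar h ((Q : Matrix n n ℂ) ^ orderOf ζ) fun x => by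
    have hz : (ζ (π₀ x) : ℂ) ^ orderOf ζ = 1 := by
      rw [← Units.val_pow_eq_pow_val, ← MonoidHom.pow_apply, pow_orderOf_eq_one]
      simp
    rw [hpow, hz, one_smul]
  have hn := nonempty_of_mem_Irr h
  have hc0 : c ≠ 0 := by
    rintro rfl
    rw [zero_smul, ← Units.val_pow_eq_pow_val] at hc
    exact (Q ^ orderOf ζ).ne_zero hc
  -- a root of the scalar normalizes the operator to finite order
  obtain ⟨r, hr⟩ := IsAlgClosed.exists_pow_nat_eq c⁻¹ (orderOf_pos ζ)
  have hr0 : r ≠ 0 := by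
    rintro rfl
    rw [zero_pow hs] at hr
    exact inv_ne_zero hc0 hr.symm
  refine ⟨⟨r • Q.val, r⁻¹ • Q⁻¹.val, ?_, ?_⟩, ?_, ?_⟩
  · rw [smul_mul_smul_comm, mul_inv_cancel₀ hr0, Units.mul_inv, one_smul]
  · rw [smul_mul_smul_comm, inv_mul_cancel₀ hr0, Units.inv_mul, one_smul]
  · ext1
    rw [Units.val_pow_eq_pow_val, smul_pow, hc, hr, smul_smul, inv_mul_cancel₀ hc0, one_smul]
    rfl
  · intro x
    simp only [smul_mul_assoc, mul_smul_comm, hQ']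
    rw [smul_comm]

theorem twist_operator_pow {n : Type*} [Fintype n] [DecidableEq n]
    {R : G₀ →* Matrix n n ℂ} {ζ : K₀ →* ℂˣ} {E : (Matrix n n ℂ)ˣ}
    (hE : ∀ x, (E : Matrix n n ℂ) * R x = (ζ (π₀ x) : ℂ) • (R x * E)) (k : ℕ) (x : G₀) :
    (E : Matrix n n ℂ) ^ k * R x = ((ζ ^ k) (π₀ x) : ℂ) • (R x * (E : Matrix n n ℂ) ^ k) := by
  induction k with
  | zero => simp
  | succ k ih =>
    rw [pow_succ', mul_assoc, ih, mul_smul_comm, ← mul_assoc, hE, smul_mul_assoc, smul_smul,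
      pow_succ ζ, mul_assoc, MonoidHom.mul_apply, Units.val_mul]

/-- The powers of the twist operator are traceless below its order, because conjugation by a suitable `R x`
multiplies them by a scalar different from `1`. -/
theorem trace_twist_operator_pow {n : Type*} [Fintype n] [DecidableEq n]
    (hπ₀ : Function.Surjective π₀) {R : G₀ →* Matrix n n ℂ} {ζ : K₀ →* ℂˣ} {E : (Matrix n n ℂ)ˣ}
    (hE : ∀ x, (E : Matrix n n ℂ) * R x = (ζ (π₀ x) : ℂ) • (R x * E)) {k : ℕ} (hk : k ≠ 0)
    (hk' : k < orderOf ζ) : ((E : Matrix n n ℂ) ^ k).trace = 0 := by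
  have h1 : ζ ^ k ≠ 1 := pow_ne_one_of_lt_orderOf hk hk'
  obtain ⟨y, hy⟩ : ∃ y, (ζ ^ k) y ≠ 1 := by
    by_contra! h
    exact h1 (MonoidHom.ext h)
  obtain ⟨x, rfl⟩ := hπ₀ y
  have h2 := congrArg (fun M => (M * R x⁻¹).trace) (twist_operator_pow π₀ hE k x)
  have h3 : R x * R x⁻¹ = 1 := by rw [← map_mul, mul_inv_cancel, map_one]
  have h4 : R x⁻¹ * R x = 1 := by rw [← map_mul, inv_mul_cancel, map_one]
  simp only [mul_assoc, h3, mul_one, smul_mul_assoc, Matrix.trace_smul, smul_eq_mul] at h2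
  rw [Matrix.trace_mul_comm (R x), mul_assoc, h4, mul_one] at h2
  have h5 : (((ζ ^ k) (π₀ x) : ℂ) - 1) * ((E : Matrix n n ℂ) ^ k).trace = 0 := by
    rw [sub_mul, ← h2, one_mul, sub_self]
  refine (mul_eq_zero.1 h5).resolve_left fun h6 => hy ?_
  ext
  simpa [sub_eq_zero] using h6

end Twist

section Base

variable {A : ℕ} [NeZero A] {G₀ K₀ : Type*} [Group G₀] [CommGroup K₀] (π₀ : G₀ →* K₀)

/-- The homomorphism `t ↦ ∏ π₀ (t_i)` on the base group of the wreath product. -/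
def bmap (A : ℕ) [NeZero A] (π₀ : G₀ →* K₀) : (F A → G₀) →* K₀ where
  toFun t := ∏ i, π₀ (t i)
  map_one' := by simp
  map_mul' s t := by simp [Finset.prod_mul_distrib]

theorem bmap_apply (t : F A → G₀) : bmap A π₀ t = ∏ i, π₀ (t i) := rfl

theorem bmap_surjective (h : Function.Surjective π₀) : Function.Surjective (bmap A π₀) := by
  intro k
  obtain ⟨x, rfl⟩ := h k
  refine ⟨Pi.mulSingle 1 x, ?_⟩
  rw [bmap_apply, Finset.prod_eq_single 1] <;> simp +contextual

theorem mem_H_iff {w : G₀ ≀ᵣ F A} : w ∈ H A π₀ ↔ w.right = 1 ∧ bmap A π₀ w.left = 1 := by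
  rw [MonoidHom.mem_ker, MonoidHom.prod_apply, Prod.mk_eq_one]
  rfl

theorem mem_Hhat_iff {w : G₀ ≀ᵣ F A} : w ∈ Hhat A π₀ ↔ bmap A π₀ w.left = 1 := Iff.rfl

/-- `H` is the kernel of `t ↦ ∏ π₀ (t_i)` on the base group. -/
def kerEquivH : (bmap A π₀).ker ≃ H A π₀ where
  toFun t := ⟨⟨t, 1⟩, (mem_H_iff π₀).2 ⟨rfl, t.2⟩⟩
  invFun h := ⟨h.1.left, ((mem_H_iff π₀).1 h.2).2⟩
  left_inv _ := rfl
  right_inv h := by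
    ext1
    exact RegularWreathProduct.ext rfl ((mem_H_iff π₀).1 h.2).1.symm

theorem H_right (h : H A π₀) : (h : G₀ ≀ᵣ F A).right = 1 := ((mem_H_iff π₀).1 h.2).1

theorem H_left_mul (h h' : H A π₀) :
    ((h * h' : H A π₀) : G₀ ≀ᵣ F A).left = (h : G₀ ≀ᵣ F A).left * (h' : G₀ ≀ᵣ F A).left := by
  rw [Subgroup.coe_mul, RegularWreathProduct.mul_left, H_right]
  simp

theorem H_left_inv (h : H A π₀) :
    ((h⁻¹ : H A π₀) : G₀ ≀ᵣ F A).left = ((h : G₀ ≀ᵣ F A).left)⁻¹ := by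
  rw [InvMemClass.coe_inv, RegularWreathProduct.inv_left, H_right]
  ext; simp

variable [Finite G₀] [Finite K₀]

omit [Finite G₀] [Finite K₀] in
theorem card_H_mul (h : Function.Surjective π₀) :
    Nat.card (H A π₀) * Nat.card K₀ = Nat.card G₀ ^ A := by
  rw [← Nat.card_congr (kerEquivH π₀), ← Nat.card_congr (QuotientGroup.quotientKerEquivOfSurjective
    _ (bmap_surjective (A := A) π₀ h)).toEquiv, mul_comm, ← Subgroup.card_eq_card_quotient_mul_card_subgroup,
    Nat.card_fun]
  congr 1
  exact Nat.card_zmod A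

/-- Inner products over `H` as sums over the base group. -/
theorem ip_H [Fintype (K₀ →* ℂˣ)] (h : Function.Surjective π₀) (f f' : (F A → G₀) → ℂ) :
    ip (fun x : H A π₀ => f (x : G₀ ≀ᵣ F A).left) (fun x : H A π₀ => f' (x : G₀ ≀ᵣ F A).left) =
      ∑ ξ : K₀ →* ℂˣ, ip (fun t => (ξ (bmap A π₀ t) : ℂ) * f t) f' := by
  classical
  have := Fintype.ofFinite G₀
  have := Fintype.ofFinite (H A π₀)
  have hK : (Nat.card K₀ : ℂ) ≠ 0 := natCard_ne_zero
  have hH : (Nat.card (H A π₀) : ℂ) ≠ 0 := natCard_ne_zero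
  have hcard : (Nat.card (F A → G₀) : ℂ) = Nat.card (H A π₀) * Nat.card K₀ := by
    rw [← Nat.cast_mul, card_H_mul π₀ h, Nat.card_fun]
    congr 2
    exact Nat.card_zmod A
  simp only [ip_eq]
  rw [← Finset.mul_sum, Finset.sum_comm, hcard]
  have h1 : ∀ t : F A → G₀, ∑ ξ : K₀ →* ℂˣ, (ξ (bmap A π₀ t) : ℂ) * f t * f' t⁻¹ =
      if t ∈ (bmap A π₀).ker then (Nat.card K₀ : ℂ) * (f t * f' t⁻¹) else 0 := by
    intro t
    simp only [mul_assoc]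
    rw [← Finset.sum_mul, sum_dual]
    by_cases ht : bmap A π₀ t = 1
    · rw [if_pos ht, if_pos (MonoidHom.mem_ker.2 ht)]
    · rw [if_neg ht, if_neg fun h' => ht (MonoidHom.mem_ker.1 h'), zero_mul]
  rw [Finset.sum_congr rfl fun t _ => h1 t, ← Finset.sum_filter,
    Finset.sum_subtype (p := fun t => t ∈ (bmap A π₀).ker) _
    (by simp), ← Finset.mul_sum]
  rw [Fintype.sum_equiv (kerEquivH π₀) (fun t : (bmap A π₀).ker => f t * f' (t : F A → G₀)⁻¹)
    (fun x => f (x : G₀ ≀ᵣ F A).left * f' ((x⁻¹ : H A π₀) : G₀ ≀ᵣ F A).left)]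
  · field_simp
  · intro t
    rw [H_left_inv]
    rfl

/-- Inner products of product functions on a power of a group. -/
theorem ip_prod (f f' : F A → G₀ → ℂ) :
    ip (fun t : F A → G₀ => ∏ i, f i (t i)) (fun t => ∏ i, f' i (t i)) = ∏ i, ip (f i) (f' i) := by
  have := Fintype.ofFinite G₀
  simp only [ip_eq, Pi.inv_apply, ← Finset.prod_mul_distrib]
  rw [Finset.prod_mul_distrib, Finset.prod_univ_sum, Fintype.piFinset_univ]
  simp

end Base

/-! ### The representation of the base group attached to a twist -/

section Index

variable {A : ℕ} [NeZero A] (α : F A ≃* Multiplicative (ZMod A))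

/-- The representative in `[0, A)` of the coordinate of an element of `F_A`. -/
def idx (i : F A) : ℕ := (Multiplicative.toAdd (α i)).val

/-- The generator of `F_A` of coordinate `1`. -/
def gen : F A := α.symm (Multiplicative.ofAdd 1)

theorem idx_mul (i j : F A) : idx α (i * j) = (idx α i + idx α j) % A := by
  simp [idx, ZMod.val_add]

omit [NeZero A] in
theorem idx_one : idx α 1 = 0 := by simp [idx]

omit [NeZero A] in
theorem idx_gen : idx α (gen α) = 1 % A := by
  simp only [idx, gen, MulEquiv.apply_symm_apply, toAdd_ofAdd]
  exact ZMod.val_one_eq_one_mod A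

/-- Multiplication by the generator wraps around at the last index. -/
theorem idx_gen_mul (i : F A) : idx α (gen α * i) = if idx α i = A - 1 then 0 else idx α i + 1 := by
  have h2 : idx α i < A := ZMod.val_lt _
  rw [idx_mul, idx_gen, Nat.mod_add_mod]
  split_ifs with h
  · rw [h, Nat.add_sub_cancel' (NeZero.one_le), Nat.mod_self]
  · rw [Nat.mod_eq_of_lt (by omega), add_comm]

theorem gen_pow_idx (i : F A) : gen α ^ idx α i = i := by
  apply α.injective
  apply Multiplicative.toAdd.injective
  simp [gen, idx]

omit [NeZero A] in
theorem gen_pow_A : gen α ^ A = 1 := by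
  apply α.injective
  apply Multiplicative.toAdd.injective
  simp [gen]

end Index

section Operators

variable {A : ℕ} [NeZero A] {G₀ K₀ : Type*} [Group G₀] [CommGroup K₀] (π₀ : G₀ →* K₀)
  (α : F A ≃* Multiplicative (ZMod A)) {n : Type*} [Fintype n] [DecidableEq n]

/-- The tuple of characters `ξ^i η`, `0 ≤ i < A`. -/
def chi (ξ : K₀ →* ℂˣ) (η : G₀ → ℂ) (i : F A) : G₀ → ℂ := tw π₀ (ξ ^ idx α i) η

/-- The representation of the base group `G₀^A` with character `∏ ξ^i η`. -/
def baseRep (ξ : K₀ →* ℂˣ) (R : G₀ →* Matrix n n ℂ) :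
    (F A → G₀) →* Matrix (F A → n) (F A → n) ℂ where
  toFun t := tens fun i => twRep π₀ (ξ ^ idx α i) R (t i)
  map_one' := by simp [tens_one]
  map_mul' s t := by simp [tens_mul]

theorem chr_baseRep (ξ : K₀ →* ℂˣ) (R : G₀ →* Matrix n n ℂ) (t : F A → G₀) :
    chr (baseRep π₀ α ξ R) t = ∏ i, chi π₀ α ξ (chr R) i (t i) := by
  simp only [chi, ← chr_twRep]
  exact trace_tens _

/-- The operator of the wreath generator: the cyclic permutation of the factors, corrected at the
last factor by the twist operator. -/
def shiftOp (E : (Matrix n n ℂ)ˣ) (m : ℕ) : (Matrix (F A → n) (F A → n) ℂ)ˣ :=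
  permTensUnit n (Equiv.mulLeft (gen α)) * tensUnit fun i => if idx α i = A - 1 then E ^ m else 1

/-- The action of the wreath generator on the base group. -/
def shift (x : F A) (t : F A → G₀) : F A → G₀ := fun y => t (x⁻¹ * y)

theorem val_shiftOp (E : (Matrix n n ℂ)ˣ) (m : ℕ) : (shiftOp α E m : Matrix (F A → n) (F A → n) ℂ) =
    permTens n (Equiv.mulLeft (gen α)) *
      tens fun i => if idx α i = A - 1 then (E : Matrix n n ℂ) ^ m else 1 := by
  rw [shiftOp, Units.val_mul, val_tensUnit]
  congr 2
  ext i
  split_ifs <;> simp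

theorem shiftOp_commute (E : (Matrix n n ℂ)ˣ) (m : ℕ) :
    Commute (tens fun _ : F A => (E : Matrix n n ℂ)) (shiftOp α E m : Matrix (F A → n) (F A → n) ℂ) := by
  rw [Commute, SemiconjBy, val_shiftOp, mul_assoc, tens_mul, ← mul_assoc,
    ← permTens_mul_tens (Equiv.mulLeft (gen α)) (fun _ => (E : Matrix n n ℂ)), mul_assoc, tens_mul]
  congr 2
  ext1 i
  split_ifs
  · exact (Commute.self_pow _ _).eq
  · simp

variable {π₀} {ξ ζ : K₀ →* ℂˣ} {R : G₀ →* Matrix n n ℂ} {E : (Matrix n n ℂ)ˣ}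

/-- The tensor power of the twist operator commutes with the base representation up to `ζ`. -/
theorem tens_mul_baseRep (hE : ∀ x, (E : Matrix n n ℂ) * R x = (ζ (π₀ x) : ℂ) • (R x * E))
    (t : F A → G₀) : (tens fun _ : F A => (E : Matrix n n ℂ)) * baseRep π₀ α ξ R t =
      (ζ (bmap A π₀ t) : ℂ) • (baseRep π₀ α ξ R t * tens fun _ => (E : Matrix n n ℂ)) := by
  simp only [baseRep, MonoidHom.coe_mk, OneHom.coe_mk, tens_mul]
  rw [bmap_apply, map_prod, Units.coe_prod, ← tens_smul]
  congr 1
  ext1 i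
  simp only [twRep, MonoidHom.coe_mk, OneHom.coe_mk, mul_smul_comm, smul_mul_assoc, hE]
  rw [smul_comm]

/-- The operator of the wreath generator implements the cyclic shift of the base group, up to `ξ`. The
correction by `E ^ m` at the last factor, where `ζ^m = ξ^{-A}`, accounts for `ξ^A η = η`. -/
theorem shiftOp_mul_baseRep (hE : ∀ x, (E : Matrix n n ℂ) * R x = (ζ (π₀ x) : ℂ) • (R x * E))
    {m : ℕ} (hm : ζ ^ m * ξ ^ A = 1) (t : F A → G₀) :
    (shiftOp α E m : Matrix (F A → n) (F A → n) ℂ) * baseRep π₀ α ξ R t =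
      (((ξ (bmap A π₀ t))⁻¹ : ℂˣ) : ℂ) • (baseRep π₀ α ξ R (shift (gen α) t) * shiftOp α E m) := by
  have key : ∀ i, (if idx α i = A - 1 then (E : Matrix n n ℂ) ^ m else 1) *
      twRep π₀ (ξ ^ idx α i) R (t i) = (((ξ (π₀ (t i)))⁻¹ : ℂˣ) : ℂ) •
        (twRep π₀ (ξ ^ idx α (gen α * i)) R (t i) *
          (if idx α i = A - 1 then (E : Matrix n n ℂ) ^ m else 1)) := by
    intro i
    rw [idx_gen_mul]
    simp only [twRep, MonoidHom.coe_mk, OneHom.coe_mk]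
    split_ifs with h
    · rw [mul_smul_comm, twist_operator_pow π₀ hE, smul_smul, smul_mul_assoc, smul_smul,
        ← Units.val_mul, ← Units.val_mul, ← MonoidHom.mul_apply]
      congr 2
      have h1 : ξ ^ idx α i * ζ ^ m = ξ⁻¹ := by
        rw [h]
        ext1 x
        have h2 := DFunLike.congr_fun hm x
        simp only [MonoidHom.mul_apply, MonoidHom.pow_apply, MonoidHom.inv_apply,
          MonoidHom.one_apply] at h2 ⊢
        rw [eq_inv_iff_mul_eq_one, mul_right_comm, ← pow_succ, Nat.sub_add_cancel NeZero.one_le,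
          mul_comm, h2]
      rw [h1]
      simp
    · rw [one_mul, mul_one, smul_smul, ← Units.val_mul]
      congr 2
      rw [MonoidHom.pow_apply, MonoidHom.pow_apply, pow_succ', inv_mul_cancel_left]
  rw [val_shiftOp, mul_assoc]
  simp only [baseRep, MonoidHom.coe_mk, OneHom.coe_mk, tens_mul]
  simp only [key]
  rw [tens_smul, ← Units.coe_prod, Finset.prod_inv_distrib, ← map_prod, ← bmap_apply,
    mul_smul_comm]
  congr 1
  rw [← tens_mul, ← mul_assoc, ← mul_assoc, permTens_mul_tens]
  congr 3
  ext1 i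
  simp [shift]

theorem bmap_shift (x : F A) (t : F A → G₀) : bmap A π₀ (shift x t) = bmap A π₀ t :=
  Fintype.prod_equiv (Equiv.mulLeft x⁻¹) _ _ fun _ => rfl

theorem shiftOp_pow_mul_baseRep
    (hE : ∀ x, (E : Matrix n n ℂ) * R x = (ζ (π₀ x) : ℂ) • (R x * E))
    {m : ℕ} (hm : ζ ^ m * ξ ^ A = 1) (k : ℕ) (t : F A → G₀) :
    (shiftOp α E m : Matrix (F A → n) (F A → n) ℂ) ^ k * baseRep π₀ α ξ R t =
      (((ξ (bmap A π₀ t))⁻¹ ^ k : ℂˣ) : ℂ) • (baseRep π₀ α ξ R (shift (gen α ^ k) t) *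
        (shiftOp α E m : Matrix (F A → n) (F A → n) ℂ) ^ k) := by
  induction k generalizing t with
  | zero =>
    have : shift 1 t = t := by ext; simp [shift]
    simp [this]
  | succ k ih =>
    rw [pow_succ, mul_assoc, shiftOp_mul_baseRep α hE hm, mul_smul_comm, ← mul_assoc, ih,
      smul_mul_assoc, smul_smul, bmap_shift, pow_succ _⁻¹, Units.val_mul, mul_comm (Units.val _),
      mul_assoc]
    congr 3
    ext1 i
    simp [shift, pow_succ, mul_assoc]

end Operators

section Tuples

variable {A : ℕ} [NeZero A] {G₀ K₀ : Type*} [Group G₀] [CommGroup K₀] {π₀ : G₀ →* K₀}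
  [Finite G₀] [Finite K₀] (α : F A ≃* Multiplicative (ZMod A))

/-- Two tuples of irreducible characters have a common constituent on `H` only if they differ by a
simultaneous twist. -/
theorem ip_H_tuple [Fintype (K₀ →* ℂˣ)] (h : Function.Surjective π₀) (χ χ' : F A → G₀ → ℂ) :
    ip (fun x : H A π₀ => ∏ i, χ i ((x : G₀ ≀ᵣ F A).left i))
      (fun x : H A π₀ => ∏ i, χ' i ((x : G₀ ≀ᵣ F A).left i)) =
      ∑ ξ : K₀ →* ℂˣ, ∏ i, ip (tw π₀ ξ (χ i)) (χ' i) := by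
  rw [ip_H π₀ h (fun t => ∏ i, χ i (t i)) (fun t => ∏ i, χ' i (t i))]
  refine Finset.sum_congr rfl fun ξ _ => ?_
  rw [← ip_prod]
  congr 1
  ext t
  simp only [tw, bmap_apply, map_prod, Units.coe_prod, Finset.prod_mul_distrib]

/-- The restriction of the tuple `ξ^i η` to `H` has norm `|Stab η|`. -/
theorem ip_H_chi (h : Function.Surjective π₀) {η : G₀ → ℂ} (hη : η ∈ Irr G₀) (ξ : K₀ →* ℂˣ) :
    ip (fun x : H A π₀ => ∏ i, chi π₀ α ξ η i ((x : G₀ ≀ᵣ F A).left i))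
      (fun x : H A π₀ => ∏ i, chi π₀ α ξ η i ((x : G₀ ≀ᵣ F A).left i)) =
      Nat.card (stabC π₀ η) := by
  classical
  have := Fintype.ofFinite (K₀ →* ℂˣ)
  rw [ip_H_tuple h]
  have h1 : ∀ ξ' : K₀ →* ℂˣ, ∏ i, ip (tw π₀ ξ' (chi π₀ α ξ η i)) (chi π₀ α ξ η i) =
      if ξ' ∈ stabC π₀ η then 1 else 0 := by
    intro ξ'
    have h2 : ∀ i, ip (tw π₀ ξ' (chi π₀ α ξ η i)) (chi π₀ α ξ η i) =
        if ξ' ∈ stabC π₀ η then 1 else 0 := by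
      intro i
      rw [chi, ip_of_mem_Irr (tw_mem_Irr _ _ (tw_mem_Irr _ _ hη)) (tw_mem_Irr _ _ hη)]
      refine if_congr ?_ rfl rfl
      rw [← tw_mul, tw_eq_tw_iff, ← inv_mem_iff]
      refine iff_of_eq (congrArg (· ∈ stabC π₀ η) ?_)
      ext1 x
      simp [MonoidHom.mul_apply, MonoidHom.inv_apply]
    rw [Finset.prod_congr rfl fun i _ => h2 i]
    split_ifs
    · simp
    · exact Finset.prod_eq_zero (Finset.mem_univ 1) rfl
  rw [Finset.sum_congr rfl fun ξ' _ => h1 ξ', Finset.sum_boole, Nat.card_eq_fintype_card,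
    Fintype.card_subtype]

end Tuples

/-- A matrix of natural numbers with positive diagonal and total sum its size is the identity. -/
theorem eq_one_of_sum_eq_card {ι : Type*} [Fintype ι] [DecidableEq ι] (k : ι → ι → ℕ)
    (hk : ∀ i, k i i ≠ 0) (hsum : ∑ i, ∑ j, k i j = Fintype.card ι) (i j : ι) :
    k i j = if i = j then 1 else 0 := by
  have h1 : ∀ i ∈ Finset.univ, 1 ≤ ∑ j, k i j := fun i _ =>
    (Nat.one_le_iff_ne_zero.2 (hk i)).trans (Finset.single_le_sum (f := k i) (fun _ _ => Nat.zero_le _)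
      (Finset.mem_univ i))
  have h2 := (Finset.sum_eq_sum_iff_of_le h1).1 (by rw [hsum]; simp) i (Finset.mem_univ i)
  rw [← Finset.add_sum_erase _ _ (Finset.mem_univ i)] at h2
  have h3 := hk i
  split_ifs with h
  · subst h; omega
  · have h4 : ∑ j ∈ Finset.univ.erase i, k i j = 0 := by omega
    exact Finset.sum_eq_zero_iff.1 h4 j (Finset.mem_erase.2 ⟨Ne.symm h, Finset.mem_univ j⟩)

/-! ### Irreducible pieces of the restriction to `H` -/

section CompressRep

variable {Γ V d : Type*} [Group Γ] [Fintype V] [DecidableEq V] [Fintype d] [DecidableEq d]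
  {P : Matrix V V ℂ} {I : Matrix V d ℂ} {J : Matrix d V ℂ}

/-- The representation cut out by an idempotent `P = I J` commuting with a representation. -/
def compressRep (ρ : Γ →* Matrix V V ℂ) (hJI : J * I = 1) (hIJ : I * J = P)
    (hc : ∀ x, Commute P (ρ x)) : Γ →* Matrix d d ℂ where
  toFun x := J * ρ x * I
  map_one' := by rw [map_one, Matrix.mul_one, hJI]
  map_mul' x y := by rw [map_mul, compress_mul hJI hIJ _ (hc y)]

theorem chr_compressRep (ρ : Γ →* Matrix V V ℂ) (hJI : J * I = 1) (hIJ : I * J = P)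
    (hc : ∀ x, Commute P (ρ x)) (x : Γ) :
    chr (compressRep ρ hJI hIJ hc) x = (ρ x * P).trace := trace_compress hIJ _

end CompressRep

section Pieces

variable {A : ℕ} [NeZero A] {G₀ K₀ : Type*} [Group G₀] [CommGroup K₀] {π₀ : G₀ →* K₀}
  (α : F A ≃* Multiplicative (ZMod A)) {n : Type*} [Fintype n] [DecidableEq n]
  {ξ ζ : K₀ →* ℂˣ} {R : G₀ →* Matrix n n ℂ} {E : (Matrix n n ℂ)ˣ}

variable (π₀) in
/-- The embedding of `H` in the base group. -/
def leftH : H A π₀ →* (F A → G₀) where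
  toFun h := (h : G₀ ≀ᵣ F A).left
  map_one' := rfl
  map_mul' := H_left_mul π₀

theorem bmap_leftH (h : H A π₀) : bmap A π₀ (leftH π₀ h) = 1 := ((mem_H_iff π₀).1 h.2).2

/-- The spectral projection of the tensor power of the twist operator. -/
noncomputable def pieceProj (A : ℕ) [NeZero A] (ζ : K₀ →* ℂˣ) (E : (Matrix n n ℂ)ˣ) (ω : ℂˣ) :
    Matrix (F A → n) (F A → n) ℂ :=
  specProj (tens fun _ : F A => (E : Matrix n n ℂ)) (orderOf ζ) ω

theorem pieceProj_commute (hE : ∀ x, (E : Matrix n n ℂ) * R x = (ζ (π₀ x) : ℂ) • (R x * E))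
    (ω : ℂˣ) {t : F A → G₀} (ht : ζ (bmap A π₀ t) = 1) :
    Commute (pieceProj A ζ E ω) (baseRep π₀ α ξ R t) := by
  apply specProj_commute
  rw [Commute, SemiconjBy, tens_mul_baseRep α hE, ht, Units.val_one, one_smul]

theorem tens_pow_orderOf (hEs : E ^ orderOf ζ = 1) :
    (tens fun _ : F A => (E : Matrix n n ℂ)) ^ orderOf ζ = 1 := by
  rw [tens_pow, ← Units.val_pow_eq_pow_val, hEs, Units.val_one, tens_one]

/-- Conjugation by an element of the wreath product permutes the pieces. -/
theorem trace_piece_conj (hE : ∀ x, (E : Matrix n n ℂ) * R x = (ζ (π₀ x) : ℂ) • (R x * E))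
    {m : ℕ} (hm : ζ ^ m * ξ ^ A = 1) (ω : ℂˣ) (w : G₀ ≀ᵣ F A) (h : H A π₀) :
    (baseRep π₀ α ξ R (leftH π₀ (MulAut.conjNormal w h)) * pieceProj A ζ E ω).trace =
      (baseRep π₀ α ξ R (leftH π₀ h) *
        pieceProj A ζ E ((ζ (bmap A π₀ w.left))⁻¹ * ω)).trace := by
  have h1 : leftH π₀ (MulAut.conjNormal w h) =
      w.left * shift w.right (leftH π₀ h) * w.left⁻¹ := by
    ext i
    simp [leftH, MulAut.conjNormal_apply, shift, H_right, mul_assoc]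
  set k := idx α w.right with hk
  set T := (shiftOp α E m : (Matrix (F A → n) (F A → n) ℂ)ˣ)
  set ω' := (ζ (bmap A π₀ w.left))⁻¹ * ω
  have h2 : baseRep π₀ α ξ R (shift w.right (leftH π₀ h)) =
      (T ^ k : (Matrix (F A → n) (F A → n) ℂ)ˣ).val * baseRep π₀ α ξ R (leftH π₀ h) *
        (T ^ k)⁻¹.val := by
    rw [Units.eq_mul_inv_iff_mul_eq, Units.val_pow_eq_pow_val, shiftOp_pow_mul_baseRep α hE hm,
      bmap_leftH, map_one, inv_one, one_pow, Units.val_one, one_smul, hk, gen_pow_idx]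
  -- the cyclic shift commutes with the projections, so only the base component of `w` matters
  have h3 : Commute (pieceProj A ζ E ω') ((T ^ k)⁻¹).val := by
    have : Commute (pieceProj A ζ E ω') T.val := specProj_commute _ _ _ (shiftOp_commute α E m)
    have h4 := this.pow_right k
    rw [← Units.val_pow_eq_pow_val] at h4
    exact h4.units_inv_right
  have h5 : pieceProj A ζ E ω * baseRep π₀ α ξ R w.left =
      baseRep π₀ α ξ R w.left * pieceProj A ζ E ω' :=
    specProj_mul_of_twist (tens_mul_baseRep α hE _)
  have h6 : baseRep π₀ α ξ R w.left⁻¹ * baseRep π₀ α ξ R w.left = 1 := by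
    rw [← map_mul, inv_mul_cancel, map_one]
  rw [h1, map_mul, map_mul, mul_assoc, mul_assoc, Matrix.trace_mul_comm, mul_assoc, mul_assoc, h5,
    ← mul_assoc _ (baseRep π₀ α ξ R w.left), h6, one_mul, h2, mul_assoc, mul_assoc, ← h3.eq,
    Matrix.trace_mul_comm]
  simp only [mul_assoc]
  rw [Units.inv_mul, mul_one]

variable [Finite G₀] [Finite K₀]

/-- The pieces of the restriction of `∏ ξ^i η` to `H`. -/
theorem trace_baseRep_pieces (hπ₀ : Function.Surjective π₀)
    [Fintype (rootsOfUnity (orderOf ζ) ℂ)] {η : G₀ → ℂ}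
    (hη : η ∈ Irr G₀) (hR : chr R = η) (hζ : Subgroup.zpowers ζ = stabC π₀ η)
    (hE : ∀ x, (E : Matrix n n ℂ) * R x = (ζ (π₀ x) : ℂ) • (R x * E))
    (d : rootsOfUnity (orderOf ζ) ℂ → ℕ)
    (I : ∀ ω, Matrix (F A → n) (Fin (d ω)) ℂ) (J : ∀ ω, Matrix (Fin (d ω)) (F A → n) ℂ)
    (hJI : ∀ ω, J ω * I ω = 1) (hIJ : ∀ ω, I ω * J ω = pieceProj A ζ E ω) :
    (∀ ω, (d ω : ℂ) * orderOf ζ = η 1 ^ A) ∧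
    (∀ t, ∑ ω : rootsOfUnity (orderOf ζ) ℂ, (baseRep π₀ α ξ R t * pieceProj A ζ E ω).trace =
      ∏ i, chi π₀ α ξ η i (t i)) ∧
    ∀ ω ω' : rootsOfUnity (orderOf ζ) ℂ,
      ip (fun h : H A π₀ => (baseRep π₀ α ξ R (leftH π₀ h) * pieceProj A ζ E ω).trace)
        (fun h : H A π₀ => (baseRep π₀ α ξ R (leftH π₀ h) * pieceProj A ζ E ω').trace) =
        if ω = ω' then 1 else 0 := by
  classical
  have hs : NeZero (orderOf ζ) := ⟨(orderOf_pos ζ).ne'⟩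
  have hs' : (orderOf ζ : ℂ) ≠ 0 := by exact_mod_cast NeZero.ne (orderOf ζ)
  have hη1 : η 1 = Fintype.card n := by rw [← hR, chr, map_one, Matrix.trace_one]
  have hdeg : ∀ ω, (d ω : ℂ) * orderOf ζ = η 1 ^ A := by
    intro ω
    have h1 : (d ω : ℂ) = (pieceProj A ζ E ω).trace := by
      rw [← hIJ, Matrix.trace_mul_comm, hJI, Matrix.trace_one, Fintype.card_fin]
    have h2 : ∀ k ∈ Finset.range (orderOf ζ), k ≠ 0 →
        ((((ω : ℂˣ)⁻¹ ^ k : ℂˣ) : ℂ) • (tens fun _ : F A => (E : Matrix n n ℂ)) ^ k).trace = 0 := by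
      intro k hk hk0
      rw [Matrix.trace_smul, tens_pow, trace_tens]
      simp only [trace_twist_operator_pow π₀ hπ₀ hE hk0 (Finset.mem_range.1 hk)]
      rw [Finset.prod_eq_zero (Finset.mem_univ 1) rfl, smul_zero]
    rw [h1, pieceProj, specProj, Matrix.trace_smul, Matrix.trace_sum, Finset.sum_eq_single 0 h2
      (fun h => absurd (Finset.mem_range.2 (NeZero.pos _)) h), pow_zero, pow_zero, Units.val_one,
      one_smul, Matrix.trace_one, smul_eq_mul, mul_comm, mul_inv_cancel_left₀ hs', hη1,
      Fintype.card_fun, Nat.cast_pow]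
    congr 1
    exact (Fintype.card_multiplicative _).trans (ZMod.card A)
  have hsum : ∀ t, ∑ ω : rootsOfUnity (orderOf ζ) ℂ,
      (baseRep π₀ α ξ R t * pieceProj A ζ E ω).trace = ∏ i, chi π₀ α ξ η i (t i) := by
    intro t
    rw [← Matrix.trace_sum, ← Finset.mul_sum]
    simp only [pieceProj]
    rw [sum_specProj, mul_one, ← hR]
    exact chr_baseRep π₀ α ξ R t
  refine ⟨hdeg, hsum, ?_⟩
  have hc : ∀ (ω : rootsOfUnity (orderOf ζ) ℂ) (h : H A π₀),
      Commute (pieceProj A ζ E ω) ((baseRep π₀ α ξ R).comp (leftH π₀) h) := fun ω h =>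
    pieceProj_commute α hE _ (by rw [bmap_leftH, map_one])
  let θ := fun ω => compressRep ((baseRep π₀ α ξ R).comp (leftH π₀)) (hJI ω) (hIJ ω) (hc ω)
  have hθ : ∀ ω : rootsOfUnity (orderOf ζ) ℂ,
      (fun h : H A π₀ => (baseRep π₀ α ξ R (leftH π₀ h) * pieceProj A ζ E ω).trace) = chr (θ ω) :=
    fun ω => funext fun h => (chr_compressRep _ (hJI ω) (hIJ ω) (hc ω) h).symm
  simp only [hθ]
  choose k hk using fun ω ω' => ip_chr_nat (θ ω) (θ ω')
  intro ω ω'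
  rw [hk]
  -- there are `|Stab η|` pieces, and `|Stab η|` is the norm of their sum: they are irreducible and distinct
  rw [eq_one_of_sum_eq_card k]
  · split_ifs <;> simp
  · intro ω h0
    have h1 := intertwiner_eq_zero (ρ := θ ω) (τ := θ ω) (by rw [hk, h0, Nat.cast_zero]) 1
      (fun x => by rw [mul_one, one_mul])
    have h2 := congrArg Matrix.trace h1
    rw [Matrix.trace_one, Matrix.trace_zero, Fintype.card_fin] at h2
    have h3 := hdeg ω
    rw [h2, zero_mul] at h3
    exact pow_ne_zero _ (irr_one_ne_zero hη) h3.symm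
  · have hcard := Complex.card_rootsOfUnity (orderOf ζ)
    rw [Nat.card_eq_fintype_card] at hcard
    have h1 := ip_H_chi α hπ₀ hη ξ
    rw [← hζ, Nat.card_zpowers] at h1
    have h2 : (fun x : H A π₀ => ∏ i, chi π₀ α ξ η i ((x : G₀ ≀ᵣ F A).left i)) =
        fun x => ∑ ω, chr (θ ω) x := by
      ext x
      rw [← hsum]
      exact Finset.sum_congr rfl fun ω _ => congrFun (hθ ω) x
    rw [h2, ip_sum_left] at h1
    rw [hcard]
    have h3 : ((∑ ω, ∑ ω', k ω ω' : ℕ) : ℂ) = (orderOf ζ : ℂ) := by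
      rw [← h1]
      push_cast
      refine Finset.sum_congr rfl fun ω _ => ?_
      rw [ip_comm, ip_sum_left]
      refine Finset.sum_congr rfl fun ω' _ => ?_
      rw [ip_comm, hk]
    exact_mod_cast h3

end Pieces

/-! ### Extension of the pieces to `Ĥ` -/

section Extension

variable {A : ℕ} [NeZero A] {G₀ K₀ : Type*} [Group G₀] [CommGroup K₀] {π₀ : G₀ →* K₀}
  (α : F A ≃* Multiplicative (ZMod A)) {n : Type*} [Fintype n] [DecidableEq n]
  {ξ ζ : K₀ →* ℂˣ} {R : G₀ →* Matrix n n ℂ} {E : (Matrix n n ℂ)ˣ}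
  [Finite G₀] [Finite K₀]

omit [Finite K₀] in
/-- The operator of the wreath generator on a piece, normalized so that its `A`-th power is `1`. -/
theorem exists_piece_operator
    (hE : ∀ x, (E : Matrix n n ℂ) * R x = (ζ (π₀ x) : ℂ) • (R x * E))
    {m : ℕ} (hm : ζ ^ m * ξ ^ A = 1) {ω : ℂˣ} {d : ℕ}
    {I : Matrix (F A → n) (Fin d) ℂ} {J : Matrix (Fin d) (F A → n) ℂ} (hJI : J * I = 1)
    (hIJ : I * J = pieceProj A ζ E ω)
    (hirr : (fun h : H A π₀ => (baseRep π₀ α ξ R (leftH π₀ h) * pieceProj A ζ E ω).trace) ∈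
      Irr (H A π₀)) :
    ∃ τ : Matrix (Fin d) (Fin d) ℂ, τ ^ A = 1 ∧ ∀ (k : ℕ) (t : F A → G₀), ζ (bmap A π₀ t) = 1 →
      τ ^ k * (J * baseRep π₀ α ξ R t * I) = (((ξ (bmap A π₀ t))⁻¹ ^ k : ℂˣ) : ℂ) •
        ((J * baseRep π₀ α ξ R (shift (gen α ^ k) t) * I) * τ ^ k) := by
  set T := (shiftOp α E m : (Matrix (F A → n) (F A → n) ℂ)ˣ) with hTdef
  set P := pieceProj A ζ E ω
  have hPT : Commute P T.val := specProj_commute _ _ _ (shiftOp_commute α E m)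
  have hPρ : ∀ t, ζ (bmap A π₀ t) = 1 → Commute P (baseRep π₀ α ξ R t) := fun t ht =>
    pieceProj_commute α hE _ ht
  have hpow : ∀ k : ℕ, (J * T.val * I) ^ k = J * T.val ^ k * I := by
    intro k
    induction k with
    | zero => rw [pow_zero, pow_zero, Matrix.mul_one, hJI]
    | succ k ih => rw [pow_succ, ih, pow_succ, compress_mul hJI hIJ _ hPT]
  have hrel : ∀ (k : ℕ) (t : F A → G₀), ζ (bmap A π₀ t) = 1 →
      (J * T.val * I) ^ k * (J * baseRep π₀ α ξ R t * I) = (((ξ (bmap A π₀ t))⁻¹ ^ k : ℂˣ) : ℂ) •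
        ((J * baseRep π₀ α ξ R (shift (gen α ^ k) t) * I) * (J * T.val * I) ^ k) := by
    intro k t ht
    rw [hpow, ← compress_mul hJI hIJ _ (hPρ t ht), shiftOp_pow_mul_baseRep α hE hm,
      Matrix.mul_smul, Matrix.smul_mul, compress_mul hJI hIJ _ (hPT.pow_right k)]
  -- by Schur's lemma the `A`-th power is a scalar
  have hc : ∀ h : H A π₀, Commute P ((baseRep π₀ α ξ R).comp (leftH π₀) h) := fun h =>
    hPρ _ (by rw [bmap_leftH, map_one])
  have hθ : (fun h : H A π₀ => (baseRep π₀ α ξ R (leftH π₀ h) * P).trace) =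
      chr (compressRep ((baseRep π₀ α ξ R).comp (leftH π₀)) hJI hIJ hc) :=
    funext fun h => (chr_compressRep _ hJI hIJ hc h).symm
  rw [hθ] at hirr
  obtain ⟨c, hcA⟩ := schur_scalar hirr ((J * T.val * I) ^ A) fun h => by
    have h1 := hrel A (leftH π₀ h) (by rw [bmap_leftH, map_one])
    have h2 : shift (1 : F A) (leftH π₀ h) = leftH π₀ h := by ext; simp [shift]
    rw [gen_pow_A, h2, bmap_leftH, map_one, inv_one, one_pow, Units.val_one, one_smul] at h1
    exact h1.symm
  have hd : Nonempty (Fin d) := nonempty_of_mem_Irr hirr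
  have hc0 : c ≠ 0 := by
    rintro rfl
    rw [zero_smul, hpow] at hcA
    have h1 : J * (T.val ^ A * T⁻¹.val ^ A) * I = 0 := by
      have : Commute P (T⁻¹.val ^ A) := hPT.units_inv_right.pow_right A
      rw [compress_mul hJI hIJ _ this, hcA, Matrix.zero_mul]
    rw [← (Units.commute_coe_inv T).mul_pow, Units.mul_inv, one_pow, Matrix.mul_one, hJI] at h1
    exact one_ne_zero h1
  obtain ⟨r, hr⟩ := IsAlgClosed.exists_pow_nat_eq c⁻¹ (NeZero.pos A)
  refine ⟨r • (J * T.val * I), ?_, ?_⟩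
  · rw [smul_pow, hcA, hr, smul_smul, inv_mul_cancel₀ hc0, one_smul]
  · intro k t ht
    rw [smul_pow, smul_mul_assoc, hrel k t ht, mul_smul_comm, smul_comm]

omit [Finite K₀] in
/-- A piece extends to `Ĥ`, and conjugating the extension by an element of the base group that fixes
the piece multiplies it by a linear character of `Ĥ / H`. -/
theorem exists_extension
    (hE : ∀ x, (E : Matrix n n ℂ) * R x = (ζ (π₀ x) : ℂ) • (R x * E))
    {m : ℕ} (hm : ζ ^ m * ξ ^ A = 1) {ω : ℂˣ} {d : ℕ}
    {I : Matrix (F A → n) (Fin d) ℂ} {J : Matrix (Fin d) (F A → n) ℂ} (hJI : J * I = 1)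
    (hIJ : I * J = pieceProj A ζ E ω)
    (hirr : (fun h : H A π₀ => (baseRep π₀ α ξ R (leftH π₀ h) * pieceProj A ζ E ω).trace) ∈
      Irr (H A π₀)) :
    ∃ θ : Hhat A π₀ →* Matrix (Fin d) (Fin d) ℂ,
      (∀ h : H A π₀, chr θ (Subgroup.inclusion (H_le_Hhat A π₀) h) =
        (baseRep π₀ α ξ R (leftH π₀ h) * pieceProj A ζ E ω).trace) ∧
      ∀ t : F A → G₀, ζ (bmap A π₀ t) = 1 → ∀ h : Hhat A π₀,
        chr θ (MulAut.conjNormal (⟨t, 1⟩ : G₀ ≀ᵣ F A) h) =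
          (((ξ (bmap A π₀ t))⁻¹ ^ idx α (h : G₀ ≀ᵣ F A).right : ℂˣ) : ℂ) * chr θ h := by
  obtain ⟨τ, hτA, hτ⟩ := exists_piece_operator α hE hm hJI hIJ hirr
  have hPρ : ∀ t, ζ (bmap A π₀ t) = 1 →
      Commute (pieceProj A ζ E ω) (baseRep π₀ α ξ R t) := fun t ht => pieceProj_commute α hE _ ht
  have hb : ∀ h : Hhat A π₀, bmap A π₀ (h : G₀ ≀ᵣ F A).left = 1 := fun h => (mem_Hhat_iff π₀).1 h.2
  have hmul : ∀ s t, ζ (bmap A π₀ t) = 1 → J * baseRep π₀ α ξ R (s * t) * I =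
      (J * baseRep π₀ α ξ R s * I) * (J * baseRep π₀ α ξ R t * I) := fun s t ht => by
    rw [map_mul, compress_mul hJI hIJ _ (hPρ t ht)]
  let θ : Hhat A π₀ →* Matrix (Fin d) (Fin d) ℂ :=
    { toFun := fun h => (J * baseRep π₀ α ξ R (h : G₀ ≀ᵣ F A).left * I) *
        τ ^ idx α (h : G₀ ≀ᵣ F A).right
      map_one' := by
        simp only [OneMemClass.coe_one, RegularWreathProduct.one_left,
          RegularWreathProduct.one_right, map_one, idx_one, pow_zero, Matrix.mul_one, hJI]
      map_mul' := by
        intro h h'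
        have h1 : ((h * h' : Hhat A π₀) : G₀ ≀ᵣ F A).left =
            (h : G₀ ≀ᵣ F A).left * shift (h : G₀ ≀ᵣ F A).right (h' : G₀ ≀ᵣ F A).left := rfl
        have h2 : ((h * h' : Hhat A π₀) : G₀ ≀ᵣ F A).right =
            (h : G₀ ≀ᵣ F A).right * (h' : G₀ ≀ᵣ F A).right := rfl
        have h3 := hτ (idx α (h : G₀ ≀ᵣ F A).right) (h' : G₀ ≀ᵣ F A).left (by rw [hb, map_one])
        rw [hb, map_one, inv_one, one_pow, Units.val_one, one_smul, gen_pow_idx] at h3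
        rw [h1, h2, hmul _ _ (by rw [bmap_shift, hb, map_one]), idx_mul, ← pow_eq_pow_mod _ hτA,
          pow_add, mul_assoc, mul_assoc, ← mul_assoc _ (τ ^ _) (τ ^ _), ← h3]
        simp only [mul_assoc] }
  refine ⟨θ, ?_, ?_⟩
  · intro h
    have h1 : θ (Subgroup.inclusion (H_le_Hhat A π₀) h) = J * baseRep π₀ α ξ R (leftH π₀ h) * I := by
      simp only [θ, MonoidHom.coe_mk, OneHom.coe_mk, Subgroup.coe_inclusion, H_right, idx_one,
        pow_zero, mul_one]
      rfl
    rw [chr, h1, trace_compress hIJ]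
  · intro t ht h
    have hti : ζ (bmap A π₀ t⁻¹) = 1 := by rw [map_inv, map_inv, ht, inv_one]
    have h1 : ((MulAut.conjNormal (⟨t, 1⟩ : G₀ ≀ᵣ F A) h : Hhat A π₀) : G₀ ≀ᵣ F A).left =
        t * ((h : G₀ ≀ᵣ F A).left * shift (h : G₀ ≀ᵣ F A).right t⁻¹) := by
      ext i
      simp [MulAut.conjNormal_apply, shift, mul_assoc]
    have h2 : ((MulAut.conjNormal (⟨t, 1⟩ : G₀ ≀ᵣ F A) h : Hhat A π₀) : G₀ ≀ᵣ F A).right =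
        (h : G₀ ≀ᵣ F A).right := by
      simp [MulAut.conjNormal_apply]
    have h3 := hτ (idx α (h : G₀ ≀ᵣ F A).right) t⁻¹ hti
    rw [gen_pow_idx, map_inv (bmap A π₀), map_inv ξ, inv_inv] at h3
    set k := idx α (h : G₀ ≀ᵣ F A).right with hk
    have h4 : (J * baseRep π₀ α ξ R (shift (h : G₀ ≀ᵣ F A).right t⁻¹) * I) * τ ^ k =
        (((ξ (bmap A π₀ t))⁻¹ ^ k : ℂˣ) : ℂ) • (τ ^ k * (J * baseRep π₀ α ξ R t⁻¹ * I)) := by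
      rw [h3, smul_smul, ← Units.val_mul, ← mul_pow, inv_mul_cancel, one_pow, Units.val_one,
        one_smul]
    have h5 : (J * baseRep π₀ α ξ R t⁻¹ * I) * (J * baseRep π₀ α ξ R t * I) = 1 := by
      rw [← hmul _ _ ht, inv_mul_cancel, map_one, Matrix.mul_one, hJI]
    have hs : ζ (bmap A π₀ (shift (h : G₀ ≀ᵣ F A).right t⁻¹)) = 1 := by rw [bmap_shift, hti]
    have h6 : ζ (bmap A π₀ ((h : G₀ ≀ᵣ F A).left * shift (h : G₀ ≀ᵣ F A).right t⁻¹)) = 1 := by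
      rw [map_mul, hb, one_mul, hs]
    simp only [chr, θ, MonoidHom.coe_mk, OneHom.coe_mk]
    rw [h1, h2, hmul _ _ h6, hmul _ _ hs, mul_assoc, mul_assoc, h4, mul_smul_comm, mul_smul_comm,
      Matrix.trace_smul, Matrix.trace_mul_comm, smul_eq_mul]
    simp only [mul_assoc]
    rw [h5, mul_one]

end Extension

section Package

variable {A : ℕ} [NeZero A] {G₀ K₀ : Type*} [Group G₀] [CommGroup K₀] {π₀ : G₀ →* K₀}
  [Finite G₀] [Finite K₀] (α : F A ≃* Multiplicative (ZMod A))

/-- The decomposition of the restriction to `H` of the character `∏ ξ^i η` of the base group, where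
`ξ^A` stabilizes `η`: irreducible constituents of equal degree, indexed by the roots of unity of order
dividing `|Stab η|`, each extending to `Ĥ`. -/
theorem exists_pieces (hπ₀ : Function.Surjective π₀) {η : G₀ → ℂ} (hη : η ∈ Irr G₀)
    {ξ ζ : K₀ →* ℂˣ} (hζ : Subgroup.zpowers ζ = stabC π₀ η) (hξ : ξ ^ A ∈ stabC π₀ η)
    [Fintype (rootsOfUnity (orderOf ζ) ℂ)] :
    ∃ (d : rootsOfUnity (orderOf ζ) ℂ → ℕ)
      (θ : ∀ ω, Hhat A π₀ →* Matrix (Fin (d ω)) (Fin (d ω)) ℂ),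
      (∀ ω, (d ω : ℂ) * orderOf ζ = η 1 ^ A) ∧
      (∀ ω, chr ((θ ω).comp (Subgroup.inclusion (H_le_Hhat A π₀))) ∈ Irr (H A π₀)) ∧
      (∀ h : H A π₀, ∑ ω, chr (θ ω) (Subgroup.inclusion (H_le_Hhat A π₀) h) =
        ∏ i, chi π₀ α ξ η i ((h : G₀ ≀ᵣ F A).left i)) ∧
      (∀ ω (w : G₀ ≀ᵣ F A), (∀ h : H A π₀,
        chr (θ ω) (Subgroup.inclusion (H_le_Hhat A π₀) (MulAut.conjNormal w h)) =
          chr (θ ω) (Subgroup.inclusion (H_le_Hhat A π₀) h)) → ζ (bmap A π₀ w.left) = 1) ∧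
      ∀ ω (t : F A → G₀), ζ (bmap A π₀ t) = 1 → ∀ h : Hhat A π₀,
        chr (θ ω) (MulAut.conjNormal (⟨t, 1⟩ : G₀ ≀ᵣ F A) h) =
          (((ξ (bmap A π₀ t))⁻¹ ^ idx α (h : G₀ ≀ᵣ F A).right : ℂˣ) : ℂ) * chr (θ ω) h := by
  classical
  obtain ⟨n, R, hR⟩ := exists_matrix_of_mem_Irr hη
  have hζ' : ζ ∈ stabC π₀ η := hζ ▸ Subgroup.mem_zpowers ζ
  obtain ⟨E, hEs, hE⟩ := exists_twist_operator π₀ (hR ▸ hη) (hR ▸ hζ')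
  obtain ⟨m, hm⟩ : ∃ m : ℕ, ζ ^ m = (ξ ^ A)⁻¹ := by
    have h1 : (ξ ^ A)⁻¹ ∈ Subgroup.zpowers ζ := hζ ▸ inv_mem hξ
    rw [← mem_powers_iff_mem_zpowers] at h1
    exact h1
  have hm' : ζ ^ m * ξ ^ A = 1 := by rw [hm]; exact inv_mul_cancel (ξ ^ A)
  have hidem : ∀ ω : rootsOfUnity (orderOf ζ) ℂ,
      pieceProj A ζ E ω * pieceProj A ζ E ω = pieceProj A ζ E ω := fun ω =>
    specProj_idem (orderOf_pos ζ).ne' (tens_pow_orderOf hEs) ((mem_rootsOfUnity _ _).1 ω.2)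
  choose d I J hJI hIJ using fun ω : rootsOfUnity (orderOf ζ) ℂ => exists_splitting _ (hidem ω)
  obtain ⟨h1, h2, h3⟩ := trace_baseRep_pieces (ξ := ξ) α hπ₀ hη hR hζ hE d I J hJI hIJ
  have hc : ∀ (ω : rootsOfUnity (orderOf ζ) ℂ) (h : H A π₀),
      Commute (pieceProj A ζ E ω) ((baseRep π₀ α ξ R).comp (leftH π₀) h) := fun ω h =>
    pieceProj_commute α hE _ (by rw [bmap_leftH, map_one])
  have hirr : ∀ ω : rootsOfUnity (orderOf ζ) ℂ,
      (fun h : H A π₀ => (baseRep π₀ α ξ R (leftH π₀ h) * pieceProj A ζ E ω).trace) ∈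
        Irr (H A π₀) := by
    intro ω
    have h4 : (fun h : H A π₀ => (baseRep π₀ α ξ R (leftH π₀ h) * pieceProj A ζ E ω).trace) =
        chr (compressRep ((baseRep π₀ α ξ R).comp (leftH π₀)) (hJI ω) (hIJ ω) (hc ω)) :=
      funext fun h => (chr_compressRep _ (hJI ω) (hIJ ω) (hc ω) h).symm
    have h5 := h3 ω ω
    rw [if_pos rfl] at h5
    rw [h4] at h5 ⊢
    exact (chr_mem_Irr_iff _).2 h5
  choose θ hθ1 hθ2 using fun ω : rootsOfUnity (orderOf ζ) ℂ =>
    exists_extension α hE hm' (hJI ω) (hIJ ω) (hirr ω)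
  have hθ1' : ∀ ω, chr ((θ ω).comp (Subgroup.inclusion (H_le_Hhat A π₀))) =
      fun h : H A π₀ => (baseRep π₀ α ξ R (leftH π₀ h) * pieceProj A ζ E ω).trace := fun ω =>
    funext fun h => hθ1 ω h
  refine ⟨d, θ, h1, fun ω => by rw [hθ1']; exact hirr ω, ?_, ?_, hθ2⟩
  · intro h
    rw [Finset.sum_congr rfl fun ω _ => hθ1 ω h]
    exact h2 _
  · intro ω w hw
    set u := ζ (bmap A π₀ w.left) with hu
    have hus : u ∈ rootsOfUnity (orderOf ζ) ℂ := by
      rw [mem_rootsOfUnity, hu, ← MonoidHom.pow_apply, pow_orderOf_eq_one, MonoidHom.one_apply]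
    -- conjugation by `w` moves the piece of `ω` to the piece of `u⁻¹ ω`, and distinct pieces are orthogonal
    set ω' : rootsOfUnity (orderOf ζ) ℂ := ⟨u, hus⟩⁻¹ * ω with hω'
    have h4 : (fun h : H A π₀ => (baseRep π₀ α ξ R (leftH π₀ h) * pieceProj A ζ E ω').trace) =
        fun h => (baseRep π₀ α ξ R (leftH π₀ h) * pieceProj A ζ E ω).trace := by
      ext h
      have h5 := hw h
      rw [hθ1, hθ1, trace_piece_conj α hE hm'] at h5
      exact h5
    have h6 := h3 ω' ω
    rw [h4, h3 ω ω, if_pos rfl] at h6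
    by_cases h7 : ω' = ω
    · rw [hω', mul_eq_right, inv_eq_one] at h7
      exact congrArg Subtype.val h7
    · rw [if_neg h7] at h6
      exact absurd h6 one_ne_zero

end Package

/-! ### The groups `H` and `Ĥ` inside `G` -/

section Reps

variable {Γ : Type*} [Group Γ] [Finite Γ] {d e : Type*} [Fintype d] [DecidableEq d] [Fintype e]
  [DecidableEq e]

theorem chr_mem_Irr_of_scalar [Nonempty d] (ρ : Γ →* Matrix d d ℂ)
    (h : ∀ M : Matrix d d ℂ, (∀ x, ρ x * M = M * ρ x) → ∃ c : ℂ, M = c • 1) : chr ρ ∈ Irr Γ := by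
  rw [chr_mem_Irr_iff, ← character_matRep, ip_character]
  have hid : Representation.IntertwiningMap.id (matRep ρ) ≠ 0 := by
    intro h0
    have h1 : ∀ v : d → ℂ, v = 0 := fun v =>
      congrArg (fun F : Representation.IntertwiningMap (matRep ρ) (matRep ρ) => F v) h0
    exact one_ne_zero (congrFun (h1 1) (Classical.arbitrary d))
  rw [(finrank_eq_one_iff_of_nonzero' _ hid).2, Nat.cast_one]
  intro f
  obtain ⟨c, hc⟩ := h (LinearMap.toMatrix' f.toLinearMap) fun x => by
    have h1 := congrArg LinearMap.toMatrix' (f.isIntertwining' x)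
    rw [LinearMap.toMatrix'_comp, LinearMap.toMatrix'_comp, matRep_apply,
      LinearMap.toMatrix'_toLin'] at h1
    exact h1.symm
  refine ⟨c, ?_⟩
  ext1
  apply LinearMap.toMatrix'.injective
  rw [hc, ← LinearMap.toMatrix'_id (R := ℂ) (n := d), ← map_smul]
  rfl

/-- A representation with irreducible restriction is irreducible. -/
theorem chr_mem_Irr_of_comp {Γ' : Type*} [Group Γ'] [Finite Γ'] (f : Γ' →* Γ)
    (ρ : Γ →* Matrix d d ℂ) (h : chr (ρ.comp f) ∈ Irr Γ') : chr ρ ∈ Irr Γ := by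
  have := nonempty_of_mem_Irr h
  exact chr_mem_Irr_of_scalar ρ fun M hM => schur_scalar h M fun x => hM (f x)

/-- The multiplicities of the irreducible constituents of a character. -/
theorem exists_multiplicities (ρ : Γ →* Matrix d d ℂ) :
    ∃ k : (Γ → ℂ) → ℕ, ∀ ψ ∈ Irr Γ, ip (chr ρ) ψ = k ψ := by
  choose! k hk using fun (ψ : Γ → ℂ) (hψ : ψ ∈ Irr Γ) => show ∃ k : ℕ, ip (chr ρ) ψ = k by
    obtain ⟨n, R, rfl⟩ := exists_matrix_of_mem_Irr hψ
    exact ip_chr_nat ρ R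
  exact ⟨k, hk⟩

/-- Characters with a common irreducible constituent are not orthogonal. -/
theorem ip_ne_zero_of_common (ρ : Γ →* Matrix d d ℂ) (τ : Γ →* Matrix e e ℂ) {θ : Γ → ℂ}
    (hθ : θ ∈ Irr Γ) (h1 : ip (chr ρ) θ ≠ 0) (h2 : ip (chr τ) θ ≠ 0) :
    ip (chr ρ) (chr τ) ≠ 0 := by
  obtain ⟨k, hk⟩ := exists_multiplicities ρ
  obtain ⟨l, hl⟩ := exists_multiplicities τ
  have h3 : ip (chr ρ) (chr τ) = ((∑ ψ ∈ irrFinset Γ, k ψ * l ψ : ℕ) : ℂ) := by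
    rw [show chr ρ = fun x => ∑ ψ ∈ irrFinset Γ, ip (chr ρ) ψ * ψ x from funext (chr_eq_sum_ip ρ),
      ip_sum_left (irrFinset Γ) (fun ψ x => ip (chr ρ) ψ * ψ x)]
    push_cast
    refine Finset.sum_congr rfl fun ψ hψ => ?_
    rw [ip_smul_left, hk ψ (mem_irrFinset.1 hψ), ip_comm, hl ψ (mem_irrFinset.1 hψ)]
  rw [hk θ hθ] at h1
  rw [hl θ hθ] at h2
  rw [h3, Nat.cast_ne_zero]
  intro h4
  have h5 := Finset.sum_eq_zero_iff.1 h4 θ (mem_irrFinset.2 hθ)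
  rcases Nat.mul_eq_zero.1 h5 with h6 | h6
  · exact h1 (by rw [h6, Nat.cast_zero])
  · exact h2 (by rw [h6, Nat.cast_zero])

end Reps

namespace Setting

variable {A : ℕ} [NeZero A] {G₀ K₀ Kbar G K : Type*} [Group G₀] [CommGroup K₀]
  [CommGroup Kbar] [Group G] [CommGroup K] (S : Setting A G₀ K₀ Kbar G K)

theorem commutator_mem_ker (x y : G) : ⁅x, y⁆ ∈ S.π.ker := by
  rw [MonoidHom.mem_ker, map_commutatorElement, commutatorElement_eq_one_iff_mul_comm, mul_comm]

theorem ker_le_range : S.π.ker ≤ S.ι.range := by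
  rw [S.ker_π]
  exact Subgroup.map_le_range _ _

instance : S.ι.range.Normal :=
  ⟨fun n hn x => by
    have h := S.ι.range.mul_mem (S.ker_le_range (S.commutator_mem_ker x n)) hn
    rwa [commutatorElement_def, inv_mul_cancel_right] at h⟩

/-- `Ĥ` as a subgroup of `G`. -/
noncomputable def eD : Hhat A S.π₀ ≃* S.ι.range := MonoidHom.ofInjective S.ι_injective

theorem coe_eD (h : Hhat A S.π₀) : (S.eD h : G) = S.ι h := rfl

theorem ι_inclusion_mem (h : H A S.π₀) :
    S.ι (Subgroup.inclusion (H_le_Hhat A S.π₀) h) ∈ S.π.ker := by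
  rw [S.ker_π]
  exact ⟨_, h.2, rfl⟩

/-- `H` as a subgroup of `G`. -/
noncomputable def eN : H A S.π₀ ≃* S.π.ker :=
  MulEquiv.ofBijective
    ((S.ι.comp (Subgroup.inclusion (H_le_Hhat A S.π₀))).codRestrict S.π.ker S.ι_inclusion_mem) <| by
    constructor
    · intro h h' hh
      exact Subgroup.inclusion_injective _ (S.ι_injective (congrArg Subtype.val hh))
    · rintro ⟨x, hx⟩
      have hx' := hx
      rw [S.ker_π] at hx'
      obtain ⟨h, hh, rfl⟩ := hx'
      exact ⟨⟨h, hh⟩, rfl⟩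

theorem coe_eN (h : H A S.π₀) :
    (S.eN h : G) = S.ι (Subgroup.inclusion (H_le_Hhat A S.π₀) h) := rfl

theorem inclusion_eN (h : H A S.π₀) : Subgroup.inclusion S.ker_le_range (S.eN h) =
    S.eD (Subgroup.inclusion (H_le_Hhat A S.π₀) h) := rfl

theorem finite_K₀ (S : Setting A G₀ K₀ Kbar G K) [Finite G₀] : Finite K₀ :=
  Finite.of_surjective _ S.π₀_surjective

/-- `w` induces on the irreducible characters the same permutation as `x`. -/
def Compat (x : G) (w : G₀ ≀ᵣ F A) : Prop := S.j (S.π x) = (w.right, S.q (prodHom A S.π₀ w))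

/-- The component of `w` in `K₀` can be prescribed among the lifts of the component of `x` in `K̄₀`. -/
theorem exists_compat (x : G) (k : K₀) (hk : S.q k = (S.j (S.π x)).2) :
    ∃ w : G₀ ≀ᵣ F A, S.Compat x w ∧ bmap A S.π₀ w.left = k := by
  obtain ⟨t, rfl⟩ := bmap_surjective (A := A) S.π₀ S.π₀_surjective k
  exact ⟨⟨t, (S.j (S.π x)).1⟩, Prod.ext rfl hk.symm, rfl⟩

/-- Compatibility of the actions on `Irr H`. -/
theorem conj_N {x : G} {w : G₀ ≀ᵣ F A} (hxw : S.Compat x w) {θ : S.π.ker → ℂ}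
    (hθ : (fun h => θ (S.eN h)) ∈ Irr (H A S.π₀)) (h : H A S.π₀) :
    θ (MulAut.conjNormal x (S.eN h)) = θ (S.eN (MulAut.conjNormal w h)) := by
  have := S.compatible_H x w hxw _ hθ h (S.eN.symm (MulAut.conjNormal x (S.eN h))) (by
    rw [← coe_eN, MulEquiv.apply_symm_apply, MulAut.conjNormal_apply, coe_eN])
  simpa using this

/-- Compatibility of the actions on `Irr Ĥ`. -/
theorem conj_D {x : G} {w : G₀ ≀ᵣ F A} (hxw : S.Compat x w) {θ : S.ι.range → ℂ}
    (hθ : (fun h => θ (S.eD h)) ∈ Irr (Hhat A S.π₀)) (h : Hhat A S.π₀) :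
    θ (MulAut.conjNormal x (S.eD h)) = θ (S.eD (MulAut.conjNormal w h)) := by
  have := S.compatible_Hhat x w hxw _ hθ h (S.eD.symm (MulAut.conjNormal x (S.eD h))) (by
    change S.ι (S.eD.symm _) = _
    rw [← coe_eD, MulEquiv.apply_symm_apply, MulAut.conjNormal_apply, coe_eD]
    rfl)
  simpa using this

variable (α : F A ≃* Multiplicative (ZMod A)) (β : S.FB ≃* Multiplicative (ZMod S.B))

/-- The generator of `F_B` of coordinate `1`. -/
noncomputable def genB : S.FB := β.symm (Multiplicative.ofAdd 1)

/-- The representative in `[0, B)` of the coordinate of an element of `F_B`. -/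
noncomputable def idxB (y : S.FB) : ℕ := (Multiplicative.toAdd (β y)).val

theorem genB_pow_idxB [NeZero S.B] (y : S.FB) : S.genB β ^ S.idxB β y = y := by
  apply β.injective
  apply Multiplicative.toAdd.injective
  simp [genB, idxB]

/-- An element `u` of `G` generating the factor `F_B` of `K`. -/
theorem exists_generator_FB : ∃ u : G, S.prA (S.π u) = 1 ∧ S.prB (S.π u) = S.genB β := by
  obtain ⟨k, hk⟩ := S.bijective_prod.2 (1, S.genB β)
  obtain ⟨u, rfl⟩ := S.π_surjective k
  exact ⟨u, congrArg Prod.fst hk, congrArg Prod.snd hk⟩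

theorem prA_ι (h : Hhat A S.π₀) : S.prA (S.π (S.ι h)) = (h : G₀ ≀ᵣ F A).right :=
  congrArg Prod.fst (S.j_Hhat h)

theorem prB_ι (h : Hhat A S.π₀) : S.prB (S.π (S.ι h)) = 1 :=
  Subtype.ext (congrArg Prod.snd (S.j_Hhat h))

theorem coe_prB (k : K) : (S.prB k : Kbar) = (S.j k).2 := rfl

/-- Every element of `G` is a product of an element of `Ĥ` and a power of `u`. -/
theorem exists_decomp [NeZero S.B] {u : G} (hu : S.prA (S.π u) = 1)
    (hu' : S.prB (S.π u) = S.genB β) (x : G) :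
    ∃ h : Hhat A S.π₀, x = S.eD h * u ^ S.idxB β (S.prB (S.π x)) ∧
      (h : G₀ ≀ᵣ F A).right = S.prA (S.π x) := by
  set k := S.idxB β (S.prB (S.π x)) with hk
  let h₁ : Hhat A S.π₀ := ⟨⟨1, S.prA (S.π x)⟩, by rw [mem_Hhat_iff, map_one]⟩
  have h2 : S.π (x * (u ^ k)⁻¹) = S.π (S.ι h₁) := by
    apply S.bijective_prod.1
    refine Prod.ext ?_ ?_
    · change S.prA (S.π (x * (u ^ k)⁻¹)) = S.prA (S.π (S.ι h₁))
      rw [prA_ι, map_mul, map_inv, map_pow, map_mul, map_inv, map_pow, hu, one_pow, inv_one, mul_one]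
    · change S.prB (S.π (x * (u ^ k)⁻¹)) = S.prB (S.π (S.ι h₁))
      rw [prB_ι, map_mul, map_inv, map_pow, map_mul, map_inv, map_pow, hu', hk, genB_pow_idxB,
        mul_inv_cancel]
  have h3 : (x * (u ^ k)⁻¹) * (S.ι h₁)⁻¹ ∈ S.π.ker := by
    rw [MonoidHom.mem_ker, map_mul, h2, map_inv, mul_inv_cancel]
  obtain ⟨n, hn⟩ := S.eN.surjective ⟨_, h3⟩
  have hn' := congrArg Subtype.val hn
  rw [coe_eN] at hn'
  refine ⟨Subgroup.inclusion (H_le_Hhat A S.π₀) n * h₁, ?_, ?_⟩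
  · rw [coe_eD, map_mul, hn']
    group
  · rw [Subgroup.coe_mul, RegularWreathProduct.mul_right, Subgroup.coe_inclusion, H_right, one_mul]

end Setting

/-! ### The contribution of the tuples `ξ^i η` -/

section LinearCharacters

variable {Γ Γ' : Type*} [Group Γ] [Finite Γ] [Group Γ'] [Finite Γ'] {d : Type*} [Fintype d]
  [DecidableEq d]

/-- If the restriction of `ρ` along `f` is irreducible, a linear character which is trivial along `f`
and fixes the character of `ρ` is trivial. -/
theorem linear_eq_one_of_fixes (f : Γ' →* Γ) {ρ : Γ →* Matrix d d ℂ}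
    (h : chr (ρ.comp f) ∈ Irr Γ') (c : Γ →* ℂˣ) (hcf : ∀ x, c (f x) = 1)
    (hc : ∀ x, (c x : ℂ) * chr ρ x = chr ρ x) (x : Γ) : c x = 1 := by
  have hd := nonempty_of_mem_Irr h
  obtain ⟨Q, hQ⟩ := exists_intertwiner (τ := twRep c (MonoidHom.id ℂˣ) ρ)
    (chr_mem_Irr_of_comp f ρ h) (by
      rw [chr_twRep]
      exact funext fun x => (hc x).symm)
  have hQ' : ∀ x, (c x : ℂ) • (ρ x * Q) = Q * ρ x := fun x => by rw [← hQ]; simp [twRep]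
  -- along `f` the linear character is trivial, so that `Q` is a scalar and `c ρ = ρ`
  obtain ⟨r, hr⟩ := schur_scalar h (Q : Matrix d d ℂ) fun y => by
    have := hQ' (f y)
    rwa [hcf, Units.val_one, one_smul] at this
  have hr0 : r ≠ 0 := by
    rintro rfl
    rw [zero_smul] at hr
    exact Q.ne_zero hr
  have h1 := hQ' x
  rw [hr, mul_smul_comm, mul_one, smul_mul_assoc, one_mul, smul_comm] at h1
  have h2 : (c x : ℂ) • ρ x = ρ x := smul_right_injective _ hr0 h1
  have h3 : ((c x : ℂ) - 1) • ρ x = 0 := by rw [sub_smul, h2, one_smul, sub_self]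
  rcases smul_eq_zero.1 h3 with h4 | h4
  · exact Units.ext (sub_eq_zero.1 h4)
  · have h5 : ρ x * ρ x⁻¹ = 1 := by rw [← map_mul, mul_inv_cancel, map_one]
    rw [h4, zero_mul] at h5
    exact absurd h5.symm one_ne_zero

theorem zpow_finset_sum {M ι : Type*} [CommGroup M] (v : M) (s : Finset ι) (f : ι → ℤ) :
    v ^ (∑ i ∈ s, f i) = ∏ i ∈ s, v ^ f i := by
  classical
  induction s using Finset.induction_on with
  | empty => simp
  | insert i s hi ih => rw [Finset.sum_insert hi, Finset.prod_insert hi, _root_.zpow_add, ih]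

/-- The linear character of `F_A` sending the generator to `v`. -/
def idxHom {A : ℕ} [NeZero A] (α : F A ≃* Multiplicative (ZMod A)) (v : ℂˣ) (hv : v ^ A = 1) :
    F A →* ℂˣ where
  toFun i := v ^ idx α i
  map_one' := by rw [idx_one, pow_zero]
  map_mul' i j := by rw [idx_mul, ← pow_eq_pow_mod _ hv, pow_add]

end LinearCharacters

/-- The properties of a constituent `θ` of the tuple of characters `ξ^i η`: its restriction to `H` is
irreducible, is moved by every element on which `ζ` is nontrivial, and elements of the base group on
which `ζ` is trivial twist `θ` by a linear character. -/
structure IsPiece {A : ℕ} [NeZero A] {G₀ K₀ : Type*} [Group G₀] [CommGroup K₀] (π₀ : G₀ →* K₀)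
    (α : F A ≃* Multiplicative (ZMod A)) (ξ ζ : K₀ →* ℂˣ) {d : ℕ}
    (θ : Hhat A π₀ →* Matrix (Fin d) (Fin d) ℂ) : Prop where
  irr : chr (θ.comp (Subgroup.inclusion (H_le_Hhat A π₀))) ∈ Irr (H A π₀)
  fixed : ∀ w : G₀ ≀ᵣ F A, (∀ h : H A π₀,
    chr θ (Subgroup.inclusion (H_le_Hhat A π₀) (MulAut.conjNormal w h)) =
      chr θ (Subgroup.inclusion (H_le_Hhat A π₀) h)) → ζ (bmap A π₀ w.left) = 1
  twist : ∀ t : F A → G₀, ζ (bmap A π₀ t) = 1 → ∀ h : Hhat A π₀,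
    chr θ (MulAut.conjNormal (⟨t, 1⟩ : G₀ ≀ᵣ F A) h) =
      (((ξ (bmap A π₀ t))⁻¹ ^ idx α (h : G₀ ≀ᵣ F A).right : ℂˣ) : ℂ) * chr θ h

namespace Setting

variable {A : ℕ} [NeZero A] {G₀ K₀ Kbar G K : Type*} [Group G₀] [CommGroup K₀]
  [CommGroup Kbar] [Group G] [CommGroup K] (S : Setting A G₀ K₀ Kbar G K)
  (α : F A ≃* Multiplicative (ZMod A)) (β : S.FB ≃* Multiplicative (ZMod S.B))
  {d : ℕ} (θ : Hhat A S.π₀ →* Matrix (Fin d) (Fin d) ℂ)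

/-- A representation of `Ĥ` viewed on its image in `G`. -/
noncomputable def repD : S.ι.range →* Matrix (Fin d) (Fin d) ℂ := θ.comp S.eD.symm.toMonoidHom

/-- The restriction to `H` of a representation of `Ĥ`, viewed on the image of `H` in `G`. -/
noncomputable def repN : S.π.ker →* Matrix (Fin d) (Fin d) ℂ :=
  (S.repD θ).comp (Subgroup.inclusion S.ker_le_range)

theorem chr_repD (h : Hhat A S.π₀) : chr (S.repD θ) (S.eD h) = chr θ h := by
  simp [chr, repD]

theorem chr_repN (h : H A S.π₀) :
    chr (S.repN θ) (S.eN h) = chr θ (Subgroup.inclusion (H_le_Hhat A S.π₀) h) := by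
  rw [← chr_repD, ← inclusion_eN]
  rfl

variable {θ} {ξ ζ : K₀ →* ℂˣ} [Finite G₀] [Finite K₀]

omit [Finite G₀] [Finite K₀] in
theorem chr_repN_comp_mem (hθ : IsPiece S.π₀ α ξ ζ θ) :
    (fun h => chr (S.repN θ) (S.eN h)) ∈ Irr (H A S.π₀) := by
  have : (fun h => chr (S.repN θ) (S.eN h)) =
      chr (θ.comp (Subgroup.inclusion (H_le_Hhat A S.π₀))) := funext fun h => S.chr_repN θ h
  rw [this]
  exact hθ.irr

omit [Finite G₀] [Finite K₀] in
/-- If `x` fixes the character of a piece, then `ζ` vanishes on the component of `x`. -/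
theorem eq_one_of_fixed (hθ : IsPiece S.π₀ α ξ ζ θ) {x : G}
    (hx : chr (conjRep (S.repN θ) x) = chr (S.repN θ)) {k : K₀} (hk : S.q k = (S.j (S.π x)).2) :
    ζ k = 1 := by
  obtain ⟨w, hw, rfl⟩ := S.exists_compat x k hk
  refine hθ.fixed w fun h => ?_
  rw [← chr_repN, ← chr_repN, ← S.conj_N hw (S.chr_repN_comp_mem α hθ), ← chr_conjRep, hx]

omit [Finite G₀] [Finite K₀] in
/-- The element `1 : G` is compatible with every element of the base group lying over the kernel of `q`, so
the kernel of `q` fixes each piece. -/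
theorem eq_one_of_q_eq_one (hθ : IsPiece S.π₀ α ξ ζ θ) {k : K₀} (hk : S.q k = 1) : ζ k = 1 := by
  refine S.eq_one_of_fixed α hθ (x := 1) ?_ (by rw [hk, map_one, map_one]; rfl)
  ext n
  rw [chr_conjRep, map_one, MulAut.one_apply]

omit [NeZero A] [Finite K₀] in
/-- A power of `ξ` in the group generated by `ζ` is trivial where `ζ` is. -/
theorem pow_eq_one_of_pow_mem_zpowers {k : K₀} (hξ : ξ ^ A ∈ Subgroup.zpowers ζ) (hk : ζ k = 1) :
    ξ k ^ A = 1 := by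
  obtain ⟨m, hm⟩ := hξ
  have h1 := DFunLike.congr_fun hm k
  simp only [MonoidHom.pow_apply] at h1
  rw [← h1]
  change (ζ ^ m) k = 1
  rw [← MonoidHom.eval_apply_apply, map_zpow, MonoidHom.eval_apply_apply, hk, _root_.one_zpow]

omit [Finite K₀] in
/-- The action on `Irr Ĥ` factoring through `K̄₀` forces `ξ` to factor through `K̄₀`. -/
theorem twist_eq_one_of_q_eq_one (hθ : IsPiece S.π₀ α ξ ζ θ) (hξ : ξ ^ A ∈ Subgroup.zpowers ζ) {k : K₀}
    (hk : S.q k = 1) : ξ k = 1 := by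
  have hζ := S.eq_one_of_q_eq_one α hθ hk
  have hv := pow_eq_one_of_pow_mem_zpowers hξ hζ
  have hv' : (ξ k)⁻¹ ^ A = 1 := by rw [inv_pow, hv, inv_one]
  obtain ⟨t, rfl⟩ := bmap_surjective (A := A) S.π₀ S.π₀_surjective k
  -- evaluated at the wreath generator, the linear character `h ↦ ξ(k)^{-idx h}` gives `ξ(k)⁻¹`
  have h1 := linear_eq_one_of_fixes (Subgroup.inclusion (H_le_Hhat A S.π₀)) hθ.irr
    ((idxHom α _ hv').comp (RegularWreathProduct.rightHom.comp (Hhat A S.π₀).subtype))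
    (fun h => by
      change (ξ _)⁻¹ ^ idx α (h : G₀ ≀ᵣ F A).right = 1
      rw [H_right, idx_one, pow_zero])
    (fun h => (hθ.twist t hζ h).symm.trans (S.action_factors _ hk _
      (chr_mem_Irr_of_comp _ _ hθ.irr) h))
    ⟨⟨1, gen α⟩, by rw [mem_Hhat_iff, map_one]⟩
  have h2 : (ξ (bmap A S.π₀ t))⁻¹ ^ idx α (gen α) = 1 := h1
  rwa [idx_gen, ← pow_eq_pow_mod _ hv', pow_one, inv_eq_one] at h2

variable [Finite G] [Fintype S.π.ker]

omit [Finite K₀] [Fintype ↥S.π.ker] in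
theorem chr_repN_mem (hθ : IsPiece S.π₀ α ξ ζ θ) : chr (S.repN θ) ∈ Irr S.π.ker := by
  have h1 := hθ.irr
  rw [chr_mem_Irr_iff] at h1 ⊢
  rw [← h1, ← ip_comp_mulEquiv S.eN]
  congr 1 <;> exact funext fun h => S.chr_repN θ h

omit [Finite G₀] [Finite K₀] [Finite G] [Fintype ↥S.π.ker] in
/-- A character of `K₀` trivial on the kernel of `q` is a character of `K̄₀`. -/
theorem exists_lift {ζ : K₀ →* ℂˣ} (h : ∀ k, S.q k = 1 → ζ k = 1) :
    ∃ ζ' : Kbar →* ℂˣ, ∀ k, ζ k = ζ' (S.q k) := by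
  refine ⟨S.q.liftOfSurjective S.q_surjective ⟨ζ, fun k hk => h k hk⟩, fun k => ?_⟩
  exact (MonoidHom.liftOfRightInverse_comp_apply _ _ _ ⟨ζ, fun k hk => h k hk⟩ k).symm

omit [Finite K₀] in
/-- The contribution of a piece moved by the elements of given images in `K` vanishes. -/
theorem Psi_piece_eq_zero (hθ : IsPiece S.π₀ α ξ ζ θ) {g : ℕ} (x y : Fin g → G) (z : S.π.ker)
    (hxy : (Subgroup.closure (Set.range (S.π ∘ x) ∪ Set.range (S.π ∘ y))).map S.prB = ⊤)
    (htriv : ¬ ∀ k, S.q k ∈ S.FB → ζ k = 1) : Psi x y z (chr (S.repN θ)) = 0 := by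
  refine Psi_eq_zero S.commutator_mem_ker (S.chr_repN_mem α hθ) x y z ?_
  by_contra! hfix
  apply htriv
  obtain ⟨ζ', hζ'⟩ := S.exists_lift fun k => S.eq_one_of_q_eq_one α hθ
  have h1 : ∀ x : G, chr (conjRep (S.repN θ) x) = chr (S.repN θ) → ζ' (S.prB (S.π x)) = 1 := by
    intro x hx
    obtain ⟨k, hk⟩ := S.q_surjective (S.prB (S.π x))
    rw [← hk, ← hζ']
    exact S.eq_one_of_fixed α hθ hx hk
  -- the elements fixing the piece have trivial `ζ'`-component, and they generate a group onto `F_B`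
  have h2 : Subgroup.closure (Set.range (S.π ∘ x) ∪ Set.range (S.π ∘ y)) ≤
      ((ζ'.comp S.FB.subtype).comp S.prB).ker := by
    rw [Subgroup.closure_le]
    rintro _ (⟨i, rfl⟩ | ⟨i, rfl⟩)
    · exact h1 _ (hfix i).1
    · exact h1 _ (hfix i).2
  intro k hk
  obtain ⟨κ, hκ, hκ'⟩ : (⟨S.q k, hk⟩ : S.FB) ∈
    (Subgroup.closure (Set.range (S.π ∘ x) ∪ Set.range (S.π ∘ y))).map S.prB := hxy ▸ trivial
  have h3 := h2 hκ
  rw [MonoidHom.mem_ker, MonoidHom.comp_apply, hκ'] at h3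
  rw [hζ']
  exact h3

/-- An integer lifting the pairing of `a` and `b`. -/
noncomputable def pairingZ {g : ℕ} (a b : Fin g → K) : ℤ :=
  ∑ i, ((idx α (S.prA (a i)) : ℤ) * S.idxB β (S.prB (b i)) -
    S.idxB β (S.prB (a i)) * idx α (S.prA (b i)))

omit [Finite K₀] in
/-- The contribution of a piece fixed by `G`. -/
theorem Psi_piece_eq [NeZero S.B] (hθ : IsPiece S.π₀ α ξ ζ θ) (hξ : ξ ^ A ∈ Subgroup.zpowers ζ)
    {g : ℕ} (x y : Fin g → G) (z : S.π.ker) (htriv : ∀ k, S.q k ∈ S.FB → ζ k = 1) {b₀ : K₀}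
    (hb₀ : S.q b₀ = S.genB β) :
    Psi x y z (chr (S.repN θ)) = ((ξ b₀ ^ S.pairingZ α β (S.π ∘ x) (S.π ∘ y) : ℂˣ) : ℂ) *
      ((Nat.card S.π.ker : ℂ) / d) ^ (2 * g) * chr (S.repN θ) z := by
  obtain ⟨u, hu, hu'⟩ := S.exists_generator_FB β
  have hζ : ζ b₀ = 1 := htriv b₀ (hb₀ ▸ (S.genB β).2)
  have hv := pow_eq_one_of_pow_mem_zpowers hξ hζ
  obtain ⟨t, ht⟩ := bmap_surjective (A := A) S.π₀ S.π₀_surjective b₀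
  -- conjugation by `u` acts like an element of the base group over `b₀`,
  -- hence twists `θ` by powers of `ξ b₀`
  have hut : S.Compat u ⟨t, 1⟩ := by
    refine Prod.ext hu ?_
    change (S.j (S.π u)).2 = S.q (bmap A S.π₀ t)
    rw [ht, hb₀, ← hu', coe_prB]
  have hirrD : chr (S.repD θ) ∈ Irr S.ι.range :=
    chr_mem_Irr_of_comp (Subgroup.inclusion S.ker_le_range) _ (S.chr_repN_mem α hθ)
  let c : S.ι.range →* ℂˣ := ((idxHom α _ hv).comp (RegularWreathProduct.rightHom.comp
    (Hhat A S.π₀).subtype)).comp S.eD.symm.toMonoidHom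
  have hc : ∀ h : Hhat A S.π₀, c (S.eD h) = ξ b₀ ^ idx α (h : G₀ ≀ᵣ F A).right := by
    intro h
    simp only [c, MonoidHom.comp_apply]
    rw [MulEquiv.toMonoidHom_eq_coe, MonoidHom.coe_coe, MulEquiv.symm_apply_apply]
    rfl
  have hirrH : (fun h => chr (S.repD θ) (S.eD h)) ∈ Irr (Hhat A S.π₀) := by
    rw [funext fun h => S.chr_repD θ h]
    exact chr_mem_Irr_of_comp _ _ hθ.irr
  obtain ⟨T, hT⟩ := exists_intertwiner
    (τ := twRep c (MonoidHom.id ℂˣ) (conjRep (S.repD θ) u)) hirrD (by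
      rw [chr_twRep]
      ext n
      obtain ⟨h, rfl⟩ := S.eD.surjective n
      rw [tw, MonoidHom.id_apply, chr_conjRep, S.conj_D hut hirrH, chr_repD, chr_repD,
        hθ.twist t (by rw [ht, hζ]), hc, ht, ← mul_assoc, ← Units.val_mul, ← mul_pow,
        mul_inv_cancel, one_pow, Units.val_one, one_mul])
  have hT' : ∀ h, (T : Matrix (Fin d) (Fin d) ℂ) * S.repD θ h =
      (c h : ℂ) • (S.repD θ (MulAut.conjNormal u h) * T) := fun h => by
    rw [← hT, ← smul_mul_assoc]
    rfl
  have hcN : ∀ n : S.ι.range, (n : G) ∈ S.π.ker → c n = 1 := by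
    intro n hn
    obtain ⟨h, hh⟩ := S.eN.surjective ⟨n, hn⟩
    have : n = S.eD (Subgroup.inclusion (H_le_Hhat A S.π₀) h) := by
      rw [← inclusion_eN, hh]
      rfl
    rw [this, hc, Subgroup.coe_inclusion, H_right, idx_one, pow_zero]
  have key : ∀ x y : G, commSum (S.repN θ) x y =
      (((ξ b₀ ^ ((idx α (S.prA (S.π x)) : ℤ) * S.idxB β (S.prB (S.π y)) -
        S.idxB β (S.prB (S.π x)) * idx α (S.prA (S.π y))) : ℂˣ) : ℂ) *
          ((Nat.card S.π.ker : ℂ) / d) ^ 2) • 1 := by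
    intro x y
    obtain ⟨h, hx, hx'⟩ := S.exists_decomp β hu hu' x
    obtain ⟨h', hy, hy'⟩ := S.exists_decomp β hu hu' y
    have h1 := commSum_eq_smul S.ker_le_range S.commutator_mem_ker (S.chr_repN_mem α hθ) hcN hT'
      (S.eD h) (S.eD h') (S.idxB β (S.prB (S.π x))) (S.idxB β (S.prB (S.π y)))
    rw [← hx, ← hy, hc, hc, hx', hy', Fintype.card_fin] at h1
    rw [repN, h1]
    congr 3
    rw [sub_eq_add_neg, add_comm, _root_.zpow_add, neg_mul_eq_mul_neg, mul_comm (Nat.cast _) (-_),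
      _root_.zpow_mul, _root_.zpow_mul, _root_.zpow_neg, zpow_natCast, zpow_natCast, zpow_natCast,
      zpow_natCast]
  rw [Psi_eq_prod S.commutator_mem_ker x y z _ fun i => key (x i) (y i), Finset.prod_mul_distrib,
    Finset.prod_const, Finset.card_univ, Fintype.card_fin, ← pow_mul, ← Units.coe_prod]
  congr 3
  rw [pairingZ, zpow_finset_sum]
  rfl

/-- The contribution of the tuple of characters `ξ^i η`. -/
theorem Psi_chi [NeZero S.B] {η : G₀ → ℂ} (hη : η ∈ Irr G₀)
    (hζ : Subgroup.zpowers ζ = stabC S.π₀ η) (hξ : ξ ^ A ∈ stabC S.π₀ η)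
    {g : ℕ} (x y : Fin g → G) (z : H A S.π₀)
    (hxy : (Subgroup.closure (Set.range (S.π ∘ x) ∪ Set.range (S.π ∘ y))).map S.prB = ⊤)
    {b₀ : K₀} (hb₀ : S.q b₀ = S.genB β) [Decidable (∀ k, S.q k ∈ S.FB → ζ k = 1)] :
    Psi x y (S.eN z) (fun n : S.π.ker =>
        ∏ i, chi S.π₀ α ξ η i ((S.eN.symm n : G₀ ≀ᵣ F A).left i)) =
      if ∀ k, S.q k ∈ S.FB → ζ k = 1 then
        ((ξ b₀ ^ S.pairingZ α β (S.π ∘ x) (S.π ∘ y) : ℂˣ) : ℂ) *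
          ((Nat.card S.π.ker : ℂ) * orderOf ζ / η 1 ^ A) ^ (2 * g) *
          ∏ i, chi S.π₀ α ξ η i ((z : G₀ ≀ᵣ F A).left i)
      else 0 := by
  have hs := (orderOf_pos ζ).ne'
  have : NeZero (orderOf ζ) := ⟨hs⟩
  have := Fintype.ofFinite (rootsOfUnity (orderOf ζ) ℂ)
  obtain ⟨d, θ, hd, hirr, hsum, hfix, htw⟩ :=
    exists_pieces (ξ := ξ) (ζ := ζ) α S.π₀_surjective hη hζ hξ
  have hθ : ∀ ω, IsPiece S.π₀ α ξ ζ (θ ω) := fun ω => ⟨hirr ω, hfix ω, htw ω⟩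
  have h1 : (fun n : S.π.ker => ∏ i, chi S.π₀ α ξ η i ((S.eN.symm n : G₀ ≀ᵣ F A).left i)) =
      fun n => ∑ ω, 1 * chr (S.repN (θ ω)) n := by
    ext n
    obtain ⟨h, rfl⟩ := S.eN.surjective n
    rw [MulEquiv.symm_apply_apply, ← hsum]
    exact Finset.sum_congr rfl fun ω _ => by rw [one_mul, chr_repN]
  rw [h1, Psi_sum]
  split_ifs with htriv
  · rw [← hsum, Finset.mul_sum]
    refine Finset.sum_congr rfl fun ω _ => ?_
    have hs' : (orderOf ζ : ℂ) ≠ 0 := by exact_mod_cast hs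
    rw [one_mul, S.Psi_piece_eq α β (hθ ω) (hζ ▸ hξ) x y _ htriv hb₀, chr_repN, ← hd ω,
      mul_div_mul_right _ _ hs']
  · refine Finset.sum_eq_zero fun ω _ => ?_
    rw [S.Psi_piece_eq_zero α (hθ ω) x y _ hxy htriv, mul_zero]

end Setting

/-! ### Tuples that do not contribute -/

section TupleSymmetry

variable {A : ℕ} [NeZero A] {G₀ K₀ : Type*} [Group G₀] [CommGroup K₀] (π₀ : G₀ →* K₀)

/-- The translations of the indices which twist a tuple of functions by a linear character. -/
def tupleSymm (χ : F A → G₀ → ℂ) : Subgroup (F A) where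
  carrier := {a | ∃ ξ : K₀ →* ℂˣ, ∀ i, χ (a * i) = tw π₀ ξ (χ i)}
  one_mem' := ⟨1, fun i => by rw [one_mul, tw_one]⟩
  mul_mem' := by
    rintro a b ⟨ξ, hξ⟩ ⟨ξ', hξ'⟩
    exact ⟨ξ * ξ', fun i => by rw [mul_assoc, hξ, hξ', tw_mul]⟩
  inv_mem' := by
    rintro a ⟨ξ, hξ⟩
    refine ⟨ξ⁻¹, fun i => ?_⟩
    have h1 := hξ (a⁻¹ * i)
    rw [mul_inv_cancel_left] at h1
    rw [h1, ← tw_mul, show ξ⁻¹ * ξ = 1 from inv_mul_cancel ξ, tw_one]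

variable {π₀} {n : F A → ℕ}

/-- The restriction to `H` of an outer tensor product of representations. -/
def tensRep (R : ∀ i, G₀ →* Matrix (Fin (n i)) (Fin (n i)) ℂ) :
    H A π₀ →* Matrix (∀ i, Fin (n i)) (∀ i, Fin (n i)) ℂ where
  toFun h := tens fun i => R i ((h : G₀ ≀ᵣ F A).left i)
  map_one' := by simp [tens_one]
  map_mul' s t := by
    rw [H_left_mul, tens_mul]
    simp

theorem chr_tensRep (R : ∀ i, G₀ →* Matrix (Fin (n i)) (Fin (n i)) ℂ) (h : H A π₀) :
    chr (tensRep R) h = ∏ i, chr (R i) ((h : G₀ ≀ᵣ F A).left i) := trace_tens _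

theorem conjNormal_left (w : G₀ ≀ᵣ F A) (h : H A π₀) (i : F A) :
    ((MulAut.conjNormal w h : H A π₀) : G₀ ≀ᵣ F A).left i =
      w.left i * (h : G₀ ≀ᵣ F A).left (w.right⁻¹ * i) * (w.left i)⁻¹ := by
  have := H_right π₀ h
  simp [MulAut.conjNormal_apply, this]

/-- An element of the wreath product fixing a common constituent permutes a tuple of irreducible
characters up to a twist. -/
theorem right_mem_tupleSymm [Finite G₀] [Finite K₀] (hπ₀ : Function.Surjective π₀)
    (R : ∀ i, G₀ →* Matrix (Fin (n i)) (Fin (n i)) ℂ) (hR : ∀ i, chr (R i) ∈ Irr G₀)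
    {θ : H A π₀ → ℂ} (hθ : θ ∈ Irr (H A π₀)) (hne : ip (chr (tensRep (π₀ := π₀) R)) θ ≠ 0)
    {w : G₀ ≀ᵣ F A} (hw : ∀ h, θ (MulAut.conjNormal w h) = θ h) :
    w.right ∈ tupleSymm π₀ fun i => chr (R i) := by
  classical
  have := Fintype.ofFinite (K₀ →* ℂˣ)
  have h1 : ip (chr ((tensRep (π₀ := π₀) R).comp (MulAut.conjNormal w).toMonoidHom)) θ ≠ 0 := by
    rw [← ip_comp_mulEquiv (MulAut.conjNormal w : MulAut (H A π₀)), funext hw] at hne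
    exact hne
  have h2 := ip_ne_zero_of_common _ _ hθ h1 hne
  have h3 : chr ((tensRep (π₀ := π₀) R).comp (MulAut.conjNormal w).toMonoidHom) =
      fun h : H A π₀ => ∏ i, chr (R (w.right * i)) ((h : G₀ ≀ᵣ F A).left i) := by
    ext h
    change chr (tensRep R) (MulAut.conjNormal w h) = _
    rw [chr_tensRep]
    refine (Fintype.prod_equiv (Equiv.mulLeft w.right) _ _ fun i => ?_).symm
    rw [Equiv.coe_mulLeft, conjNormal_left, inv_mul_cancel_left, chr, chr, map_mul, map_mul,
      Matrix.trace_mul_comm, ← mul_assoc, ← map_mul, inv_mul_cancel, map_one, one_mul]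
  rw [h3, show chr (tensRep (π₀ := π₀) R) = fun h : H A π₀ => ∏ i, chr (R i)
    ((h : G₀ ≀ᵣ F A).left i) from funext (chr_tensRep R), ip_H_tuple hπ₀ (fun i => chr (R (w.right * i)))
    (fun i => chr (R i))] at h2
  obtain ⟨ξ, -, hξ⟩ := Finset.exists_ne_zero_of_sum_ne_zero h2
  rw [Finset.prod_ne_zero_iff] at hξ
  refine ⟨ξ⁻¹, fun i => ?_⟩
  have h4 := hξ i (Finset.mem_univ i)
  rw [ip_of_mem_Irr (tw_mem_Irr _ _ (hR _)) (hR _)] at h4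
  have h5 : tw π₀ ξ (chr (R (w.right * i))) = chr (R i) := by
    by_contra h6
    exact h4 (if_neg h6)
  change chr (R (w.right * i)) = tw π₀ ξ⁻¹ (chr (R i))
  rw [← h5, ← tw_mul, show ξ⁻¹ * ξ = 1 from inv_mul_cancel ξ, tw_one]

end TupleSymmetry

namespace Setting

variable {A : ℕ} [NeZero A] {G₀ K₀ Kbar G K : Type*} [Group G₀] [CommGroup K₀]
  [CommGroup Kbar] [Group G] [CommGroup K] (S : Setting A G₀ K₀ Kbar G K)
  [Finite G₀] [Finite K₀] [Finite G] [Fintype S.π.ker]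

/-- A tuple of irreducible characters contributes only if translating its indices amounts to a twist
by a linear character of `K₀`. -/
theorem mem_tupleSymm_of_Psi_ne_zero {χ : F A → G₀ → ℂ} (hχ : ∀ i, χ i ∈ Irr G₀)
    {g : ℕ} (x y : Fin g → G) (z : S.π.ker)
    (hxy : (Subgroup.closure (Set.range (S.π ∘ x) ∪ Set.range (S.π ∘ y))).map S.prA = ⊤)
    (hne : Psi x y z (fun n : S.π.ker => ∏ i, χ i ((S.eN.symm n : G₀ ≀ᵣ F A).left i)) ≠ 0)
    (a : F A) : a ∈ tupleSymm S.π₀ χ := by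
  choose n R hR using fun i => exists_matrix_of_mem_Irr (hχ i)
  obtain rfl : (fun i => chr (R i)) = χ := funext hR
  have h1 : (fun n : S.π.ker => ∏ i, chr (R i) ((S.eN.symm n : G₀ ≀ᵣ F A).left i)) =
      fun n => ∑ θ ∈ irrFinset S.π.ker,
        ip (chr ((tensRep R).comp S.eN.symm.toMonoidHom)) θ * θ n := by
    ext n
    rw [← chr_eq_sum_ip]
    exact (chr_tensRep R _).symm
  rw [h1, Psi_sum] at hne
  obtain ⟨θ, hθ, hne⟩ := Finset.exists_ne_zero_of_sum_ne_zero hne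
  rw [mem_irrFinset] at hθ
  obtain ⟨m, σ, rfl⟩ := exists_matrix_of_mem_Irr hθ
  have hip := left_ne_zero_of_mul hne
  have hPsi := right_ne_zero_of_mul hne
  have hfix : ∀ i, chr (conjRep σ (x i)) = chr σ ∧ chr (conjRep σ (y i)) = chr σ := by
    by_contra! h
    obtain ⟨i, hi⟩ := h
    exact hPsi (Psi_eq_zero S.commutator_mem_ker hθ x y z ⟨i, not_and_or.1 fun h' => hi h'.1 h'.2⟩)
  have hθ' : (fun h => chr σ (S.eN h)) ∈ Irr (H A S.π₀) := chr_comp_mem_Irr S.eN hθ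
  have hip' : ip (chr (tensRep (π₀ := S.π₀) R)) (fun h => chr σ (S.eN h)) ≠ 0 := by
    rw [← ip_comp_mulEquiv S.eN] at hip
    convert hip using 2
    ext h
    simp [chr]
  have key : ∀ x : G, chr (conjRep σ x) = chr σ →
      S.prA (S.π x) ∈ tupleSymm S.π₀ fun i => chr (R i) := by
    intro x hx
    obtain ⟨k, hk⟩ := S.q_surjective (S.j (S.π x)).2
    obtain ⟨w, hw, -⟩ := S.exists_compat x k hk
    have hr : S.prA (S.π x) = w.right := congrArg Prod.fst hw
    rw [hr]
    refine right_mem_tupleSymm S.π₀_surjective R hχ hθ' hip' fun h => ?_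
    rw [← S.conj_N hw hθ', ← chr_conjRep, hx]
  -- the elements fixing a constituent permute the tuple up to twists, and they generate a group onto `F_A`
  have hle : Subgroup.closure (Set.range (S.π ∘ x) ∪ Set.range (S.π ∘ y)) ≤
      (tupleSymm S.π₀ fun i => chr (R i)).comap S.prA := by
    rw [Subgroup.closure_le]
    rintro _ (⟨i, rfl⟩ | ⟨i, rfl⟩)
    · exact key _ (hfix i).1
    · exact key _ (hfix i).2
  rw [← Subgroup.map_le_iff_le_comap, hxy] at hle
  exact hle trivial

end Setting

/-! ### Solutions as a sum over characters -/

section Tuples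

variable {A : ℕ} [NeZero A] {G₀ K₀ : Type*} [Group G₀] [CommGroup K₀] {π₀ : G₀ →* K₀}
  (α : F A ≃* Multiplicative (ZMod A))

theorem tw_pow_zero (ξ : K₀ →* ℂˣ) (η : G₀ → ℂ) : tw π₀ (ξ ^ 0) η = η := by
  ext x
  simp [tw]

theorem tw_pow_succ (ξ : K₀ →* ℂˣ) (k : ℕ) (η : G₀ → ℂ) :
    tw π₀ (ξ ^ (k + 1)) η = tw π₀ ξ (tw π₀ (ξ ^ k) η) := by
  ext x
  simp only [tw, MonoidHom.pow_apply, pow_succ', Units.val_mul, mul_assoc]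

omit [NeZero A] in
theorem chi_one_right (ξ : K₀ →* ℂˣ) (η : G₀ → ℂ) : chi π₀ α ξ η 1 = η := by
  rw [chi, idx_one, tw_pow_zero]

theorem chi_gen_mul {ξ : K₀ →* ℂˣ} {η : G₀ → ℂ} (h : ξ ^ A ∈ stabC π₀ η) (i : F A) :
    chi π₀ α ξ η (gen α * i) = tw π₀ ξ (chi π₀ α ξ η i) := by
  rw [chi, chi, ← tw_pow_succ, idx_gen_mul]
  split_ifs with hi
  · rw [tw_pow_zero, hi, Nat.sub_add_cancel NeZero.one_le, (mem_stabC π₀).1 h]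
  · rfl

/-- A tuple whose index shift is a twist by `ξ` consists of the twists of its first entry by the powers
of `ξ`. -/
theorem eq_chi_of_gen_mul {χ : F A → G₀ → ℂ} {ξ : K₀ →* ℂˣ}
    (h : ∀ i, χ (gen α * i) = tw π₀ ξ (χ i)) :
    ξ ^ A ∈ stabC π₀ (χ 1) ∧ chi π₀ α ξ (χ 1) = χ := by
  have h1 : ∀ k : ℕ, χ (gen α ^ k) = tw π₀ (ξ ^ k) (χ 1) := by
    intro k
    induction k with
    | zero => rw [pow_zero, tw_pow_zero]
    | succ k ih => rw [pow_succ', h, ih, tw_pow_succ]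
  constructor
  · rw [mem_stabC, ← h1, gen_pow_A]
  · ext1 i
    rw [chi, ← h1, gen_pow_idx]

/-- Two twists give the same tuple exactly when they differ by an element of the stabilizer. -/
theorem chi_eq_chi_iff {ξ ξ' : K₀ →* ℂˣ} {η : G₀ → ℂ} (h : ξ ^ A ∈ stabC π₀ η) :
    (ξ' ^ A ∈ stabC π₀ η ∧ chi π₀ α ξ' η = chi π₀ α ξ η) ↔ ξ⁻¹ * ξ' ∈ stabC π₀ η := by
  constructor
  · rintro ⟨h1, h2⟩
    have h3 := congrFun h2 (gen α * 1)
    rw [chi_gen_mul α h1, chi_gen_mul α h, chi_one_right, chi_one_right] at h3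
    exact (tw_eq_tw_iff π₀ ξ ξ' η).1 h3.symm
  · intro h1
    have h2 : ∀ k : ℕ, (ξ ^ k)⁻¹ * ξ' ^ k ∈ stabC π₀ η := by
      intro k
      convert (stabC π₀ η).pow_mem h1 k using 1
      ext1 x
      simp only [MonoidHom.mul_apply, MonoidHom.pow_apply, MonoidHom.inv_apply, mul_pow, inv_pow]
    constructor
    · have h3 := (stabC π₀ η).mul_mem h (h2 A)
      convert h3 using 1
      ext1 x
      simp only [MonoidHom.mul_apply, MonoidHom.inv_apply, mul_inv_cancel_left]
    · ext1 i
      exact ((tw_eq_tw_iff π₀ _ _ η).2 (h2 _)).symm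

open Classical in
/-- A sum over tuples of irreducible characters, supported on those whose index shift is a twist, as a
sum over a character `η` and a twist `ξ`; each tuple arises from `|Stab η|` twists. -/
theorem sum_tuples_eq [Finite G₀] [Finite K₀] [Fintype (K₀ →* ℂˣ)] (X : (F A → G₀ → ℂ) → ℂ)
    (hX : ∀ χ, (∀ i, χ i ∈ Irr G₀) → X χ ≠ 0 → ∃ ξ : K₀ →* ℂˣ, ∀ i, χ (gen α * i) = tw π₀ ξ (χ i)) :
    ∑ χ ∈ Fintype.piFinset (fun _ : F A => irrFinset G₀), X χ =
      ∑ η ∈ irrFinset G₀, ∑ ξ : K₀ →* ℂˣ, if ξ ^ A ∈ stabC π₀ η then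
        (Nat.card (stabC π₀ η) : ℂ)⁻¹ * X (chi π₀ α ξ η) else 0 := by
  have h1 : ∀ χ ∈ Fintype.piFinset (fun _ : F A => irrFinset G₀), X χ =
      ∑ η ∈ irrFinset G₀, ∑ ξ : K₀ →* ℂˣ, if chi π₀ α ξ η = χ then
        (if ξ ^ A ∈ stabC π₀ η then (Nat.card (stabC π₀ η) : ℂ)⁻¹ * X χ else 0) else 0 := by
    intro χ hχ
    rw [Fintype.mem_piFinset] at hχ
    by_cases h0 : X χ = 0
    · simp [h0]
    obtain ⟨ξ₀, hξ₀⟩ := hX χ (fun i => mem_irrFinset.1 (hχ i)) h0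
    obtain ⟨h2, h3⟩ := eq_chi_of_gen_mul α hξ₀
    rw [Finset.sum_eq_single (χ 1)]
    · have h4 : ∀ ξ : K₀ →* ℂˣ, (if chi π₀ α ξ (χ 1) = χ then
          (if ξ ^ A ∈ stabC π₀ (χ 1) then (Nat.card (stabC π₀ (χ 1)) : ℂ)⁻¹ * X χ else 0) else 0) =
          if ξ₀⁻¹ * ξ ∈ stabC π₀ (χ 1) then (Nat.card (stabC π₀ (χ 1)) : ℂ)⁻¹ * X χ else 0 := by
        intro ξ
        rw [← ite_and]
        refine if_congr ?_ rfl rfl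
        rw [← chi_eq_chi_iff α h2, h3, and_comm]
      rw [Finset.sum_congr rfl fun ξ _ => h4 ξ,
        show (∑ ξ : K₀ →* ℂˣ, if ξ₀⁻¹ * ξ ∈ stabC π₀ (χ 1) then
          (Nat.card (stabC π₀ (χ 1)) : ℂ)⁻¹ * X χ else 0) = ∑ ξ : K₀ →* ℂˣ,
            if ξ ∈ stabC π₀ (χ 1) then (Nat.card (stabC π₀ (χ 1)) : ℂ)⁻¹ * X χ else 0 from
          Fintype.sum_equiv (Equiv.mulLeft ξ₀⁻¹) _ _ fun ξ => rfl,
        ← Finset.sum_filter, Finset.sum_const, nsmul_eq_mul, ← mul_assoc,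
        ← Fintype.card_subtype, ← Nat.card_eq_fintype_card]
      rw [mul_inv_cancel₀ (natCard_ne_zero (Γ := stabC π₀ (χ 1))), one_mul]
    · intro η _ hη
      refine Finset.sum_eq_zero fun ξ _ => if_neg fun h4 => hη ?_
      rw [← h4, chi_one_right]
    · exact fun h => absurd (hχ 1) h
  rw [Finset.sum_congr rfl h1, Finset.sum_comm]
  refine Finset.sum_congr rfl fun η hη => ?_
  rw [Finset.sum_comm]
  refine Finset.sum_congr rfl fun ξ _ => ?_
  rw [Finset.sum_ite_eq, if_pos]
  rw [Fintype.mem_piFinset]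
  exact fun i => mem_irrFinset.2 (tw_mem_Irr _ _ (mem_irrFinset.1 hη))

end Tuples

namespace Setting

variable {A : ℕ} [NeZero A] {G₀ K₀ Kbar G K : Type*} [Group G₀] [CommGroup K₀]
  [CommGroup Kbar] [Group G] [CommGroup K] (S : Setting A G₀ K₀ Kbar G K)
  [Finite G₀] [Finite K₀] [Finite G] [Fintype S.π.ker]

omit [Finite G₀] [Finite K₀] [Finite G] in
open Classical in
/-- The number of solutions as a sum over two families of cosets of `H`. -/
theorem ncard_solutions {g : ℕ} (x y : Fin g → G) (z : Hhat A S.π₀) :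
    ((S.solutions z (S.π ∘ x) (S.π ∘ y)).ncard : ℂ) =
      Psi x y (S.ι z) fun n : S.π.ker => if n = 1 then 1 else 0 := by
  have h1 : ∀ v : G, extZ S.π.ker (fun n => if n = 1 then (1 : ℂ) else 0) v =
      if v = 1 then 1 else 0 := by
    intro v
    by_cases hv : v ∈ S.π.ker
    · rw [extZ_of_mem _ hv]
      exact if_congr (Subgroup.mk_eq_one _) rfl rfl
    · rw [extZ, dif_neg hv, if_neg]
      rintro rfl
      exact hv S.π.ker.one_mem
  simp only [Psi, h1]
  rw [Finset.sum_boole, ← Set.ncard_coe_finset]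
  congr 1
  symm
  let φ : (Fin g → S.π.ker × S.π.ker) → (Fin g → G) × (Fin g → G) :=
    fun p => (fun i => x i * (p i).1, fun i => y i * (p i).2)
  have hφ : Function.Injective φ := by
    intro p p' h
    ext i
    · exact mul_left_cancel (congrFun (congrArg Prod.fst h) i)
    · exact mul_left_cancel (congrFun (congrArg Prod.snd h) i)
  rw [← Set.ncard_image_of_injective _ hφ]
  congr 1
  ext ⟨X, Y⟩
  constructor
  · rintro ⟨p, hp, hpX⟩
    obtain ⟨rfl, rfl⟩ := Prod.ext_iff.1 hpX
    refine ⟨(Finset.mem_filter.1 hp).2, fun i => ?_, fun i => ?_⟩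
    · simp only [φ, map_mul, MonoidHom.mem_ker.1 (p i).1.2, mul_one, Function.comp_apply]
    · simp only [φ, map_mul, MonoidHom.mem_ker.1 (p i).2.2, mul_one, Function.comp_apply]
  · rintro ⟨h2, h3, h4⟩
    refine ⟨fun i => (⟨(x i)⁻¹ * X i, ?_⟩, ⟨(y i)⁻¹ * Y i, ?_⟩), ?_, ?_⟩
    · have := h3 i
      simp only at this
      rw [MonoidHom.mem_ker, map_mul, map_inv, this, Function.comp_apply, inv_mul_cancel]
    · have := h4 i
      simp only at this
      rw [MonoidHom.mem_ker, map_mul, map_inv, this, Function.comp_apply, inv_mul_cancel]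
    · rw [Finset.mem_coe, Finset.mem_filter]
      refine ⟨Finset.mem_univ _, ?_⟩
      simp only [mul_inv_cancel_left]
      exact h2
    · simp [φ]

omit [Finite K₀] [Finite G] in
open Classical in
/-- Column orthogonality for `G₀^A` turns the number of solutions into a sum over tuples of irreducible
characters. -/
theorem card_mul_ncard_solutions {g : ℕ} (x y : Fin g → G) (z : Hhat A S.π₀) :
    (Nat.card G₀ : ℂ) ^ A * (S.solutions z (S.π ∘ x) (S.π ∘ y)).ncard =
      ∑ χ ∈ Fintype.piFinset (fun _ : F A => irrFinset G₀), (∏ i, χ i 1) *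
        Psi x y (S.ι z) (fun n : S.π.ker => ∏ i, χ i ((S.eN.symm n : G₀ ≀ᵣ F A).left i)) := by
  rw [← Psi_sum, ncard_solutions]
  have h1 : (fun n : S.π.ker => ∑ χ ∈ Fintype.piFinset (fun _ : F A => irrFinset G₀),
      (∏ i, χ i 1) * ∏ i, χ i ((S.eN.symm n : G₀ ≀ᵣ F A).left i)) =
      fun n => ∑ _i ∈ Finset.univ (α := Unit), (Nat.card G₀ : ℂ) ^ A * if n = 1 then 1 else 0 := by
    ext n
    simp only [← Finset.prod_mul_distrib]
    rw [← Finset.prod_univ_sum (fun _ => irrFinset G₀)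
      (fun i θ => θ 1 * θ ((S.eN.symm n : G₀ ≀ᵣ F A).left i)),
      Finset.prod_congr rfl fun i _ => sum_irr_one_mul _]
    simp only [Finset.univ_unique, Finset.sum_singleton]
    by_cases hn : n = 1
    · subst hn
      rw [if_pos rfl, map_one, mul_one]
      simp
    · rw [if_neg hn, mul_zero]
      by_contra hne
      rw [← ne_eq, Finset.prod_ne_zero_iff] at hne
      apply hn
      rw [← S.eN.symm.map_eq_one_iff]
      ext1
      refine RegularWreathProduct.ext (funext fun i => ?_) (H_right S.π₀ _)
      by_contra h2
      exact hne i (Finset.mem_univ i) (if_neg h2)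
  rw [h1, Psi_sum]
  simp

end Setting

/-! ### Cyclic groups and divisibility -/

section Cyclic

variable {C : Type*} [CommGroup C] [IsCyclic C] [Finite C]

/-- A finite cyclic group has only one subgroup of each order. -/
theorem mem_iff_pow_card_eq_one (T : Subgroup C) (x : C) : x ∈ T ↔ x ^ Nat.card T = 1 := by
  have h1 : T = (powMonoidHom (Nat.card T) : C →* C).ker := by
    refine Subgroup.eq_of_le_of_card_ge (fun x hx => ?_) ?_
    · have := pow_card_eq_one' (x := (⟨x, hx⟩ : T))
      exact congrArg Subtype.val this
    · rw [IsCyclic.card_powMonoidHom_ker]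
      exact Nat.le_of_dvd Nat.card_pos (Nat.gcd_dvd_right _ _)
  conv_lhs => rw [h1]
  rfl

/-- A subgroup of index `m` of a finite cyclic group consists of the `m`-th powers. -/
theorem mem_iff_exists_pow (T : Subgroup C) (x : C) :
    x ∈ T ↔ ∃ c : C, c ^ (Nat.card C / Nat.card T) = x := by
  have hdvd := Subgroup.card_subgroup_dvd_card T
  have h1 : (powMonoidHom (Nat.card C / Nat.card T) : C →* C).range = T := by
    refine Subgroup.eq_of_le_of_card_ge ?_ ?_
    · rintro _ ⟨c, rfl⟩
      rw [mem_iff_pow_card_eq_one, powMonoidHom_apply, ← pow_mul, Nat.div_mul_cancel hdvd,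
        pow_card_eq_one']
    · rw [IsCyclic.card_powMonoidHom_range, Nat.gcd_eq_right (Nat.div_dvd_of_dvd hdvd),
        Nat.div_div_self hdvd Nat.card_pos.ne']
  conv_lhs => rw [← h1]
  rfl

end Cyclic

section CyclicDual

variable {K₀ Kbar : Type*} [CommGroup K₀] [CommGroup Kbar] [Finite K₀]
  {q : K₀ →* Kbar}

instance [IsCyclic K₀] : IsCyclic (K₀ →* ℂˣ) :=
  isCyclic_of_surjective (CommGroup.monoidHom_mulEquiv_of_hasEnoughRootsOfUnity K₀ ℂ).some.symm
    (MulEquiv.surjective _)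

omit [Finite K₀] in
/-- A character of `K₀` which factors through a cyclic quotient is trivial above a subgroup if and only
if its power by the index of the subgroup is trivial. -/
theorem trivial_above_iff [IsCyclic Kbar] [Finite Kbar] (hq : Function.Surjective q)
    (T : Subgroup Kbar) {ζ : K₀ →* ℂˣ} (hζ : ∀ k, q k = 1 → ζ k = 1) (p : ℤ) :
    (∀ k, q k ∈ T → ζ k ^ p = 1) ↔
      ∀ k, ζ k ^ (p * (Nat.card Kbar / Nat.card T : ℕ)) = 1 := by
  constructor
  · intro h k
    have := h (k ^ (Nat.card Kbar / Nat.card T)) (by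
      rw [mem_iff_exists_pow]
      exact ⟨q k, (map_pow q _ _).symm⟩)
    rwa [map_pow, ← zpow_natCast, ← _root_.zpow_mul, mul_comm] at this
  · intro h k hk
    rw [mem_iff_exists_pow] at hk
    obtain ⟨c, hc⟩ := hk
    obtain ⟨k', rfl⟩ := hq c
    have h1 : ζ (k * (k' ^ (Nat.card Kbar / Nat.card T))⁻¹) = 1 := by
      apply hζ
      rw [map_mul, map_inv, map_pow, hc, mul_inv_cancel]
    rw [map_mul, map_inv, mul_inv_eq_one] at h1
    rw [h1, map_pow, ← zpow_natCast, ← _root_.zpow_mul, mul_comm, h]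

/-- A group of characters of a cyclic group is cyclic, so its exponent is its order. -/
theorem forall_zpow_eq_one_iff [IsCyclic K₀] (M : Subgroup (K₀ →* ℂˣ)) (p : ℤ) :
    (∀ ξ ∈ M, ∀ k, ξ k ^ p = 1) ↔ (Nat.card M : ℤ) ∣ p := by
  have hnat : ∀ v : ℂˣ, v ^ p = 1 ↔ v ^ p.natAbs = 1 := fun v => by
    rw [← orderOf_dvd_iff_zpow_eq_one, ← orderOf_dvd_iff_pow_eq_one, Int.natCast_dvd]
  simp only [hnat, Int.natCast_dvd]
  constructor
  · intro h
    obtain ⟨μ, hμ⟩ := IsCyclic.exists_generator (α := M)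
    rw [← orderOf_eq_card_of_forall_mem_zpowers hμ, orderOf_dvd_iff_pow_eq_one]
    ext1
    ext1 k
    exact h μ μ.2 k
  · rintro ⟨r, hr⟩ ξ hξ k
    have h1 : (⟨ξ, hξ⟩ : M) ^ p.natAbs = 1 := by rw [hr, pow_mul, pow_card_eq_one', one_pow]
    exact DFunLike.congr_fun (congrArg Subtype.val h1) k

omit [Finite K₀] in
open Classical in
/-- The sum of the values at a point of the `p`-th powers of a group of characters. -/
theorem sum_zpow_apply [Fintype (K₀ →* ℂˣ)] (M : Subgroup (K₀ →* ℂˣ)) (b : K₀) (p : ℤ) :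
    ∑ ξ : K₀ →* ℂˣ, (if ξ ∈ M then ((ξ b ^ p : ℂˣ) : ℂ) else 0) =
      if ∀ ξ ∈ M, ξ b ^ p = 1 then (Nat.card M : ℂ) else 0 := by
  let f : M →* ℂ := (Units.coeHom ℂ).comp
    ((zpowGroupHom p).comp ((MonoidHom.eval b).comp M.subtype))
  have h1 := sum_hom_units f
  rw [← Finset.sum_filter, Finset.sum_subtype (p := fun ξ => ξ ∈ M) _ (by simp)]
  refine h1.trans ?_
  rw [Nat.card_eq_fintype_card]
  have h2 : f = 1 ↔ ∀ ξ ∈ M, ξ b ^ p = 1 := by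
    constructor
    · intro h ξ hξ
      have h3 : f ⟨ξ, hξ⟩ = 1 := by rw [h, MonoidHom.one_apply]
      exact Units.ext h3
    · intro h
      ext ξ
      exact congrArg Units.val (h ξ ξ.2)
  simp only [h2]
  split_ifs <;> simp

end CyclicDual

section Arithmetic

/-- The numerical content of the condition `e_A(η) ∣ Δ(a,b)`. -/
theorem dvd_mul_iff_dvd_div_addOrderOf {A s k m B : ℕ} (hA : A ≠ 0) (hm : m ∣ k) (hm0 : m ≠ 0)
    (hs : s ∣ m) (hk : Nat.gcd (A * s) k ∣ m * B) (p : ℤ) :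
    (Nat.gcd (A * s) k : ℤ) ∣ p * m ↔
      Nat.gcd (A * s) k / Nat.gcd (A * s) m ∣
        Nat.gcd A B / addOrderOf (p : ZMod (Nat.gcd A B)) := by
  set r := Nat.gcd (A * s) m with hr
  have hr0 : 0 < r := Nat.gcd_pos_of_pos_right _ (Nat.pos_of_ne_zero hm0)
  have hD0 : Nat.gcd A B ≠ 0 := fun h => hA (Nat.gcd_eq_zero_iff.1 h).1
  have hgcd : Nat.gcd (Nat.gcd (A * s) k) m = r := by
    rw [Nat.gcd_assoc, Nat.gcd_eq_right hm]
  obtain ⟨e, he⟩ : r ∣ Nat.gcd (A * s) k := hgcd ▸ Nat.gcd_dvd_left _ _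
  obtain ⟨m', hm'⟩ : r ∣ m := Nat.gcd_dvd_right _ _
  have hcop : Nat.Coprime e m' := by
    rw [he, hm', Nat.gcd_mul_left] at hgcd
    exact Nat.eq_of_mul_eq_mul_left hr0 (by rw [mul_one]; exact hgcd)
  -- `r` is the greatest common divisor of `|M| = r e` and `m = r m'`, so `e` and `m'` are coprime
  have hcancel : ∀ x : ℕ, r * e ∣ m * x → e ∣ x := by
    intro x hx
    rw [hm', mul_assoc] at hx
    exact hcop.dvd_of_dvd_mul_left (Nat.dvd_of_mul_dvd_mul_left hr0 hx)
  have heB : e ∣ B := hcancel B (he ▸ hk)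
  have heA : e ∣ A := hcancel A (by
    rw [← he]
    refine (Nat.gcd_dvd_left _ _).trans ?_
    rw [mul_comm m]
    exact Nat.mul_dvd_mul_left _ hs)
  have heD : e ∣ Nat.gcd A B := Nat.dvd_gcd heA heB
  rw [he, Nat.mul_div_cancel_left _ hr0]
  have hlhs : ((r * e : ℕ) : ℤ) ∣ p * m ↔ (e : ℤ) ∣ p := by
    rw [hm', Int.natCast_dvd, Int.natAbs_mul, Int.natAbs_natCast, mul_left_comm,
      Nat.mul_dvd_mul_iff_left hr0, hcop.dvd_mul_right, Int.natCast_dvd]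
  rw [hlhs]
  have ht : addOrderOf (p : ZMod (Nat.gcd A B)) ∣ Nat.gcd A B := by
    rw [addOrderOf_dvd_iff_nsmul_eq_zero, nsmul_eq_mul, CharP.cast_eq_zero, zero_mul]
  set D := Nat.gcd A B
  obtain ⟨D', hD'⟩ := heD
  have hD'0 : D' ≠ 0 := fun h => hD0 (by rw [hD', h, mul_zero])
  have he0 : e ≠ 0 := fun h => hD0 (by rw [hD', h, zero_mul])
  have h1 : ∀ t : ℕ, t * e ∣ D ↔ t ∣ D' := fun t => by
    rw [hD', mul_comm e, Nat.mul_dvd_mul_iff_right (Nat.pos_of_ne_zero he0)]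
  have h2 : (D' : ZMod D) * (p : ZMod D) = ((D' * p : ℤ) : ZMod D) := by push_cast; rfl
  rw [Nat.dvd_div_iff_mul_dvd ht, h1, addOrderOf_dvd_iff_nsmul_eq_zero, nsmul_eq_mul, h2,
    ZMod.intCast_zmod_eq_zero_iff_dvd]
  rw [show (D : ℤ) = D' * e by rw [hD', Nat.cast_mul, mul_comm],
    mul_dvd_mul_iff_left (by exact_mod_cast hD'0)]

end Arithmetic

/-! ### The sum over the twists of a character -/

section TwistGroup

variable {G₀ K₀ : Type*} [Group G₀] [CommGroup K₀] [IsCyclic K₀] [Finite K₀] (π₀ : G₀ →* K₀)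

/-- The group of linear characters of `K₀` whose `A`-th power stabilizes `η`. -/
def twistGroup (A : ℕ) (η : G₀ → ℂ) : Subgroup (K₀ →* ℂˣ) :=
  (stabC π₀ η).comap (powMonoidHom A)

omit [IsCyclic K₀] [Finite K₀] in
theorem mem_twistGroup {A : ℕ} {η : G₀ → ℂ} {ξ : K₀ →* ℂˣ} :
    ξ ∈ twistGroup π₀ A η ↔ ξ ^ A ∈ stabC π₀ η := Iff.rfl

/-- The stabilizer is the group of all characters of order dividing its order, so the condition on `ξ^A` is
a condition on the order of `ξ`. -/
theorem twistGroup_eq_ker (A : ℕ) (η : G₀ → ℂ) :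
    twistGroup π₀ A η = (powMonoidHom (A * Nat.card (stabC π₀ η)) : (K₀ →* ℂˣ) →* _).ker := by
  ext ξ
  rw [MonoidHom.mem_ker, powMonoidHom_apply, pow_mul, ← mem_iff_pow_card_eq_one]
  rfl

theorem card_twistGroup (A : ℕ) (η : G₀ → ℂ) :
    Nat.card (twistGroup π₀ A η) = Nat.gcd (A * Nat.card (stabC π₀ η)) (Nat.card K₀) := by
  rw [twistGroup_eq_ker]
  refine (IsCyclic.card_powMonoidHom_ker (G := K₀ →* ℂˣ) _).trans ?_
  rw [CommGroup.card_monoidHom_of_hasEnoughRootsOfUnity, Nat.gcd_comm]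

omit [IsCyclic K₀] in
theorem card_stabC_dvd (η : G₀ → ℂ) : Nat.card (stabC π₀ η) ∣ Nat.card K₀ := by
  rw [← CommGroup.card_monoidHom_of_hasEnoughRootsOfUnity K₀ ℂ]
  exact Subgroup.card_subgroup_dvd_card _

/-- The product of the twisted characters at a tuple of `gcd(AN, |K₀|)`-th powers does not depend on the
twist. -/
theorem prod_chi_eq_of_root {A : ℕ} [NeZero A] (α : F A ≃* Multiplicative (ZMod A)) {N : ℕ}
    {η : G₀ → ℂ} (hN : Nat.card (stabC π₀ η) ∣ N) {ξ : K₀ →* ℂˣ} (hξ : ξ ^ A ∈ stabC π₀ η)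
    {z w : F A → G₀} (hw : ∀ i, w i ^ Nat.gcd (A * N) (Nat.card K₀) = z i) :
    ∏ i, chi π₀ α ξ η i (z i) = ∏ i, η (z i) := by
  refine Finset.prod_congr rfl fun i _ => ?_
  have h1 : orderOf ξ ∣ Nat.gcd (A * N) (Nat.card K₀) := by
    have h2 : ξ ^ (A * Nat.card (stabC π₀ η)) = 1 :=
      (pow_mul ξ _ _).trans ((mem_iff_pow_card_eq_one _ _).1 hξ)
    refine Nat.dvd_gcd ((orderOf_dvd_of_pow_eq_one h2).trans (Nat.mul_dvd_mul_left _ hN)) ?_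
    rw [← CommGroup.card_monoidHom_of_hasEnoughRootsOfUnity K₀ ℂ]
    exact orderOf_dvd_natCard ξ
  have h3 : ξ ^ Nat.gcd (A * N) (Nat.card K₀) = 1 := orderOf_dvd_iff_pow_eq_one.1 h1
  have h4 : ξ (π₀ (z i)) = 1 := by
    rw [← hw, map_pow, map_pow]
    exact DFunLike.congr_fun h3 (π₀ (w i))
  simp only [chi, tw, MonoidHom.pow_apply, h4, one_pow, Units.val_one, one_mul]

end TwistGroup

namespace Setting

variable {A : ℕ} [NeZero A] {G₀ K₀ Kbar G K : Type*} [Group G₀] [CommGroup K₀]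
  [CommGroup Kbar] [Group G] [CommGroup K] (S : Setting A G₀ K₀ Kbar G K)
  (α : F A ≃* Multiplicative (ZMod A)) (β : S.FB ≃* Multiplicative (ZMod S.B))

theorem finite_Kbar (S : Setting A G₀ K₀ Kbar G K) [Finite K₀] : Finite Kbar :=
  Finite.of_surjective _ S.q_surjective

theorem isCyclic_Kbar (S : Setting A G₀ K₀ Kbar G K) [IsCyclic K₀] : IsCyclic Kbar :=
  isCyclic_of_surjective S.q S.q_surjective

/-- `pairingZ` lifts the pairing. -/
theorem pairing_eq_intCast [NeZero S.B] {g : ℕ} (a b : Fin g → K) :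
    S.pairing α β a b = (S.pairingZ α β a b : ZMod (Nat.gcd A S.B)) := by
  simp only [pairing, pairingZ, idx, idxB, ZMod.castHom_apply, Int.cast_sum, Int.cast_sub,
    Int.cast_mul, Int.cast_natCast]
  simp only [ZMod.natCast_val]

variable [Finite G₀] [Finite K₀] [IsCyclic K₀] {η : G₀ → ℂ}

omit [Finite G₀] in
theorem exists_generator_stabC (η : G₀ → ℂ) :
    ∃ ζ : K₀ →* ℂˣ, Subgroup.zpowers ζ = stabC S.π₀ η :=
  (Subgroup.isCyclic_iff_exists_zpowers_eq_top (stabC S.π₀ η)).1 inferInstance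

/-- The twists of `η` by which the tuples `ξ^i η` arise are characters of `K̄₀`. -/
theorem twistGroup_factors (hη : η ∈ Irr G₀) {ξ : K₀ →* ℂˣ} (hξ : ξ ∈ twistGroup S.π₀ A η) {k : K₀}
    (hk : S.q k = 1) : ξ k = 1 := by
  obtain ⟨ζ, hζ⟩ := S.exists_generator_stabC η
  have : NeZero (orderOf ζ) := ⟨(orderOf_pos ζ).ne'⟩
  have := Fintype.ofFinite (rootsOfUnity (orderOf ζ) ℂ)
  obtain ⟨d, θ, hd, hirr, hsum, hfix, htw⟩ :=
    exists_pieces (ξ := ξ) (ζ := ζ) (MulEquiv.refl (F A)) S.π₀_surjective hη hζ hξ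
  exact S.twist_eq_one_of_q_eq_one _ (θ := θ 1) ⟨hirr 1, hfix 1, htw 1⟩ (hζ ▸ hξ) hk

/-- Triviality of the stabilizer above `F_B` in terms of orders. -/
theorem trivial_above_FB_iff (hη : η ∈ Irr G₀) {ζ : K₀ →* ℂˣ}
    (hζ : Subgroup.zpowers ζ = stabC S.π₀ η) :
    (∀ k, S.q k ∈ S.FB → ζ k = 1) ↔ Nat.card (stabC S.π₀ η) ∣ Nat.card Kbar / S.B := by
  have := S.finite_Kbar
  have := S.isCyclic_Kbar
  -- in particular the stabilizer itself consists of characters of `K̄₀`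
  have hζ' : ζ ∈ twistGroup S.π₀ A η := (stabC S.π₀ η).pow_mem (hζ ▸ Subgroup.mem_zpowers ζ) A
  have h1 := trivial_above_iff S.q_surjective S.FB
    (fun k => S.twistGroup_factors hη hζ') 1
  simp only [zpow_one, one_mul, zpow_natCast] at h1
  rw [h1, ← hζ, Nat.card_zpowers, orderOf_dvd_iff_pow_eq_one]
  constructor
  · intro h
    ext1 k
    exact h k
  · intro h k
    exact DFunLike.congr_fun h k

/-- The condition on the pairing under which the twists of a character do not cancel. -/
theorem eA_dvd_Delta_iff (hη : η ∈ Irr G₀) [NeZero S.B] {b₀ : K₀} (hb₀ : S.q b₀ = S.genB β)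
    (hs : Nat.card (stabC S.π₀ η) ∣ Nat.card Kbar / S.B) {g : ℕ} (a b : Fin g → K) :
    (∀ ξ ∈ twistGroup S.π₀ A η, ξ b₀ ^ S.pairingZ α β a b = 1) ↔ S.eA η ∣ S.Delta α β a b := by
  have := S.finite_Kbar
  have := S.isCyclic_Kbar
  set p := S.pairingZ α β a b with hp
  have hBdvd : S.B ∣ Nat.card Kbar := Subgroup.card_subgroup_dvd_card S.FB
  have hKdvd : Nat.card Kbar ∣ Nat.card K₀ := Subgroup.card_dvd_of_surjective S.q S.q_surjective
  -- a character of `K̄₀` is determined on `F_B` by its value at the generator, and `F_B` is the group of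
  -- `|K̄₀| / B`-th powers
  have h1 : (∀ ξ ∈ twistGroup S.π₀ A η, ξ b₀ ^ p = 1) ↔
      ∀ ξ ∈ twistGroup S.π₀ A η, ∀ k, ξ k ^ (p * (Nat.card Kbar / S.B : ℕ)) = 1 := by
    refine forall₂_congr fun ξ hξ => ?_
    have hξ' : ∀ k, S.q k = 1 → ξ k = 1 := fun k => S.twistGroup_factors hη hξ
    refine Iff.trans ?_ (trivial_above_iff S.q_surjective S.FB hξ' p)
    refine ⟨fun h k hk => ?_, fun h => h b₀ (hb₀ ▸ (S.genB β).2)⟩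
    have h2 : S.q (k * (b₀ ^ S.idxB β ⟨S.q k, hk⟩)⁻¹) = 1 := by
      rw [map_mul, map_inv, map_pow, hb₀, ← Subgroup.coe_pow, genB_pow_idxB, mul_inv_cancel]
    have h3 := hξ' _ h2
    rw [map_mul, map_inv, mul_inv_eq_one, map_pow] at h3
    rw [h3, ← zpow_natCast, ← _root_.zpow_mul, mul_comm, _root_.zpow_mul, h, _root_.one_zpow]
  rw [h1, forall_zpow_eq_one_iff, card_twistGroup, Delta, eA, pairing_eq_intCast, ← hp,
    Nat.card_zmultiples]
  refine dvd_mul_iff_dvd_div_addOrderOf (B := S.B) (NeZero.ne A)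
    ((Nat.div_dvd_of_dvd hBdvd).trans hKdvd) ?_ hs ?_ p
  · exact (Nat.div_pos (Nat.le_of_dvd Nat.card_pos hBdvd) (Nat.pos_of_ne_zero (NeZero.ne S.B))).ne'
  · rw [Nat.div_mul_cancel hBdvd, ← card_twistGroup, ← Int.natCast_dvd_natCast,
      ← forall_zpow_eq_one_iff]
    intro ξ hξ k
    rw [zpow_natCast, ← map_pow]
    apply S.twistGroup_factors hη hξ
    rw [map_pow, pow_card_eq_one']

variable [Finite G] [Fintype S.π.ker] [Fintype (K₀ →* ℂˣ)]

open Classical in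
/-- The contribution of an irreducible character of `G₀`, summed over its twists. -/
theorem sum_twists_eq [NeZero S.B] (hη : η ∈ Irr G₀) {N : ℕ} (hN : Nat.card (stabC S.π₀ η) ∣ N)
    {g : ℕ} (x y : Fin g → G) (z : H A S.π₀) {w : F A → G₀}
    (hw : ∀ i, w i ^ Nat.gcd (A * N) (Nat.card K₀) = (z : G₀ ≀ᵣ F A).left i)
    (hxy : (Subgroup.closure (Set.range (S.π ∘ x) ∪ Set.range (S.π ∘ y))).map S.prB = ⊤) :
    (∑ ξ : K₀ →* ℂˣ, if ξ ^ A ∈ stabC S.π₀ η then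
      (Nat.card (stabC S.π₀ η) : ℂ)⁻¹ * ((∏ i, chi S.π₀ α ξ η i 1) *
        Psi x y (S.eN z) (fun n : S.π.ker =>
          ∏ i, chi S.π₀ α ξ η i ((S.eN.symm n : G₀ ≀ᵣ F A).left i))) else 0) =
      if η ∈ S.irrAB α β (S.π ∘ x) (S.π ∘ y) then
        (Nat.card (stabC S.π₀ η) : ℂ)⁻¹ * η 1 ^ A *
          ((Nat.card S.π.ker : ℂ) * Nat.card (stabC S.π₀ η) / η 1 ^ A) ^ (2 * g) *
          (∏ i, η ((z : G₀ ≀ᵣ F A).left i)) *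
          Nat.gcd (A * Nat.card (stabC S.π₀ η)) (Nat.card K₀)
      else 0 := by
  obtain ⟨ζ, hζ⟩ := S.exists_generator_stabC η
  obtain ⟨b₀, hb₀⟩ := S.q_surjective (S.genB β)
  have hcard : orderOf ζ = Nat.card (stabC S.π₀ η) := by rw [← hζ, Nat.card_zpowers]
  have hone : ∀ ξ : K₀ →* ℂˣ, ∏ i : F A, chi S.π₀ α ξ η i 1 = η 1 ^ A := by
    intro ξ
    have h1 : ∀ i : F A, chi S.π₀ α ξ η i 1 = η 1 := fun i => by simp [chi, tw]
    rw [Finset.prod_congr rfl fun i _ => h1 i, Finset.prod_const, Finset.card_univ,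
      (Fintype.card_multiplicative _).trans (ZMod.card A)]
  by_cases hs : Nat.card (stabC S.π₀ η) ∣ Nat.card Kbar / S.B
  · have htriv := (S.trivial_above_FB_iff hη hζ).2 hs
    set C : ℂ := (Nat.card (stabC S.π₀ η) : ℂ)⁻¹ * η 1 ^ A *
          ((Nat.card S.π.ker : ℂ) * Nat.card (stabC S.π₀ η) / η 1 ^ A) ^ (2 * g) *
          (∏ i, η ((z : G₀ ≀ᵣ F A).left i)) with hC
    have h2 : ∀ ξ : K₀ →* ℂˣ, (if ξ ^ A ∈ stabC S.π₀ η then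
        (Nat.card (stabC S.π₀ η) : ℂ)⁻¹ * ((∏ i, chi S.π₀ α ξ η i 1) *
          Psi x y (S.eN z) (fun n : S.π.ker =>
            ∏ i, chi S.π₀ α ξ η i ((S.eN.symm n : G₀ ≀ᵣ F A).left i))) else 0) =
        C * if ξ ∈ twistGroup S.π₀ A η then
          ((ξ b₀ ^ S.pairingZ α β (S.π ∘ x) (S.π ∘ y) : ℂˣ) : ℂ) else 0 := by
      intro ξ
      rw [mem_twistGroup]
      split_ifs with hξ
      · rw [S.Psi_chi α β hη hζ hξ x y z hxy hb₀, if_pos htriv, hone,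
          prod_chi_eq_of_root S.π₀ α hN hξ hw, hcard, hC]
        ring
      · rw [mul_zero]
    rw [Finset.sum_congr rfl fun ξ _ => h2 ξ, ← Finset.mul_sum, sum_zpow_apply, card_twistGroup,
      mul_ite, mul_zero]
    refine if_congr ?_ rfl rfl
    rw [S.eA_dvd_Delta_iff α β hη hb₀ hs]
    exact ⟨fun h => ⟨hη, hs, h⟩, fun h => h.2.2⟩
  · rw [if_neg fun h => hs h.2.1]
    refine Finset.sum_eq_zero fun ξ _ => ?_
    split_ifs with hξ
    · rw [S.Psi_chi α β hη hζ hξ x y z hxy hb₀, if_neg (mt (S.trivial_above_FB_iff hη hζ).1 hs),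
        mul_zero, mul_zero]
    · rfl

end Setting

end BlockLike

theorem mainTheorem8 {A : ℕ} [NeZero A] {G₀ K₀ Kbar G K : Type*} [Group G₀] [Finite G₀]
    [CommGroup K₀] [IsCyclic K₀] [CommGroup Kbar] [Group G] [Finite G] [CommGroup K]
    (S : BlockLike.Setting A G₀ K₀ Kbar G K)
    (α : BlockLike.F A ≃* Multiplicative (ZMod A)) (β : S.FB ≃* Multiplicative (ZMod S.B))
    (K' : Subgroup K) (hK'A : K'.map S.prA = ⊤) (hK'B : K'.map S.prB = ⊤)
    (N : ℕ) (hN : ∀ η ∈ BlockLike.Irr G₀, Nat.card (S.stab η) ∣ N)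
    (z : G₀ ≀ᵣ BlockLike.F A) (hz : z ∈ BlockLike.H A S.π₀)
    (hroot : ∃ w : BlockLike.F A → G₀, ∀ i, w i ^ Nat.gcd (A * N) (Nat.card K₀) = z.left i)
    (g : ℕ) (hg : 0 < g) (a b : Fin g → K)
    (hab : Subgroup.closure (Set.range a ∪ Set.range b) = K') :
    ((S.solutions ⟨z, BlockLike.H_le_Hhat A S.π₀ hz⟩ a b).ncard : ℂ) =
      ∑ η ∈ (S.finite_irrAB α β a b).toFinset,
        (Nat.gcd A (Nat.card K₀ / Nat.card (S.stab η)) : ℂ) *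
          ((Nat.card (S.stab η) : ℂ) / (Nat.card K₀ : ℂ)) ^ (2 * g) *
          ((Nat.card G₀ : ℂ) / η 1) ^ (A * (2 * g - 1)) *
          ∏ i, η (z.left i) := by
  classical
  have := S.finite_K₀
  have := S.finite_Kbar
  have := Fintype.ofFinite S.π.ker
  have := Fintype.ofFinite (K₀ →* ℂˣ)
  have : NeZero S.B := ⟨(Nat.card_pos (α := S.FB)).ne'⟩
  obtain ⟨w, hw⟩ := hroot
  choose x hx using fun i => S.π_surjective (a i)
  choose y hy using fun i => S.π_surjective (b i)
  obtain rfl : S.π ∘ x = a := funext hx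
  obtain rfl : S.π ∘ y = b := funext hy
  subst hab
  have hG : (Nat.card G₀ : ℂ) ≠ 0 := BlockLike.natCard_ne_zero
  have hK : (Nat.card K₀ : ℂ) ≠ 0 := BlockLike.natCard_ne_zero
  -- clear the factor `|G₀|^A` of column orthogonality; `x` and `y` are base points of the fibres of `π`
  apply mul_left_cancel₀ (pow_ne_zero A hG)
  have hz' : S.ι ⟨z, BlockLike.H_le_Hhat A S.π₀ hz⟩ = S.eN ⟨z, hz⟩ := rfl
  rw [S.card_mul_ncard_solutions, hz', BlockLike.sum_tuples_eq (π₀ := S.π₀) α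
    (fun χ => (∏ i, χ i 1) * BlockLike.Psi x y (S.eN ⟨z, hz⟩)
      (fun n : S.π.ker => ∏ i, χ i ((S.eN.symm n : G₀ ≀ᵣ BlockLike.F A).left i)))
    (fun χ hχ hne => S.mem_tupleSymm_of_Psi_ne_zero hχ x y _ hK'A (right_ne_zero_of_mul hne)
      (BlockLike.gen α)),
    Finset.sum_congr rfl fun η hη => S.sum_twists_eq α β (BlockLike.mem_irrFinset.1 hη)
      (hN η (BlockLike.mem_irrFinset.1 hη)) x y ⟨z, hz⟩ hw hK'B, ← Finset.sum_filter,
    Finset.mul_sum]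
  have hfilter : (BlockLike.irrFinset G₀).filter
      (fun η => η ∈ S.irrAB α β (S.π ∘ x) (S.π ∘ y)) =
      (S.finite_irrAB α β (S.π ∘ x) (S.π ∘ y)).toFinset := by
    ext η
    rw [Finset.mem_filter, Set.Finite.mem_toFinset, BlockLike.mem_irrFinset]
    exact and_iff_right_of_imp fun h => h.1
  rw [hfilter]
  refine Finset.sum_congr rfl fun η hη => ?_
  have hη1 : η 1 ≠ 0 := BlockLike.irr_one_ne_zero ((S.finite_irrAB α β _ _).mem_toFinset.1 hη).1
  change (Nat.card (S.stab η) : ℂ)⁻¹ * η 1 ^ A *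
          ((Nat.card S.π.ker : ℂ) * Nat.card (S.stab η) / η 1 ^ A) ^ (2 * g) *
          (∏ i, η (z.left i)) * Nat.gcd (A * Nat.card (S.stab η)) (Nat.card K₀) = _
  obtain ⟨r, hr⟩ := BlockLike.card_stabC_dvd S.π₀ η
  change Nat.card K₀ = Nat.card (S.stab η) * r at hr
  have hs0 : Nat.card (S.stab η) ≠ 0 := fun h => hK (by rw [hr, h, zero_mul, Nat.cast_zero])
  have hs : (Nat.card (S.stab η) : ℂ) ≠ 0 := by exact_mod_cast hs0
  have hgcd : (Nat.gcd (A * Nat.card (S.stab η)) (Nat.card K₀) : ℂ) =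
      Nat.card (S.stab η) * Nat.gcd A (Nat.card K₀ / Nat.card (S.stab η)) := by
    rw [hr, Nat.mul_div_cancel_left _ (Nat.pos_of_ne_zero hs0), mul_comm A, Nat.gcd_mul_left,
      Nat.cast_mul]
  have hH : (Nat.card S.π.ker : ℂ) = (Nat.card G₀ : ℂ) ^ A / Nat.card K₀ := by
    rw [eq_div_iff hK, ← Nat.card_congr S.eN.toEquiv]
    exact_mod_cast BlockLike.card_H_mul S.π₀ S.π₀_surjective
  -- `g > 0` makes the truncated subtraction in the exponent a true one
  obtain ⟨m, hm⟩ : ∃ m, 2 * g = m + 1 := ⟨2 * g - 1, by omega⟩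
  rw [hgcd, hH, hm, Nat.add_sub_cancel]
  have e1 : (Nat.card G₀ : ℂ) ^ A / Nat.card K₀ * Nat.card (S.stab η) / η 1 ^ A =
      (Nat.card (S.stab η) : ℂ) / Nat.card K₀ * ((Nat.card G₀ : ℂ) / η 1) ^ A := by
    rw [div_pow]
    ring
  have e2 : ((Nat.card G₀ : ℂ) / η 1) ^ A = (Nat.card G₀ : ℂ) ^ A / η 1 ^ A := div_pow _ _ _
  rw [e1, mul_pow, pow_mul, pow_succ (((Nat.card G₀ : ℂ) / η 1) ^ A)]
  nth_rw 2 [e2]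
  have hη2 := pow_ne_zero A hη1
  field_simp
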